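/- **Setting.** Let $\mathbb F$ be a field and let $D$ be the nearly plat front diagram of an oriented Legendrian link $L$: from left to right, $D$ consists of left cusps, then crossings, then right cusps, all with distinct $x$-coordinates, and $D$ is a small perturbation of a front whose left cusps share one $x$-coordinate and whose right cusps share one $x$-coordinate. Each component carries one marked point, located at a right cusp. Let $r(L)$ be the gcd of the rotation numbers of the components, let $\mu$ be a $\mathbb Z/2r(L)$-valued Maslov potential, and let $m\ge 0$ divide $2r(L)$. Strands of a vertical slice are numbered from top to bottom. The degree of a crossing is the difference of $\mu$ on its two strands; a crossing is *$m$-graded* if its degree is $0$ mod $m$. Diagrams and handleslides are considered up to planar isotopies that keep the left-to-right order of cusps, crossings and handleslides. **Normal rulings.** A normal ruling $\rho$ assigns to each slice of $D$ a fixed-point-free involution of its strands. At a cusp, the two cusp strands are paired and the pairing of the other strands is unchanged. At a crossing of strands $k,k+1$ these are not paired, and the involutions $\pi$ before and $\pi'$ after satisfy either $\pi'=(k\ k{+}1)\,\pi\,(k\ k{+}1)$, or $\pi'=\pi$ together with the normality condition: $\pi(k)<k<k+1<\pi(k+1)$ (S1), or $\pi(k+1)<\pi(k)<k$ (S2), or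 $k+1<\pi(k+1)<\pi(k)$ (S3). In the second case the crossing is a *switch*. A crossing that is not a switch is a *departure* if the normality condition holds for $\pi$, and a *return* if it holds for $\pi'$, i.e. $\pi(k+1)<k<k+1<\pi(k)$ (R1), or $\pi(k)<\pi(k+1)<k$ (R2), or $k+1<\pi(k)<\pi(k+1)$ (R3). The ruling is *$m$-graded* if all its switches are $m$-graded. **Morse complex sequences.** A handleslide $(i,j;r)$ is a vertical mark between strands $i<j$ with coefficient $r\in\mathbb F$. An MCS is a finite set of handleslides on $D$ together with a complex $(C,d)$, $d^2=0$, on each of the vertical lines that cut $D$ and the handleslides into tangles with exactly one crossing, cusp or handleslide. Here $C$ is free on the strands $e_1,e_2,\dots$ and $\langle de_i,e_j\rangle=0$ unless $i<j$. Let $(C,d)$ and $(C',d')$ be the complexes before and after a tangle. * Crossing of $k,k+1$: $\langle de_k,e_{k+1}\rangle=0$ on both sides, and the swap of $e_k$ and $e_{k+1}$ is an isomorphism $C\to C'$. * Handleslide $(i,j;r)$: $e_i\mapsto e_i-re_j$, $e_l\mapsto e_l$ ($l\ne i$) is an isomorphism $C\to C'$. * Right cusp of $k,k+1$: $\langle de_k,e_{k+1}\rangle=-1$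 (only required to be a unit if the cusp is marked), and $e_i\mapsto[e_i]$ ($i<k$), $e_i\mapsto[e_{i+2}]$ ($i\ge k$) is an isomorphism from $C'$ to $C/\langle e_k,de_k\rangle$. * Left cusp of $k,k+1$: $\langle d'e_k,e_{k+1}\rangle=1$, and the same formula is an isomorphism from $C$ to $C'/\langle e_k,d'e_k\rangle$. The left cusp is *simple* if $d'e_k=e_{k+1}$ and $\langle d'e_j,e_k\rangle=\langle d'e_j,e_{k+1}\rangle=0$ for $j<k$. The MCS is *$m$-graded* if every $d$ lowers $\mu$ mod $m$ by $1$ and each handleslide joins strands with equal $\mu$ mod $m$. *A-form.* An MCS is in A-form if left cusps are simple and its handleslides are exactly one handleslide of arbitrary coefficient between the crossing strands immediately before each $m$-graded crossing and, if $m=1$, one of arbitrary coefficient between the cusp strands immediately before each right cusp. Let $MCS^A_m(D;\mathbb F)$ be the set of $m$-graded MCSs in A-form. *SR-form.* An MCS is in SR-form compatible with a normal ruling $\rho$ if left cusps are simple and its handleslides are exactly the following. In the first two items $d_{ij}=\langle de_i,e_j\rangle$ for the complex just before the first handleslide listed and $\pi$ is the involution of $\rho$ before the crossing. * At a switch of $k,k+1$: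 $(k,k+1;r)$ with $r\ne0$ immediately before, and immediately after it $(k,k+1;-r^{-1})$, followed, for (S2) and (S3), by $(\pi(k+1),\pi(k);\,a r^{-1}b^{-1})$, where $(a,b)=(d_{\pi(k+1),k+1},d_{\pi(k),k})$ for (S2) and $(d_{k,\pi(k)},d_{k+1,\pi(k+1)})$ for (S3). * At an $m$-graded return: $(k,k+1;r)$ with $r\in\mathbb F$ immediately before, and immediately after it, for (R2), $(\pi(k),\pi(k+1);\,arb^{-1})$ with $(a,b)=(d_{\pi(k),k},d_{\pi(k+1),k+1})$ and, for (R3), $(\pi(k),\pi(k+1);\,a^{-1}rb)$ with $(a,b)=(d_{k,\pi(k)},d_{k+1,\pi(k+1)})$. * If $m=1$: one handleslide of arbitrary coefficient between the cusp strands immediately before each right cusp. Let $MCS^{SR}_m(D;\mathbb F)$ be the set of $m$-graded MCSs that are in SR-form compatible with some $m$-graded normal ruling of $D$. **Local moves.** Where there is no crossing or cusp: two adjacent handleslides, $(i_1,j_1;r_1)$ on the left and $(i_2,j_2;r_2)$ on the right, may be interchanged; if $j_1=i_2$ a new handleslide $(i_1,j_2;-r_1r_2)$ appears between them, and if $i_1=j_2$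 a new handleslide $(i_2,j_1;r_1r_2)$. Adjacent handleslides with equal endpoints merge, adding coefficients; trivial handleslides (coefficient $0$) and canceling pairs may be inserted. A collection is *properly ordered* if, from left to right, larger top strands come first and, for equal top strands, smaller bottom strands come first; the reverse of this is the *opposite order*. To *incorporate* a handleslide $h$ lying next to an ordered collection $V$, interchange $h$ with one handleslide of $V$ after the other, merging those created into $V$, until $h$ meets the (possibly trivial) handleslide of $V$ with the same endpoints, and merge the two. To *remove* a handleslide from $V$ to the left, interchange it in the same way with the handleslides to its left, merging those created into the rest of $V$. Except for a handleslide between the crossing strands, handleslides slide past a crossing, keeping their endpoints on the same strands of $D$. **Sweeps.** Move from left to right with an ordered collection $V$, empty at first, in opposite order for $\Phi$ and in proper order for $\Psi$. Incorporate into $V$, from the right, each handleslide that is met. At a crossing of $k,k+1$ that is not $m$-graded, slide $V$ past it. At an $m$-graded crossing, remove the $(k,k+1)$ handleslide from $V$ to the left, with coefficient $r$ ($0$ if absent), and slide the rest of $V$ past the crossing and reorder it. For $\Phi$, leave the handleslide $(k,k+1;r)$ behind. For $\Psi$, a ruling is built along the way, starting from the pairing of strands at the left cusps; it has no switch at crossings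 that are not $m$-graded. If the normality condition holds before an $m$-graded crossing and $r=0$, the crossing is a departure and no handleslide is left behind; if it holds and $r\neq0$, the crossing is a switch; otherwise it is a return. At a switch or return leave $(k,k+1;r)$ behind and introduce, immediately after the crossing, the further handleslides that SR-form demands, each together with a canceling handleslide on its right, which is incorporated into $V$ from the left; the $d_{ij}$ are those of the complex immediately to the left of $V$ and of the removed handleslide. At a right cusp of $k,k+1$, leave behind the handleslide of $V$ with endpoints $k,k+1$ (coefficient $0$ if absent) if $m=1$ and nothing if $m\neq1$, and erase all handleslides of $V$ with an endpoint on $k$ or $k+1$. **Theorem 6.1.** For $D$, $\mu$, $m$ as above, the sweeps define maps $$\Phi: MCS_m^{SR}(D;\mathbb F)\to MCS_m^{A}(D;\mathbb F),\qquad \Psi: MCS_m^{A}(D;\mathbb F)\to MCS_m^{SR}(D;\mathbb F):$$ the handleslides that result from the sweep of an $m$-graded SR-form (respectively A-form) MCS are the handleslides of an $m$-graded MCS in A-form (respectively SR-form, compatible with some $m$-graded normal ruling). Moreover $\Psi=\Phi^{-1}$, that is, $\Psi\circ\Phi$ and $\Phi\circ\Psi$ are the identity maps. -/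

import Mathlib

/-! ## Front diagrams

A front diagram in general position is recorded by the sequence of its cusps and crossings from left
to right.  Strands of a vertical slice are numbered from top to bottom, starting with `0`. -/

/-- The swap of the two strands `k` and `k + 1`. -/
def swapStrand (k i : ℕ) : ℕ := if i = k then k + 1 else if i = k + 1 then k else i

/-- Order preserving bijection from `ℕ` onto `ℕ` without `k` and `k + 1`. -/
def skipStrand (k i : ℕ) : ℕ := if i < k then i else i + 2

/-- The inverse of `skipStrand k` on its range. -/
def unskipStrand (k i : ℕ) : ℕ := if i < k then i else i - 2

/-- A cusp or a crossing of a front diagram, between the strands `k` and `k + 1` of the adjacent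
slice.  A right cusp also records whether it carries a marked point. -/
inductive FrontEvent where
  | leftCusp (k : ℕ)
  | crossing (k : ℕ)
  | rightCusp (k : ℕ) (marked : Bool)

namespace FrontEvent

/-- The number of strands to the right of an event with `n` strands to its left. -/
def next (n : ℕ) : FrontEvent → ℕ
  | leftCusp _ => n + 2
  | crossing _ => n
  | rightCusp _ _ => n - 2

/-- The event can take place when there are `n` strands to its left. -/
def Fits (n : ℕ) : FrontEvent → Prop
  | leftCusp k => k ≤ n
  | crossing k => k + 1 < n
  | rightCusp k _ => k + 1 < n

/-- Strand `i` to the left of the event continues as strand `j` to its right. -/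
def Continues (i j : ℕ) : FrontEvent → Prop
  | leftCusp k => j = skipStrand k i
  | crossing k => j = swapStrand k i
  | rightCusp k _ => i = skipStrand k j

end FrontEvent

/-- The number of strands in slice `p`, that is, between the events number `p - 1` and `p`. -/
def strandCount (E : List FrontEvent) (p : ℕ) : ℕ :=
  (E.take p).foldl (fun n e => e.next n) 0

/-- A strand of a slice: slice number and strand number. -/
abbrev FrontPoint (E : List FrontEvent) : Type :=
  (p : Fin (E.length + 1)) × Fin (strandCount E p)

/-- The strand `x` continues as the strand `y` of the next slice. -/
def ContinuesTo (E : List FrontEvent) (x y : FrontPoint E) : Prop :=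
  (y.1 : ℕ) = x.1 + 1 ∧ ∃ e, E[(x.1 : ℕ)]? = some e ∧ e.Continues x.2 y.2

/-- `x` is the upper strand of a left cusp that ends the strand to the left. -/
def IsUpperAtLeftCusp (E : List FrontEvent) (x : FrontPoint E) : Prop :=
  ∃ p : ℕ, (x.1 : ℕ) = p + 1 ∧ E[p]? = some (.leftCusp x.2)

/-- `x` is the upper strand of a right cusp that ends the strand to the right. -/
def IsUpperAtRightCusp (E : List FrontEvent) (x : FrontPoint E) : Prop :=
  ∃ b : Bool, E[(x.1 : ℕ)]? = some (.rightCusp x.2 b)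

/-- `x` is the upper strand of a right cusp with a marked point. -/
def IsUpperAtMarkedCusp (E : List FrontEvent) (x : FrontPoint E) : Prop :=
  E[(x.1 : ℕ)]? = some (.rightCusp x.2 true)

/-- `x` and `y` are the upper and the lower strand of a common cusp. -/
def MeetAtCusp (E : List FrontEvent) (x y : FrontPoint E) : Prop :=
  (IsUpperAtLeftCusp E x ∨ IsUpperAtRightCusp E x) ∧ y.1 = x.1 ∧ (y.2 : ℕ) = x.2 + 1

/-- The components of the link: classes of strands under continuation and meeting at cusps. -/
def FrontComponent (E : List FrontEvent) : Type :=
  Quot (fun x y : FrontPoint E => ContinuesTo E x y ∨ MeetAtCusp E x y)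

instance (E : List FrontEvent) : Finite (FrontComponent E) := by
  unfold FrontComponent; infer_instance

/-- The component through a strand. -/
def componentOf (E : List FrontEvent) (x : FrontPoint E) : FrontComponent E := Quot.mk _ x

/-- The front diagram of an oriented Legendrian link; each component has exactly one marked point,
and the marked points are located at right cusps. -/
structure Front where
  events : List FrontEvent
  fits : ∀ (p : ℕ) (hp : p < events.length), (events[p]).Fits (strandCount events p)
  closed : strandCount events events.length = 0
  /-- `true` when the strand is oriented to the right, `false` when it is oriented to the left. -/
  toRight : FrontPoint events → Bool
  toRight_continues : ∀ x y, ContinuesTo events x y → toRight x = toRight y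
  toRight_cusp : ∀ x y, MeetAtCusp events x y → toRight x ≠ toRight y
  marked : ∀ c : FrontComponent events,
    ∃! x, IsUpperAtMarkedCusp events x ∧ componentOf events x = c

namespace Front

/-- The number of strands in slice `p`. -/
def strands (D : Front) (p : ℕ) : ℕ := strandCount D.events p

open Classical in
/-- The rotation number of a component: half of the number of cusps that are traversed downwards
minus the number of cusps that are traversed upwards. -/
noncomputable def componentRotation (D : Front) (c : FrontComponent D.events) : ℤ :=
  (∑ x : FrontPoint D.events, if componentOf D.events x = c then
      (if IsUpperAtRightCusp D.events x then (if D.toRight x then 1 else -1) else 0)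
      + (if IsUpperAtLeftCusp D.events x then (if D.toRight x then -1 else 1) else 0)
    else 0) / 2

open Classical in
/-- The rotation number of the link: the greatest common divisor of those of the components. -/
noncomputable def rotationNumber (D : Front) : ℕ :=
  letI : Fintype (FrontComponent D.events) := Fintype.ofFinite _
  Finset.univ.gcd fun c => (D.componentRotation c).natAbs

/-- Nearly plat: a small perturbation of a front whose left cusps have a common `x`-coordinate and
whose right cusps have a common `x`-coordinate.  The left cusps, which are stacked on top of each
other, come first, in any order (so that each is created below an even number of strands), then the
crossings, and then the right cusps, likewise stacked on top of each other, in any order. -/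
def NearlyPlat (D : Front) : Prop :=
  ∃ E₁ E₂ E₃ : List FrontEvent, D.events = E₁ ++ E₂ ++ E₃ ∧
    (∀ e ∈ E₁, ∃ k, Even k ∧ e = .leftCusp k) ∧
    (∀ e ∈ E₂, ∃ k, e = .crossing k) ∧
    (∀ e ∈ E₃, ∃ k b, Even k ∧ e = .rightCusp k b)

/-- A Maslov potential.  `val p i` is the value on strand `i` of slice `p` (irrelevant when there is
no such strand). -/
structure MaslovPotential (D : Front) where
  val : ℕ → ℕ → ZMod (2 * D.rotationNumber)
  continues : ∀ x y : FrontPoint D.events, ContinuesTo D.events x y →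
    val x.1 x.2 = val y.1 y.2
  cusp : ∀ x y : FrontPoint D.events, MeetAtCusp D.events x y →
    val x.1 x.2 = val y.1 y.2 + 1

/-- The Maslov potential modulo `m`; used only when `m` divides twice the rotation number. -/
noncomputable def MaslovPotential.mod {D : Front} (μ : D.MaslovPotential) (m : ℕ) (p i : ℕ) : ZMod m :=
  (μ.val p i).cast

/-! ## Normal rulings -/

/-- The normality condition at a crossing of the strands `k` and `k + 1`, for the involution `π`. -/
def Normality (π : ℕ → ℕ) (k : ℕ) : Prop :=
  (π k < k ∧ k + 1 < π (k + 1)) ∨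
  (k + 1 < π (k + 1) ∧ π (k + 1) < π k) ∨
  (π (k + 1) < π k ∧ π k < k)

instance (π : ℕ → ℕ) (k : ℕ) : Decidable (Normality π k) := by
  unfold Normality; infer_instance

/-- The crossing of the strands `k` and `k + 1` that follows slice `p` is a switch of `ρ`. -/
def IsSwitch (D : Front) (ρ : ℕ → ℕ → ℕ) (p k : ℕ) : Prop :=
  (∀ i < D.strands p, ρ (p + 1) i = ρ p i) ∧ Normality (ρ p) k

/-- The crossing of the strands `k` and `k + 1` that follows slice `p` is a return of `ρ`. -/
def IsReturn (D : Front) (ρ : ℕ → ℕ → ℕ) (p k : ℕ) : Prop :=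
  ¬ D.IsSwitch ρ p k ∧ Normality (ρ (p + 1)) k

/-- The requirement on a normal ruling at the event `e` that follows slice `p`. -/
def RulingStep (D : Front) (ρ : ℕ → ℕ → ℕ) (p : ℕ) : FrontEvent → Prop
  | .leftCusp k => ρ (p + 1) k = k + 1 ∧
      ∀ i < D.strands p, ρ (p + 1) (skipStrand k i) = skipStrand k (ρ p i)
  | .rightCusp k _ => ρ p k = k + 1 ∧
      ∀ i < D.strands (p + 1), ρ p (skipStrand k i) = skipStrand k (ρ (p + 1) i)
  | .crossing k => ρ p k ≠ k + 1 ∧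
      ((∀ i < D.strands p, ρ (p + 1) i = swapStrand k (ρ p (swapStrand k i))) ∨
        D.IsSwitch ρ p k)

/-- A normal ruling; `ρ p` is the involution of the strands of slice `p` (the values of `ρ p` at
numbers that are not strands are irrelevant). -/
structure IsNormalRuling (D : Front) (ρ : ℕ → ℕ → ℕ) : Prop where
  lt : ∀ p ≤ D.events.length, ∀ i < D.strands p, ρ p i < D.strands p
  involutive : ∀ p ≤ D.events.length, ∀ i < D.strands p, ρ p (ρ p i) = i
  fixedPointFree : ∀ p ≤ D.events.length, ∀ i < D.strands p, ρ p i ≠ i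
  step : ∀ (p : ℕ) (hp : p < D.events.length), D.RulingStep ρ p D.events[p]

/-- The degree of the crossing of strands `k` and `k + 1` that follows slice `p` is `0` modulo `m`,
in terms of the Maslov potential `ν` modulo `m`. -/
def GradedCrossing {m : ℕ} (ν : ℕ → ℕ → ZMod m) (p k : ℕ) : Prop := ν p k - ν p (k + 1) = 0

instance {m : ℕ} (ν : ℕ → ℕ → ZMod m) (p k : ℕ) : Decidable (GradedCrossing ν p k) := by
  unfold GradedCrossing; infer_instance

/-- All switches of `ρ` have degree `0` modulo `m`. -/
def IsGradedRuling (D : Front) {m : ℕ} (ν : ℕ → ℕ → ZMod m) (ρ : ℕ → ℕ → ℕ) : Prop :=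
  ∀ p k, D.events[p]? = some (.crossing k) → D.IsSwitch ρ p k → GradedCrossing ν p k

end Front

/-! ## Morse complex sequences -/

/-- An ungraded complex, free on `n` strands, with strictly triangular differential. -/
structure StrandComplex (R : Type*) [CommRing R] where
  n : ℕ
  d : (Fin n → R) →ₗ[R] (Fin n → R)
  d_comp_d : d ∘ₗ d = 0
  triangular : ∀ i j : Fin n, d (Pi.single i 1) j ≠ 0 → i < j

namespace StrandComplex

variable {R : Type*} [CommRing R]

/-- The basis element of strand `i` (zero when there is no strand `i`). -/
def e (C : StrandComplex R) (i : ℕ) : Fin C.n → R := fun a => if (a : ℕ) = i then 1 else 0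

/-- The coefficient of `e j` in `d (e i)` (zero when there is no strand `j`). -/
def coeff (C : StrandComplex R) (i j : ℕ) : R :=
  if hj : j < C.n then C.d (C.e i) ⟨j, hj⟩ else 0

/-- The relation between the complexes at a cusp between strands `k` and `k + 1`, where `C` is on the
side of the cusp with more strands: the linear map with `e i ↦ [e i]` for `i < k` and
`e i ↦ [e (i + 2)]` for `i ≥ k` is an isomorphism of complexes from `C'` to the quotient of `C` by the
subcomplex spanned by `e k` and `d (e k)`. -/
def CuspRelated (C C' : StrandComplex R) (k : ℕ) : Prop :=
  ∃ φ : (Fin C'.n → R) ≃ₗ[R] ((Fin C.n → R) ⧸ Submodule.span R {C.e k, C.d (C.e k)}),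
    (∀ i < C'.n, φ (C'.e i) = Submodule.Quotient.mk (C.e (skipStrand k i))) ∧
    ∀ x y, φ x = Submodule.Quotient.mk y → φ (C'.d x) = Submodule.Quotient.mk (C.d y)

end StrandComplex

/-- A handleslide mark with endpoints on the strands `top < bot`. -/
structure Handleslide (R : Type*) where
  top : ℕ
  bot : ℕ
  coeff : R

/-- An elementary tangle: it contains a single cusp or crossing, or a single handleslide mark. -/
inductive ElemTangle (R : Type*) where
  | front (e : FrontEvent)
  | slide (h : Handleslide R)

/-- The cusp or crossing of an elementary tangle. -/
def ElemTangle.event? {R : Type*} : ElemTangle R → Option FrontEvent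
  | .front e => some e
  | .slide _ => none

/-- The number of cusps and crossings among the first `l` elementary tangles. -/
def sliceIndex {R : Type*} (T : List (ElemTangle R)) (l : ℕ) : ℕ :=
  ((T.take l).filterMap ElemTangle.event?).length

/-- The requirement on the complexes `C` and `C'` to the left and to the right of an elementary
tangle. -/
def TangleStep {R : Type*} [CommRing R] (C C' : StrandComplex R) : ElemTangle R → Prop
  | .front (.crossing k) =>
      C.coeff k (k + 1) = 0 ∧ C'.coeff k (k + 1) = 0 ∧
      ∃ φ : (Fin C.n → R) ≃ₗ[R] (Fin C'.n → R),
        (∀ i < C.n, φ (C.e i) = C'.e (swapStrand k i)) ∧ ∀ x, φ (C.d x) = C'.d (φ x)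
  | .slide h =>
      h.top < h.bot ∧ h.bot < C.n ∧
      ∃ φ : (Fin C.n → R) ≃ₗ[R] (Fin C'.n → R),
        (∀ i < C.n, φ (C.e i) =
          if i = h.top then C'.e h.top - h.coeff • C'.e h.bot else C'.e i) ∧
        ∀ x, φ (C.d x) = C'.d (φ x)
  | .front (.rightCusp k marked) =>
      (if marked then ∃ s : Rˣ, C.coeff k (k + 1) = -(s : R) else C.coeff k (k + 1) = -1) ∧
      C.CuspRelated C' k
  | .front (.leftCusp k) => C'.coeff k (k + 1) = 1 ∧ C'.CuspRelated C k

/-- A Morse complex sequence over `R` for the front `D`: handleslide marks, recorded by the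
decomposition into elementary tangles, and a complex on each of the vertical lines that bound these
tangles. -/
@[ext]
structure MCS (D : Front) (R : Type*) [CommRing R] where
  tangles : List (ElemTangle R)
  tangles_front : tangles.filterMap ElemTangle.event? = D.events
  cx : Fin (tangles.length + 1) → StrandComplex R
  cx_strands : ∀ l, (cx l).n = D.strands (sliceIndex tangles l)
  step : ∀ l : Fin tangles.length, TangleStep (cx l.castSucc) (cx l.succ) tangles[l]

namespace MCS

variable {D : Front} {R : Type*} [CommRing R]

/-- The coefficient of `e j` in `d (e i)` in the complex number `l`. -/
def coeffAt (C : MCS D R) (l i j : ℕ) : R :=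
  if hl : l < C.tangles.length + 1 then (C.cx ⟨l, hl⟩).coeff i j else 0

/-- The MCS is `m`-graded, for the Maslov potential `ν` modulo `m`. -/
def IsGraded (C : MCS D R) {m : ℕ} (ν : ℕ → ℕ → ZMod m) : Prop :=
  (∀ l : Fin (C.tangles.length + 1), ∀ i < (C.cx l).n, ∀ j < (C.cx l).n,
    (C.cx l).coeff i j ≠ 0 →
      ν (sliceIndex C.tangles l) j = ν (sliceIndex C.tangles l) i - 1) ∧
  ∀ l h, C.tangles[l]? = some (.slide h) →
    ν (sliceIndex C.tangles l) h.top = ν (sliceIndex C.tangles l) h.bot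

/-- All left cusps are simple. -/
def SimpleLeftCusps (C : MCS D R) : Prop :=
  ∀ (l : Fin C.tangles.length) (k : ℕ), C.tangles[l] = .front (.leftCusp k) →
    (C.cx l.succ).d ((C.cx l.succ).e k) = (C.cx l.succ).e (k + 1) ∧
    ∀ j < k, (C.cx l.succ).coeff j k = 0 ∧ (C.cx l.succ).coeff j (k + 1) = 0

end MCS

/-- The events `E` with handleslides inserted: `L p` immediately to the left of the event number `p`,
and `Q p` immediately to the right of it. -/
def assemble {R : Type*} (E : List FrontEvent) (L Q : ℕ → List (Handleslide R)) :
    List (ElemTangle R) :=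
  E.zipIdx.flatMap fun ep =>
    (L ep.2).map .slide ++ [.front ep.1] ++ (Q ep.2).map .slide

/-! ### A-form -/

/-- The handleslides to the left of the event that follows slice `p`, in an A-form MCS. -/
def AFormAt {R : Type*} {m : ℕ} (ν : ℕ → ℕ → ZMod m) (p : ℕ) (L : List (Handleslide R)) :
    FrontEvent → Prop
  | .leftCusp _ => L = []
  | .crossing k => if Front.GradedCrossing ν p k then ∃ r : R, L = [⟨k, k + 1, r⟩] else L = []
  | .rightCusp k _ => if m = 1 then ∃ r : R, L = [⟨k, k + 1, r⟩] else L = []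

/-- The MCS is in A-form. -/
def MCS.IsAForm {D : Front} {R : Type*} [CommRing R] (C : MCS D R) {m : ℕ}
    (ν : ℕ → ℕ → ZMod m) : Prop :=
  C.SimpleLeftCusps ∧
  ∃ L : ℕ → List (Handleslide R), C.tangles = assemble D.events L (fun _ => []) ∧
    ∀ (p : ℕ) (hp : p < D.events.length), AFormAt ν p (L p) D.events[p]

/-! ### SR-form -/

section SRForm

variable {F : Type*} [Field F]

/-- The handleslides to the right of a switch between the strands `k` and `k + 1`.  Here `π` is the
involution of the ruling and `d i j` is the coefficient of `e j` in `d (e i)`, both before the switch,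
and `r` is the coefficient of the handleslide to the left of the switch.  The three cases are the
switches of type (S1), (S2) and (S3). -/
def switchTail (π : ℕ → ℕ) (d : ℕ → ℕ → F) (k : ℕ) (r : F) : List (Handleslide F) :=
  if π k < k ∧ k + 1 < π (k + 1) then
    [⟨k, k + 1, -r⁻¹⟩]
  else if π (k + 1) < π k ∧ π k < k then
    [⟨k, k + 1, -r⁻¹⟩,
      ⟨π (k + 1), π k, d (π (k + 1)) (k + 1) * r⁻¹ * (d (π k) k)⁻¹⟩]
  else
    [⟨k, k + 1, -r⁻¹⟩,
      ⟨π (k + 1), π k, d k (π k) * r⁻¹ * (d (k + 1) (π (k + 1)))⁻¹⟩]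

/-- The handleslides to the right of a return between the strands `k` and `k + 1`, with the notation
of `switchTail`.  The three cases are the returns of type (R1), (R2) and (R3). -/
def returnTail (π : ℕ → ℕ) (d : ℕ → ℕ → F) (k : ℕ) (r : F) : List (Handleslide F) :=
  if π (k + 1) < k ∧ k + 1 < π k then
    []
  else if π k < π (k + 1) ∧ π (k + 1) < k then
    [⟨π k, π (k + 1), d (π k) k * r * (d (π (k + 1)) (k + 1))⁻¹⟩]
  else
    [⟨π k, π (k + 1), (d k (π k))⁻¹ * r * d (k + 1) (π (k + 1))⟩]

open Classical in
/-- The handleslides to the left and to the right of the event that follows slice `p`, in an MCS in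
SR-form compatible with `ρ`; `d` is the differential prior to these handleslides. -/
def SRFormAt (D : Front) {m : ℕ} (ν : ℕ → ℕ → ZMod m) (ρ : ℕ → ℕ → ℕ) (p : ℕ)
    (d : ℕ → ℕ → F) (L Q : List (Handleslide F)) : FrontEvent → Prop
  | .leftCusp _ => L = [] ∧ Q = []
  | .crossing k =>
      if D.IsSwitch ρ p k then
        ∃ r : F, r ≠ 0 ∧ L = [⟨k, k + 1, r⟩] ∧ Q = switchTail (ρ p) d k r
      else if D.IsReturn ρ p k ∧ Front.GradedCrossing ν p k then
        ∃ r : F, L = [⟨k, k + 1, r⟩] ∧ Q = returnTail (ρ p) d k r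
      else L = [] ∧ Q = []
  | .rightCusp k _ => (if m = 1 then ∃ r : F, L = [⟨k, k + 1, r⟩] else L = []) ∧ Q = []

/-- The MCS is in SR-form compatible with `ρ`. -/
def MCS.IsSRForm {D : Front} (C : MCS D F) {m : ℕ} (ν : ℕ → ℕ → ZMod m) (ρ : ℕ → ℕ → ℕ) : Prop :=
  C.SimpleLeftCusps ∧
  ∃ L Q : ℕ → List (Handleslide F), C.tangles = assemble D.events L Q ∧
    ∀ (p : ℕ) (hp : p < D.events.length),
      SRFormAt D ν ρ p (C.coeffAt (assemble (D.events.take p) L Q).length) (L p) (Q p) D.events[p]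

end SRForm

/-- The set of `m`-graded MCSs in A-form. -/
def AFormMCS {D : Front} (μ : D.MaslovPotential) (m : ℕ) (R : Type*) [CommRing R] :
    Set (MCS D R) :=
  {C | C.IsGraded (μ.mod m) ∧ C.IsAForm (μ.mod m)}

/-- The set of `m`-graded MCSs in SR-form, compatible with some `m`-graded normal ruling. -/
def SRFormMCS {D : Front} (μ : D.MaslovPotential) (m : ℕ) (F : Type*) [Field F] :
    Set (MCS D F) :=
  {C | C.IsGraded (μ.mod m) ∧
    ∃ ρ, D.IsNormalRuling ρ ∧ D.IsGradedRuling (μ.mod m) ρ ∧ C.IsSRForm (μ.mod m) ρ}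

/-! ## Collections of handleslides and local moves -/

section Moves

variable {F : Type*} [Field F]

/-- A collection of handleslides in a tangle without crossings and cusps, with at most one handleslide
for each pair of strands: `V i j` is the coefficient of the handleslide with endpoints `i < j`, and `0`
stands for a handleslide that is trivial or absent.  The positions of the handleslides are given by a
separate list of endpoints, from left to right. -/
abbrev SlideCollection (F : Type*) := ℕ → ℕ → F

/-- The endpoints of all handleslides between `n` strands, in the proper order from left to right:
larger top strand first and, for equal top strands, smaller bottom strand first. -/
def properOrder (n : ℕ) : List (ℕ × ℕ) :=
  (List.range n).reverse.flatMap fun t =>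
    ((List.range n).filter fun b => t < b).map fun b => (t, b)

/-- The handleslide that is created when `h₁` and `h₂` are interchanged, where `h₁` is to the left
of `h₂`. -/
def created (h₁ h₂ : Handleslide F) : List (Handleslide F) :=
  if h₁.bot = h₂.top then [⟨h₁.top, h₂.bot, -(h₁.coeff * h₂.coeff)⟩]
  else if h₁.top = h₂.bot then [⟨h₂.top, h₁.bot, h₁.coeff * h₂.coeff⟩]
  else []

/-- Merge `h` with the handleslide of `V` that has the same endpoints. -/
def mergeSlide (V : SlideCollection F) (h : Handleslide F) : SlideCollection F :=
  fun i j => if i = h.top ∧ j = h.bot then V i j + h.coeff else V i j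

/-- Incorporate the handleslide `h`, which is to the right of `V`, into `V`: move `h` to the left past
one handleslide after the other, merging those created on the way into `V`, until `h` reaches the
handleslide with the same endpoints, and merge these two. -/
def incorporateRight (order : List (ℕ × ℕ)) (V : SlideCollection F) (h : Handleslide F) :
    SlideCollection F :=
  mergeSlide
    ((order.reverse.takeWhile fun x => x ≠ (h.top, h.bot)).foldl
      (fun W x => (created ⟨x.1, x.2, W x.1 x.2⟩ h).foldl mergeSlide W) V) h

/-- Incorporate the handleslide `h`, which is to the left of `V`, into `V`. -/
def incorporateLeft (order : List (ℕ × ℕ)) (V : SlideCollection F) (h : Handleslide F) :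
    SlideCollection F :=
  mergeSlide
    ((order.takeWhile fun x => x ≠ (h.top, h.bot)).foldl
      (fun W x => (created h ⟨x.1, x.2, W x.1 x.2⟩).foldl mergeSlide W) V) h

/-- Remove the handleslide with endpoints `t` and `b` from `V`: it is moved to the left past one
handleslide after the other, merging those created on the way into `V`, until it is to the left
of `V`.  The result is the collection that remains. -/
def removeLeft (order : List (ℕ × ℕ)) (V : SlideCollection F) (t b : ℕ) : SlideCollection F :=
  let W := (order.takeWhile fun x => x ≠ (t, b)).reverse.foldl
    (fun W x => (created ⟨x.1, x.2, W x.1 x.2⟩ ⟨t, b, V t b⟩).foldl mergeSlide W) V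
  fun i j => if i = t ∧ j = b then 0 else W i j

/-- Move `V` to the right past the crossing of the strands `k` and `k + 1`; endpoints stay on the same
strands of the front. -/
def crossSlides (k : ℕ) (V : SlideCollection F) : SlideCollection F :=
  fun i j => V (swapStrand k i) (swapStrand k j)

/-- Erase the handleslides with an endpoint on `k` or `k + 1`, and move the other handleslides
of `V` to the right past the right cusp of the strands `k` and `k + 1`. -/
def cuspSlides (k : ℕ) (V : SlideCollection F) : SlideCollection F :=
  fun i j => V (skipStrand k i) (skipStrand k j)

/-! ## The map from SR-form to A-form -/

/-- The sweep from left to right that turns an SR-form MCS into an A-form MCS, starting in slice `p`,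
with `n` strands and with the collection `V`, which is ordered opposite to the proper order.
Handleslides that are met are incorporated into `V`.  The handleslide of the crossing strands is left
behind at an `m`-graded crossing and, when `m = 1`, at a right cusp. -/
def sweepToA {m : ℕ} (ν : ℕ → ℕ → ZMod m) :
    (p n : ℕ) → SlideCollection F → List (ElemTangle F) → List (ElemTangle F)
  | _, _, _, [] => []
  | p, n, V, .slide h :: T =>
      sweepToA ν p n (incorporateRight (properOrder n).reverse V h) T
  | p, n, _, .front (.leftCusp k) :: T =>
      .front (.leftCusp k) :: sweepToA ν (p + 1) (n + 2) 0 T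
  | p, n, V, .front (.crossing k) :: T =>
      if Front.GradedCrossing ν p k then
        .slide ⟨k, k + 1, V k (k + 1)⟩ :: .front (.crossing k) ::
          sweepToA ν (p + 1) n (crossSlides k (removeLeft (properOrder n).reverse V k (k + 1))) T
      else
        .front (.crossing k) :: sweepToA ν (p + 1) n (crossSlides k V) T
  | p, n, V, .front (.rightCusp k b) :: T =>
      (if m = 1 then [.slide ⟨k, k + 1, V k (k + 1)⟩] else []) ++
        .front (.rightCusp k b) :: sweepToA ν (p + 1) (n - 2) (cuspSlides k V) T

/-! ## The map from A-form to SR-form -/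

/-- The differential after an elementary tangle, in terms of the differential `d` before it, when left
cusps are simple; `d i j` is the coefficient of `e j` in `d (e i)`. -/
def nextDifferential (d : ℕ → ℕ → F) : ElemTangle F → ℕ → ℕ → F
  | .slide h => fun i j =>
      let d' : ℕ → ℕ → F := fun i j => if i = h.top then d i j + h.coeff * d h.bot j else d i j
      if j = h.bot then d' i j - h.coeff * d' i h.top else d' i j
  | .front (.crossing k) => fun i j => d (swapStrand k i) (swapStrand k j)
  | .front (.leftCusp k) => fun i j =>
      if i = k ∧ j = k + 1 then 1
      else if i = k ∨ i = k + 1 ∨ j = k ∨ j = k + 1 then 0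
      else d (unskipStrand k i) (unskipStrand k j)
  | .front (.rightCusp k _) => fun i j =>
      d (skipStrand k i) (skipStrand k j)
        - d (skipStrand k i) (k + 1) * (d k (k + 1))⁻¹ * d k (skipStrand k j)

/-- The involution of the ruling after an event at which there is no switch. -/
def nextInvolution (π : ℕ → ℕ) : FrontEvent → ℕ → ℕ
  | .crossing k => fun i => swapStrand k (π (swapStrand k i))
  | .leftCusp k => fun i =>
      if i = k then k + 1 else if i = k + 1 then k else skipStrand k (π (unskipStrand k i))
  | .rightCusp k _ => fun i => unskipStrand k (π (skipStrand k i))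

/-- Introduce, from left to right, each handleslide of `Q` to the left of `V`, together with a
canceling handleslide, which is incorporated into `V`. -/
def introduceSlides (order : List (ℕ × ℕ)) (V : SlideCollection F) (Q : List (Handleslide F)) :
    SlideCollection F :=
  Q.foldl (fun W h => incorporateLeft order W ⟨h.top, h.bot, -h.coeff⟩) V

/-- The sweep from left to right that turns an A-form MCS into an SR-form MCS, starting in slice `p`,
with `n` strands and with the properly ordered collection `V`.  Here `π` is the involution of the
ruling constructed so far, and `d` is the differential to the left of `V`.  Handleslides that are met
are incorporated into `V`.  At an `m`-graded crossing the handleslide of the crossing strands, of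
coefficient `r`, is removed from `V` to the left.  The crossing becomes a departure or a switch when
the normality condition holds before the crossing and `r` is zero or not, respectively, and otherwise a
return.  At switches and returns, the handleslides that SR-form demands are introduced. -/
def sweepToSR [DecidableEq F] {m : ℕ} (ν : ℕ → ℕ → ZMod m) :
    (p n : ℕ) → (π : ℕ → ℕ) → (d : ℕ → ℕ → F) → SlideCollection F →
      List (ElemTangle F) → List (ElemTangle F)
  | _, _, _, _, _, [] => []
  | p, n, π, d, V, .slide h :: T =>
      sweepToSR ν p n π d (incorporateRight (properOrder n) V h) T
  | p, n, π, d, _, .front (.leftCusp k) :: T =>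
      .front (.leftCusp k) ::
        sweepToSR ν (p + 1) (n + 2) (nextInvolution π (.leftCusp k))
          (nextDifferential d (.front (.leftCusp k))) 0 T
  | p, n, π, d, V, .front (.crossing k) :: T =>
      let r := V k (k + 1)
      let V' := crossSlides k (removeLeft (properOrder n) V k (k + 1))
      if ¬ Front.GradedCrossing ν p k then
        .front (.crossing k) ::
          sweepToSR ν (p + 1) n (nextInvolution π (.crossing k))
            (nextDifferential d (.front (.crossing k))) (crossSlides k V) T
      else if Front.Normality π k then
        if r = 0 then
          .front (.crossing k) ::
            sweepToSR ν (p + 1) n (nextInvolution π (.crossing k))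
              (nextDifferential d (.front (.crossing k))) V' T
        else
          let Q := switchTail π d k r
          let S := .slide ⟨k, k + 1, r⟩ :: .front (.crossing k) :: Q.map .slide
          S ++ sweepToSR ν (p + 1) n π (S.foldl nextDifferential d)
            (introduceSlides (properOrder n) V' Q) T
      else
        let Q := returnTail π d k r
        let S := .slide ⟨k, k + 1, r⟩ :: .front (.crossing k) :: Q.map .slide
        S ++ sweepToSR ν (p + 1) n (nextInvolution π (.crossing k)) (S.foldl nextDifferential d)
          (introduceSlides (properOrder n) V' Q) T
  | p, n, π, d, V, .front (.rightCusp k b) :: T =>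
      let S := (if m = 1 then [.slide ⟨k, k + 1, V k (k + 1)⟩] else []) ++
        [.front (.rightCusp k b)]
      S ++ sweepToSR ν (p + 1) (n - 2) (nextInvolution π (.rightCusp k b))
        (S.foldl nextDifferential d) (cuspSlides k V) T

end Moves

/-- The handleslide marks of the A-form MCS that is associated to the SR-form MCS `C`. -/
def MCS.phiTangles {F : Type*} [Field F] {D : Front} (C : MCS D F) {m : ℕ}
    (ν : ℕ → ℕ → ZMod m) : List (ElemTangle F) :=
  sweepToA ν 0 0 0 C.tangles

/-- The handleslide marks of the SR-form MCS that is associated to the A-form MCS `C`. -/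
def MCS.psiTangles {F : Type*} [Field F] [DecidableEq F] {D : Front} (C : MCS D F) {m : ℕ}
    (ν : ℕ → ℕ → ZMod m) : List (ElemTangle F) :=
  sweepToSR ν 0 0 id 0 0 C.tangles

/-! Passing a handleslide conjugates the matrix of the differential by an elementary unipotent
matrix. The two orders are chosen so that products of such matrices have no cross terms: a
collection `V` in the opposite order multiplies to `1 + V`, and the inverse of this product is the
properly ordered collection `-V`. Incorporating or removing a handleslide then becomes one row or
column operation. Consequently the collections carried by Φ and by Ψ are inverse to each other, and
both sweeps are governed by one recursion (`sweepState`) whose state consists of the involution, the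
SR-form differential and the collection `V` that separates the two MCSs.

At a graded crossing the SR-form coefficient `r` and the A-form coefficient `s` satisfy `s = V k (k
+ 1) + r`, and either one determines the next state. A free sequence `c` of coefficients thus yields
an SR-form list `srTangles` and an A-form list `aTangles`; by `sweepToA_block` and `sweepToSR_block`
each sweep turns one list into the other.

Both lists are MCSs under the same condition. An MCS with simple left cusps is determined by its
handleslides, since its differentials are computed from left to right starting with zero. Apart from
bounds on strand numbers, a list comes from an MCS exactly when `d k (k + 1)` has the required value
at every crossing and right cusp (`coeff_of_tangleStep`, `MCS.exists_of_good`). Conjugation by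
unipotent upper triangular matrices fixes the entries `(i, i + 1)`. Up to the first right cusp, `V`
intertwines the two differentials; beyond it, right cusps sit at even strands and it suffices to
compare the entries `(2 * l, 2 * l + 1)` (`ARel`).

On the SR side the invariant (`SRInv`) is that `d` is non-zero exactly at the pairs `i < π i`. The
handleslides of SR-form restore this shape: after a return `d` is what it would be without
handleslides, and after a switch its entries are rescaled (`diff_return`, `diff_switch`). For
unpaired crossing strands, normality holds either for `π` or for its conjugate by the transposition,
never for both, so normality and `r` decide between departure, switch and return. This gives a
normal ruling, and conversely every SR-form MCS arises from such a sequence `c`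
(`exists_eq_srTangles`). -/

set_option linter.unusedSectionVars false

/-! ## Strand differentials as matrices -/

section Differentials

variable {F : Type*} [Field F]

/-- The coefficients are supported on the pairs `i < j` of strands. -/
def StrictUpper (n : ℕ) (d : ℕ → ℕ → F) : Prop := ∀ i j, ¬ (i < j ∧ j < n) → d i j = 0

/-- The coefficients on `n` strands as a matrix. -/
def toMat (n : ℕ) (d : ℕ → ℕ → F) : Matrix (Fin n) (Fin n) F := Matrix.of fun i j => d i j

@[simp] theorem toMat_apply (n : ℕ) (d : ℕ → ℕ → F) (i j : Fin n) : toMat n d i j = d i j := rfl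

/-- `d` is the family of coefficients of a strictly triangular differential on `n` strands. -/
structure IsDifferential (n : ℕ) (d : ℕ → ℕ → F) : Prop where
  upper : StrictUpper n d
  sq : toMat n d * toMat n d = 0

theorem StrictUpper.ext {n : ℕ} {d d' : ℕ → ℕ → F} (h : StrictUpper n d) (h' : StrictUpper n d')
    (H : ∀ i < n, ∀ j < n, d i j = d' i j) : d = d' := by
  funext i j
  by_cases hij : i < j ∧ j < n
  · exact H i (hij.1.trans hij.2) j hij.2
  · rw [h i j hij, h' i j hij]

theorem single_mul_entry {n : ℕ} (t b i j : Fin n) (r : F) (M : Matrix (Fin n) (Fin n) F) :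
    (Matrix.single t b r * M) i j = if i = t then r * M b j else 0 := by
  split_ifs with h
  · subst h; simp
  · simp [Matrix.single_mul_apply_of_ne, h]

theorem mul_single_entry {n : ℕ} (t b i j : Fin n) (r : F) (M : Matrix (Fin n) (Fin n) F) :
    (M * Matrix.single t b r) i j = if j = b then M i t * r else 0 := by
  split_ifs with h
  · subst h; simp
  · simp [Matrix.mul_single_apply_of_ne, h]

theorem one_sub_single_mul_one_add_single {n : ℕ} {t b : Fin n} (h : t ≠ b) (r : F) :
    (1 - Matrix.single t b r) * (1 + Matrix.single t b r) = 1 := by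
  have : Matrix.single t b r * Matrix.single t b r = 0 :=
    Matrix.single_mul_single_of_ne r t _ _ h.symm r
  rw [sub_mul, mul_add, mul_add, this]; simp

theorem one_add_single_mul_one_sub_single {n : ℕ} {t b : Fin n} (h : t ≠ b) (r : F) :
    (1 + Matrix.single t b r) * (1 - Matrix.single t b r) = 1 := by
  have : Matrix.single t b r * Matrix.single t b r = 0 :=
    Matrix.single_mul_single_of_ne r t _ _ h.symm r
  rw [add_mul, mul_sub, mul_sub, this]; simp

/-- Matrices act on row vectors, so the isomorphism of a handleslide is right multiplication by `1 -
E`. Commuting with the differentials forces conjugation, with the inverse `1 + E` on the left. -/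
theorem toMat_slide {n : ℕ} (d : ℕ → ℕ → F) (h : Handleslide F) (hb : h.bot < n) (ht : h.top < n) :
    toMat n (nextDifferential d (.slide h)) =
      (1 + Matrix.single ⟨h.top, ht⟩ ⟨h.bot, hb⟩ h.coeff) * toMat n d *
        (1 - Matrix.single ⟨h.top, ht⟩ ⟨h.bot, hb⟩ h.coeff) := by
  ext i j
  rw [mul_sub, mul_one, Matrix.sub_apply, mul_single_entry]
  simp only [add_mul, one_mul, Matrix.add_apply, single_mul_entry, toMat_apply, nextDifferential,
    Fin.ext_iff]
  split_ifs <;> ring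

theorem StrictUpper.slide {n : ℕ} {d : ℕ → ℕ → F} (hd : StrictUpper n d) (h : Handleslide F)
    (ht : h.top < h.bot) (hb : h.bot < n) : StrictUpper n (nextDifferential d (.slide h)) := by
  intro i j hij
  have h1 : d i j = 0 := hd _ _ hij
  have h2 : i = h.top → d h.bot j = 0 := fun e => hd _ _ (by omega)
  have h3 : j = h.bot → d i h.top = 0 := fun e => hd _ _ (by omega)
  have h4 : d h.bot h.top = 0 := hd _ _ (by omega)
  simp only [nextDifferential]
  split_ifs with e1 e2 e2 <;> simp_all

theorem IsDifferential.slide {n : ℕ} {d : ℕ → ℕ → F} (hd : IsDifferential n d) (h : Handleslide F)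
    (ht : h.top < h.bot) (hb : h.bot < n) : IsDifferential n (nextDifferential d (.slide h)) := by
  refine ⟨hd.upper.slide h ht hb, ?_⟩
  have hne : (⟨h.top, ht.trans hb⟩ : Fin n) ≠ ⟨h.bot, hb⟩ := by
    simpa [Fin.ext_iff] using ht.ne
  rw [toMat_slide d h hb (ht.trans hb)]
  generalize hE : Matrix.single (⟨h.top, ht.trans hb⟩ : Fin n) (⟨h.bot, hb⟩ : Fin n) h.coeff = E
  calc (1 + E) * toMat n d * (1 - E) * ((1 + E) * toMat n d * (1 - E))
      = (1 + E) * toMat n d * ((1 - E) * (1 + E)) * toMat n d * (1 - E) := by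
        simp only [mul_assoc]
    _ = (1 + E) * (toMat n d * toMat n d) * (1 - E) := by
        rw [← hE, one_sub_single_mul_one_add_single hne, mul_one]; simp only [mul_assoc]
    _ = 0 := by rw [hd.sq]; simp

theorem swapStrand_swapStrand (k i : ℕ) : swapStrand k (swapStrand k i) = i := by
  unfold swapStrand; split_ifs <;> omega

theorem swapStrand_lt {k n i : ℕ} (hk : k + 1 < n) : swapStrand k i < n ↔ i < n := by
  unfold swapStrand; split_ifs <;> omega

/-- `swapStrand` as a permutation of `n` strands. -/
def swapPerm (n k : ℕ) (hk : k + 1 < n) : Equiv.Perm (Fin n) where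
  toFun i := ⟨swapStrand k i, (swapStrand_lt hk).2 i.2⟩
  invFun i := ⟨swapStrand k i, (swapStrand_lt hk).2 i.2⟩
  left_inv i := by simp [swapStrand_swapStrand]
  right_inv i := by simp [swapStrand_swapStrand]

theorem toMat_swap {n k : ℕ} (hk : k + 1 < n) (d : ℕ → ℕ → F) :
    toMat n (fun i j => d (swapStrand k i) (swapStrand k j)) =
      (toMat n d).submatrix (swapPerm n k hk) (swapPerm n k hk) := rfl

/-- The transposition reverses the order of no pair except `k`, `k + 1`, and there the coefficient
vanishes. -/
theorem StrictUpper.swap {n k : ℕ} {d : ℕ → ℕ → F} (hd : StrictUpper n d) (hk : k + 1 < n)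
    (h0 : d k (k + 1) = 0) :
    StrictUpper n (fun i j => d (swapStrand k i) (swapStrand k j)) := by
  intro i j hij
  by_cases h : swapStrand k i < swapStrand k j ∧ swapStrand k j < n
  · have : swapStrand k i = k ∧ swapStrand k j = k + 1 := by
      rw [swapStrand_lt hk] at h
      revert h; unfold swapStrand; split_ifs <;> omega
    simp only [this, h0]
  · exact hd _ _ h

theorem IsDifferential.crossing {n k : ℕ} {d : ℕ → ℕ → F} (hd : IsDifferential n d)
    (hk : k + 1 < n) (h0 : d k (k + 1) = 0) :
    IsDifferential n (nextDifferential d (.front (.crossing k))) := by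
  refine ⟨hd.upper.swap hk h0, ?_⟩
  change toMat n (fun i j => d (swapStrand k i) (swapStrand k j)) *
    toMat n (fun i j => d (swapStrand k i) (swapStrand k j)) = 0
  rw [toMat_swap hk, Matrix.submatrix_mul_equiv, hd.sq]; rfl

end Differentials

/-! ## Complexes from coefficients -/

namespace StrandComplex

variable {F : Type*} [Field F]

theorem e_fin (C : StrandComplex F) (i : Fin C.n) : C.e i = Pi.single i 1 := by
  funext a; simp [e, Pi.single_apply, Fin.ext_iff]

theorem e_eq_zero (C : StrandComplex F) {i : ℕ} (hi : ¬ i < C.n) : C.e i = 0 := by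
  funext a; have := a.2; simp only [e, Pi.zero_apply]; rw [if_neg]; omega

theorem coeff_fin (C : StrandComplex F) (i : ℕ) (j : Fin C.n) : C.coeff i j = C.d (C.e i) j := by
  simp [coeff]

theorem hom_ext {C : StrandComplex F} {M : Type*} [AddCommGroup M] [Module F M]
    {f g : (Fin C.n → F) →ₗ[F] M} (h : ∀ i < C.n, f (C.e i) = g (C.e i)) : f = g := by
  apply LinearMap.pi_ext'
  intro i
  apply LinearMap.ext_ring
  have := h i i.2
  rw [e_fin] at this
  simpa using this

theorem upper (C : StrandComplex F) : StrictUpper C.n C.coeff := by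
  intro i j hij
  by_cases hi : i < C.n
  · by_cases hj : j < C.n
    · by_contra h
      have h1 := C.triangular ⟨i, hi⟩ ⟨j, hj⟩
      rw [← C.e_fin ⟨i, hi⟩, ← C.coeff_fin i ⟨j, hj⟩] at h1
      exact hij ⟨h1 h, hj⟩
    · simp [coeff, hj]
  · simp [coeff, C.e_eq_zero hi]

theorem d_apply (C : StrandComplex F) (x : Fin C.n → F) :
    C.d x = Matrix.vecMul x (toMat C.n C.coeff) := by
  have : C.d = (toMat C.n C.coeff).vecMulLinear := by
    apply hom_ext
    intro i hi
    funext j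
    have h := C.e_fin ⟨i, hi⟩
    simp only at h
    rw [Matrix.vecMulLinear_apply, ← C.coeff_fin, h, Matrix.single_one_vecMul]
    rfl
  rw [this]; rfl

theorem isDifferential (C : StrandComplex F) : IsDifferential C.n C.coeff := by
  refine ⟨C.upper, ?_⟩
  have h := C.d_comp_d
  apply Matrix.ext
  intro i j
  have h1 := congrFun (LinearMap.congr_fun h (C.e i)) j
  simp only [LinearMap.comp_apply, d_apply, Matrix.vecMul_vecMul] at h1
  rw [e_fin, Matrix.single_one_vecMul] at h1
  simpa using h1

/-- The complex with the given coefficients. -/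
def ofCoeff (n : ℕ) (d : ℕ → ℕ → F) (h : IsDifferential n d) : StrandComplex F where
  n := n
  d := (toMat n d).vecMulLinear
  d_comp_d := by
    refine LinearMap.ext fun x => ?_
    simp [Matrix.vecMul_vecMul, h.sq]
  triangular i j hij := by
    by_contra hlt
    apply hij
    rw [Matrix.vecMulLinear_apply, Matrix.single_one_vecMul]
    exact h.upper _ _ (fun h => hlt h.1)

@[simp] theorem coeff_ofCoeff (n : ℕ) (d : ℕ → ℕ → F) (h : IsDifferential n d) :
    (ofCoeff n d h).coeff = d := by
  apply (ofCoeff n d h).upper.ext h.upper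
  intro i hi j hj
  have h1 := (ofCoeff n d h).coeff_fin i ⟨j, hj⟩
  have h2 := (ofCoeff n d h).e_fin ⟨i, hi⟩
  simp only at h1 h2
  rw [h1, h2]
  change ((toMat n d).vecMulLinear (Pi.single (⟨i, hi⟩ : Fin n) 1)) ⟨j, hj⟩ = _
  rw [Matrix.vecMulLinear_apply, Matrix.single_one_vecMul]
  rfl

theorem ext_coeff {C C' : StrandComplex F} (hn : C.n = C'.n) (hc : C.coeff = C'.coeff) : C = C' := by
  have h1 := C.d_apply
  have h2 := C'.d_apply
  rw [hc] at h1
  generalize C'.coeff = c at h1 h2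
  cases C with | mk n d _ _ =>
  cases C' with | mk n' d' _ _ =>
  simp only at hn
  subst hn
  have : d = d' := LinearMap.ext fun x => (h1 x).trans (h2 x).symm
  subst this
  rfl

end StrandComplex

/-! ## The local conditions in terms of coefficients -/

section LocalConditions

variable {F : Type*} [Field F]

open StrandComplex

theorem tangleStep_crossing {n k : ℕ} {d d' : ℕ → ℕ → F} (hd : IsDifferential n d)
    (hd' : IsDifferential n d') (hk : k + 1 < n) (h0 : d k (k + 1) = 0)
    (hc : d' = nextDifferential d (.front (.crossing k))) :
    TangleStep (ofCoeff n d hd) (ofCoeff n d' hd') (.front (.crossing k)) := by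
  refine ⟨by simpa using h0, ?_, LinearEquiv.funCongrLeft F F (swapPerm n k hk), ?_, ?_⟩
  · rw [coeff_ofCoeff, hc]
    refine hd.upper _ _ ?_
    unfold swapStrand
    split_ifs <;> omega
  · intro i hi
    funext a
    change (if swapStrand k (a : ℕ) = i then (1 : F) else 0) =
      if (a : ℕ) = swapStrand k i then 1 else 0
    have : swapStrand k (a : ℕ) = i ↔ (a : ℕ) = swapStrand k i :=
      ⟨fun h => by rw [← h, swapStrand_swapStrand], fun h => by rw [h, swapStrand_swapStrand]⟩
    simp only [this]
  · intro x
    have e1 : toMat n d' = (toMat n d).submatrix (swapPerm n k hk) (swapPerm n k hk) := by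
      rw [hc]; rfl
    change Matrix.vecMul x (toMat n d) ∘ (swapPerm n k hk) =
      Matrix.vecMul (x ∘ (swapPerm n k hk)) (toMat n d')
    rw [e1]
    funext j
    change ∑ i, x i * d i _ = ∑ i, x (swapPerm n k hk i) * d (swapPerm n k hk i) _
    exact (Equiv.sum_comp (swapPerm n k hk) (fun i => x i * d i _)).symm

theorem tangleStep_slide {n : ℕ} {h : Handleslide F} {d d' : ℕ → ℕ → F} (hd : IsDifferential n d)
    (hd' : IsDifferential n d') (ht : h.top < h.bot) (hb : h.bot < n)
    (hc : d' = nextDifferential d (.slide h)) :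
    TangleStep (ofCoeff n d hd) (ofCoeff n d' hd') (.slide h) := by
  have hne : (⟨h.top, ht.trans hb⟩ : Fin n) ≠ ⟨h.bot, hb⟩ := by
    simpa [Fin.ext_iff] using ht.ne
  have e1 := toMat_slide d h hb (ht.trans hb)
  have e2 := one_sub_single_mul_one_add_single hne h.coeff
  have e3 := one_add_single_mul_one_sub_single hne h.coeff
  have e4 : ∀ i a : Fin n,
      (1 - Matrix.single (⟨h.top, ht.trans hb⟩ : Fin n) (⟨h.bot, hb⟩ : Fin n) h.coeff) i a =
      (if (a : ℕ) = i then 1 else 0) - if (i : ℕ) = h.top ∧ (a : ℕ) = h.bot then h.coeff else 0 := by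
    intro i a
    simp [Matrix.one_apply, Matrix.single_apply, Fin.ext_iff, eq_comm]
  rw [← hc] at e1
  generalize Matrix.single (⟨h.top, ht.trans hb⟩ : Fin n) (⟨h.bot, hb⟩ : Fin n) h.coeff = E at *
  have φ12 : ((1 - E).vecMulLinear).comp ((1 + E).vecMulLinear) = LinearMap.id := by
    refine LinearMap.ext fun x => ?_
    change Matrix.vecMul (Matrix.vecMul x (1 + E)) (1 - E) = x
    rw [Matrix.vecMul_vecMul, e3, Matrix.vecMul_one]
  have φ21 : ((1 + E).vecMulLinear).comp ((1 - E).vecMulLinear) = LinearMap.id := by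
    refine LinearMap.ext fun x => ?_
    change Matrix.vecMul (Matrix.vecMul x (1 - E)) (1 + E) = x
    rw [Matrix.vecMul_vecMul, e2, Matrix.vecMul_one]
  refine ⟨ht, hb, LinearEquiv.ofLinearMap (1 - E).vecMulLinear (1 + E).vecMulLinear φ12 φ21, ?_, ?_⟩
  · intro i hi
    change i < n at hi
    have h1 := (ofCoeff n d hd).e_fin ⟨i, hi⟩
    simp only at h1
    rw [h1]
    funext (a : Fin n)
    have h5 : Matrix.vecMul (Pi.single (⟨i, hi⟩ : Fin n) (1 : F)) (1 - E) a = (1 - E) ⟨i, hi⟩ a := by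
      rw [Matrix.single_one_vecMul]; rfl
    refine h5.trans ?_
    rw [e4]
    by_cases h2 : i = h.top
    · rw [if_pos h2]
      change _ = (if (a : ℕ) = h.top then (1 : F) else 0) -
        h.coeff * (if (a : ℕ) = h.bot then (1 : F) else 0)
      simp [h2]
    · rw [if_neg h2]
      change _ = (if (a : ℕ) = i then (1 : F) else 0)
      simp [h2]
  · intro (x : Fin n → F)
    change Matrix.vecMul (Matrix.vecMul x (toMat n d)) (1 - E) =
      Matrix.vecMul (Matrix.vecMul x (1 - E)) (toMat n d')
    rw [Matrix.vecMul_vecMul, Matrix.vecMul_vecMul, e1, ← mul_assoc, ← mul_assoc, e2, one_mul]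

theorem coeff_of_tangleStep_crossing {C C' : StrandComplex F} {k : ℕ} (hn : C'.n = C.n)
    (hk : k + 1 < C.n) (h : TangleStep C C' (.front (.crossing k))) :
    C'.coeff = nextDifferential C.coeff (.front (.crossing k)) := by
  obtain ⟨h0, -, φ, hφ, hφd⟩ := h
  have key : ∀ j (hj : j < C'.n) x, φ x ⟨j, hj⟩ = x ⟨swapStrand k j, (swapStrand_lt hk).2 (hn ▸ hj)⟩ := by
    intro j hj x
    have : (LinearMap.proj ⟨j, hj⟩).comp φ.toLinearMap =
        LinearMap.proj (⟨swapStrand k j, (swapStrand_lt hk).2 (hn ▸ hj)⟩ : Fin C.n) := by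
      apply hom_ext
      intro i hi
      have : j = swapStrand k i ↔ swapStrand k j = i :=
        ⟨fun h => by rw [h, swapStrand_swapStrand], fun h => by rw [← h, swapStrand_swapStrand]⟩
      simp [hφ i hi, e, this]
    exact LinearMap.congr_fun this x
  apply C'.upper.ext (n := C'.n) (hn ▸ C.upper.swap hk h0)
  intro i hi j hj
  have h1 := congrFun (hφd (C.e (swapStrand k i))) ⟨j, hj⟩
  rw [hφ _ ((swapStrand_lt hk).2 (hn ▸ hi)), swapStrand_swapStrand, key] at h1
  rw [C'.coeff_fin i ⟨j, hj⟩, ← h1, ← C.coeff_fin]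
  rfl

theorem coeff_of_tangleStep_slide {C C' : StrandComplex F} {h : Handleslide F} (hn : C'.n = C.n)
    (hs : TangleStep C C' (.slide h)) :
    C'.coeff = nextDifferential C.coeff (.slide h) := by
  obtain ⟨ht, hb, φ, hφ, hφd⟩ := hs
  -- The isomorphism is known on the basis only; this gives its coordinates on every vector, in
  -- particular on `C.d (C.e i)`.
  have key : ∀ j (hj : j < C'.n) x, φ x ⟨j, hj⟩ =
      x ⟨j, hn ▸ hj⟩ - if j = h.bot then h.coeff * x ⟨h.top, ht.trans hb⟩ else 0 := by
    intro j hj x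
    have : (LinearMap.proj ⟨j, hj⟩).comp φ.toLinearMap =
        LinearMap.proj (⟨j, hn ▸ hj⟩ : Fin C.n) - (if j = h.bot then h.coeff else 0) •
          LinearMap.proj (⟨h.top, ht.trans hb⟩ : Fin C.n) := by
      apply hom_ext
      intro i hi
      simp only [LinearMap.comp_apply, LinearEquiv.coe_coe, hφ i hi, LinearMap.proj_apply,
        LinearMap.sub_apply, LinearMap.smul_apply]
      by_cases h1 : i = h.top
      · subst h1; simp [e]
      · simp [e, h1, Ne.symm h1]
    have h2 := LinearMap.congr_fun this x
    simp only [LinearMap.comp_apply, LinearEquiv.coe_coe, LinearMap.proj_apply,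
        LinearMap.sub_apply, LinearMap.smul_apply] at h2
    rw [h2]
    split_ifs <;> simp
  have main : ∀ i < C.n, ∀ j < C'.n, i ≠ h.top → C'.coeff i j =
      C.coeff i j - if j = h.bot then h.coeff * C.coeff i h.top else 0 := by
    intro i hi j hj hit
    have h1 := congrFun (hφd (C.e i)) ⟨j, hj⟩
    rw [hφ i hi, if_neg hit, key, ← C.coeff_fin, ← C.coeff_fin, ← C'.coeff_fin] at h1
    exact h1.symm
  apply C'.upper.ext (n := C'.n) (hn ▸ C.upper.slide h ht hb)
  intro i hi j hj
  by_cases hit : i = h.top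
  · subst hit
    -- In the top row the relation also contains the new bottom row, because `e h.top` is sent to a
    -- combination of two basis elements. That row is already known from `main`.
    have h1 := congrFun (hφd (C.e h.top)) ⟨j, hj⟩
    rw [hφ _ (hn ▸ hi), if_pos rfl, key, ← C.coeff_fin, ← C.coeff_fin, map_sub, map_smul] at h1
    simp only [Pi.sub_apply, Pi.smul_apply, ← C'.coeff_fin, smul_eq_mul] at h1
    rw [main h.bot hb j hj ht.ne'] at h1
    simp only [nextDifferential, if_true]
    split_ifs with h2
    · subst h2
      simp only [if_true] at h1
      linear_combination -h1
    · simp only [h2, if_false] at h1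
      linear_combination -h1
  · rw [main i (hn ▸ hi) j hj hit]
    simp only [nextDifferential, hit, if_false]
    split_ifs <;> ring

/-! ### Cusps: the quotient by the span of `e k` and `d (e k)` -/

theorem skipStrand_lt {k n i : ℕ} (hk : k ≤ n) : skipStrand k i < n + 2 ↔ i < n := by
  unfold skipStrand; split_ifs <;> omega

theorem skipStrand_ne (k i : ℕ) : skipStrand k i ≠ k := by
  unfold skipStrand; split_ifs <;> omega

theorem skipStrand_ne_succ (k i : ℕ) : skipStrand k i ≠ k + 1 := by
  unfold skipStrand; split_ifs <;> omega

theorem skipStrand_inj {k i j : ℕ} : skipStrand k i = skipStrand k j ↔ i = j := by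
  unfold skipStrand; split_ifs <;> omega

theorem skipStrand_lt_skipStrand {k i j : ℕ} : skipStrand k i < skipStrand k j ↔ i < j := by
  unfold skipStrand; split_ifs <;> omega

theorem unskipStrand_skipStrand (k i : ℕ) : unskipStrand k (skipStrand k i) = i := by
  unfold skipStrand unskipStrand; split_ifs <;> omega

theorem skipStrand_unskipStrand {k i : ℕ} (h : i ≠ k) (h' : i ≠ k + 1) :
    skipStrand k (unskipStrand k i) = i := by
  unfold skipStrand unskipStrand; split_ifs <;> omega

/-- The projection of `C` to the strands other than `k` and `k + 1`, with kernel spanned by `e k` and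
`d (e k)` when the coefficient of `e (k + 1)` in `d (e k)` is not `0`. -/
def cuspProj (C : StrandComplex F) (N k : ℕ) (hN : C.n = N + 2) (hk : k ≤ N) :
    (Fin C.n → F) →ₗ[F] (Fin N → F) :=
  LinearMap.pi fun j =>
    LinearMap.proj ⟨skipStrand k j, hN ▸ (skipStrand_lt hk).2 j.2⟩ -
      ((C.coeff k (k + 1))⁻¹ * C.coeff k (skipStrand k j)) • LinearMap.proj ⟨k + 1, by omega⟩

theorem cuspProj_apply (C : StrandComplex F) {N k : ℕ} (hN : C.n = N + 2) (hk : k ≤ N) (y j) :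
    cuspProj C N k hN hk y j = y ⟨skipStrand k j, hN ▸ (skipStrand_lt hk).2 j.2⟩ -
      ((C.coeff k (k + 1))⁻¹ * C.coeff k (skipStrand k j)) * y ⟨k + 1, by omega⟩ := rfl

section CuspProj

variable (C : StrandComplex F) {N k : ℕ} (hN : C.n = N + 2) (hk : k ≤ N)

theorem cuspProj_e_skip (i : ℕ) :
    cuspProj C N k hN hk (C.e (skipStrand k i)) = fun a : Fin N => if (a : ℕ) = i then (1 : F) else 0 := by
  funext a
  rw [cuspProj_apply]
  simp [e, skipStrand_inj, (skipStrand_ne_succ k i).symm]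

theorem cuspProj_e : cuspProj C N k hN hk (C.e k) = 0 := by
  funext a
  rw [cuspProj_apply]
  simp [e, skipStrand_ne]

theorem cuspProj_d_e (h : C.coeff k (k + 1) ≠ 0) : cuspProj C N k hN hk (C.d (C.e k)) = 0 := by
  funext a
  rw [cuspProj_apply, ← C.coeff_fin, ← C.coeff_fin]
  simp only [Pi.zero_apply]
  field_simp
  ring

theorem ker_cuspProj (h : C.coeff k (k + 1) ≠ 0) :
    LinearMap.ker (cuspProj C N k hN hk) = Submodule.span F {C.e k, C.d (C.e k)} := by
  apply le_antisymm
  · intro y hy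
    have hy' : ∀ j, cuspProj C N k hN hk y j = 0 := fun j => by
      rw [LinearMap.mem_ker] at hy; rw [hy]; rfl
    rw [Submodule.mem_span_pair]
    refine ⟨y ⟨k, by omega⟩, y ⟨k + 1, by omega⟩ * (C.coeff k (k + 1))⁻¹, ?_⟩
    funext a
    simp only [Pi.add_apply, Pi.smul_apply, ← C.coeff_fin, smul_eq_mul, e]
    obtain ⟨a, ha⟩ := a
    simp only
    by_cases h1 : a = k
    · subst h1
      rw [C.upper a a (by omega)]; simp
    by_cases h2 : a = k + 1
    · subst h2
      rw [if_neg h1]; field_simp; ring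
    have h3 := skipStrand_unskipStrand h1 h2
    have h4 := hy' ⟨unskipStrand k a, by rw [← skipStrand_lt hk, h3]; omega⟩
    rw [cuspProj_apply] at h4
    simp only [h3] at h4
    rw [if_neg h1]
    linear_combination -h4
  · rw [Submodule.span_le]
    intro y hy
    rcases hy with rfl | rfl
    · exact cuspProj_e C hN hk
    · exact cuspProj_d_e C hN hk h

theorem cuspProj_surjective : Function.Surjective (cuspProj C N k hN hk) := by
  rw [← LinearMap.range_eq_top, eq_top_iff]
  intro x _
  rw [pi_eq_sum_univ x]
  refine Submodule.sum_mem _ fun i _ => Submodule.smul_mem _ _ ⟨C.e (skipStrand k i), ?_⟩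
  rw [cuspProj_e_skip]
  funext a
  simp [Fin.ext_iff, eq_comm]

-- When the coefficient of `e (k + 1)` in `d (e k)` is non-zero, `d (e k)` can replace `e (k + 1)`
-- in the standard basis. So `e k`, `d (e k)` and the remaining strands span.
include hN hk in
theorem linearMap_ext_cusp {M : Type*} [AddCommGroup M] [Module F M]
    {f g : (Fin C.n → F) →ₗ[F] M} (h : C.coeff k (k + 1) ≠ 0)
    (hs : ∀ i < N, f (C.e (skipStrand k i)) = g (C.e (skipStrand k i)))
    (h0 : f (C.e k) = g (C.e k)) (h1 : f (C.d (C.e k)) = g (C.d (C.e k))) : f = g := by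
  rw [← sub_eq_zero]
  have hker : ∀ y, cuspProj C N k hN hk y = 0 → (f - g) y = 0 := by
    intro y hy
    rw [← LinearMap.mem_ker, ker_cuspProj C hN hk h, Submodule.mem_span_pair] at hy
    obtain ⟨a, b, rfl⟩ := hy
    simp [h0, h1]
  refine LinearMap.ext fun y => ?_
  have hy : (f - g) (∑ i : Fin N, cuspProj C N k hN hk y i • C.e (skipStrand k i)) = 0 := by
    simp only [map_sum, map_smul]
    refine Finset.sum_eq_zero fun i _ => ?_
    simp [hs i i.2]
  have h2 := hker (y - ∑ i : Fin N, cuspProj C N k hN hk y i • C.e (skipStrand k i)) (by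
    rw [map_sub, map_sum, sub_eq_zero]
    funext a
    simp only [map_smul, cuspProj_e_skip, Finset.sum_apply, Pi.smul_apply, smul_eq_mul]
    simp [← Fin.ext_iff])
  rw [map_sub, hy, sub_zero] at h2
  exact h2

/-- The coefficients that the quotient at a cusp inherits. -/
theorem cuspProj_d_e_skip (i : ℕ) (j : Fin N) :
    cuspProj C N k hN hk (C.d (C.e (skipStrand k i))) j =
      nextDifferential C.coeff (.front (.rightCusp k false)) i j := by
  rw [cuspProj_apply, ← C.coeff_fin, ← C.coeff_fin]
  simp only [nextDifferential]
  ring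

end CuspProj

/-- `cuspProj` identifies the quotient with the free module on the remaining strands, and there the
induced differential has the coefficients of `nextDifferential`. -/
theorem cuspRelated_of_coeff {C C' : StrandComplex F} {k : ℕ} (hN : C.n = C'.n + 2) (hk : k ≤ C'.n)
    (h : C.coeff k (k + 1) ≠ 0)
    (hc : ∀ i < C'.n, ∀ j < C'.n, C'.coeff i j =
      nextDifferential C.coeff (.front (.rightCusp k false)) i j) :
    C.CuspRelated C' k := by
  let ψ := cuspProj C C'.n k hN hk
  have hcomm : C'.d ∘ₗ ψ = ψ ∘ₗ C.d := by
    apply linearMap_ext_cusp C hN hk h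
    · intro i hi
      simp only [LinearMap.comp_apply, ψ, cuspProj_e_skip]
      funext j
      rw [cuspProj_d_e_skip, ← hc i hi j j.2, C'.coeff_fin]
      rfl
    · simp only [LinearMap.comp_apply, ψ, cuspProj_e, cuspProj_d_e C hN hk h, map_zero]
    · have : C.d (C.d (C.e k)) = 0 := LinearMap.congr_fun C.d_comp_d _
      simp only [LinearMap.comp_apply, ψ, cuspProj_d_e C hN hk h, map_zero, this]
  let Φ : ((Fin C.n → F) ⧸ Submodule.span F {C.e k, C.d (C.e k)}) ≃ₗ[F] (Fin C'.n → F) :=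
    (Submodule.quotEquivOfEq _ _ (ker_cuspProj C hN hk h).symm).trans
      (ψ.quotKerEquivOfSurjective (cuspProj_surjective C hN hk))
  have hΦ : ∀ y, Φ (Submodule.Quotient.mk y) = ψ y := fun y => rfl
  refine ⟨Φ.symm, ?_, ?_⟩
  · intro i hi
    rw [LinearEquiv.symm_apply_eq, hΦ]
    simp only [ψ, cuspProj_e_skip]
    rfl
  · intro x y hxy
    rw [LinearEquiv.symm_apply_eq, hΦ] at hxy ⊢
    rw [hxy]
    exact LinearMap.congr_fun hcomm y

/-- The isomorphism in a cusp relation is forced: composed with `cuspProj` it agrees with the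
quotient map on a spanning set. Hence the differential of `C'` is forced as well. -/
theorem coeff_of_cuspRelated {C C' : StrandComplex F} {k : ℕ} (hN : C.n = C'.n + 2) (hk : k ≤ C'.n)
    (h : C.coeff k (k + 1) ≠ 0) (H : C.CuspRelated C' k) :
    ∀ i < C'.n, ∀ j < C'.n, C'.coeff i j =
      nextDifferential C.coeff (.front (.rightCusp k false)) i j := by
  obtain ⟨φ, h1, h2⟩ := H
  have hφ : ∀ y, φ (cuspProj C C'.n k hN hk y) = Submodule.Quotient.mk y := by
    intro y
    have : φ.toLinearMap ∘ₗ cuspProj C C'.n k hN hk =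
        (Submodule.span F {C.e k, C.d (C.e k)}).mkQ := by
      apply linearMap_ext_cusp C hN hk h
      · intro i hi
        simp only [LinearMap.comp_apply, cuspProj_e_skip]
        exact h1 i hi
      · simp only [LinearMap.comp_apply, cuspProj_e, map_zero]
        refine ((Submodule.Quotient.mk_eq_zero _).2 (Submodule.subset_span ?_)).symm
        simp
      · simp only [LinearMap.comp_apply, cuspProj_d_e C hN hk h, map_zero]
        refine ((Submodule.Quotient.mk_eq_zero _).2 (Submodule.subset_span ?_)).symm
        simp
    exact LinearMap.congr_fun this y
  intro i hi j hj
  have h3 := h2 _ _ (h1 i hi)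
  rw [← hφ] at h3
  have h4 := congrFun (φ.injective h3) ⟨j, hj⟩
  rw [cuspProj_d_e_skip] at h4
  rw [C'.coeff_fin i ⟨j, hj⟩, h4]

end LocalConditions

/-! ### Differentials past cusps; the local conditions as conditions on coefficients -/

section Cusps

variable {F : Type*} [Field F]

open StrandComplex

theorem IsDifferential.rightCusp {n k : ℕ} {b : Bool} {d : ℕ → ℕ → F} (hd : IsDifferential n d)
    (hk : k + 1 < n) (h0 : d k (k + 1) ≠ 0) :
    IsDifferential (n - 2) (nextDifferential d (.front (.rightCusp k b))) := by
  obtain ⟨N, rfl⟩ : ∃ N, n = N + 2 := ⟨n - 2, by omega⟩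
  have hkN : k ≤ N := by omega
  change IsDifferential N (nextDifferential d (.front (.rightCusp k false)))
  let C := ofCoeff (N + 2) d hd
  have hN : C.n = N + 2 := rfl
  have hC : C.coeff = d := coeff_ofCoeff _ _ _
  have h0' : C.coeff k (k + 1) ≠ 0 := by rw [hC]; exact h0
  constructor
  · intro i j hij
    have h1 : d (skipStrand k i) (skipStrand k j) = 0 :=
      hd.upper _ _ (by rwa [skipStrand_lt_skipStrand, skipStrand_lt hkN])
    -- Two non-zero factors would put strand `skipStrand k i` above the cusp and `skipStrand k j`
    -- below it, so that `i < j` after all.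
    have h2 : d (skipStrand k i) (k + 1) = 0 ∨ d k (skipStrand k j) = 0 := by
      by_contra! h
      have h3 := not_imp_comm.1 (hd.upper _ _) h.1
      have h4 := not_imp_comm.1 (hd.upper _ _) h.2
      revert h3 h4
      unfold skipStrand
      split_ifs <;> omega
    simp only [nextDifferential]
    rcases h2 with h2 | h2 <;> simp [h1, h2]
  · let d' := nextDifferential d (.front (.rightCusp k false))
    let ψ := cuspProj C N k hN hkN
    have hcomm : (toMat N d').vecMulLinear ∘ₗ ψ = ψ ∘ₗ C.d := by
      apply linearMap_ext_cusp C hN hkN h0'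
      · intro i hi
        simp only [LinearMap.comp_apply, ψ, cuspProj_e_skip]
        funext j
        rw [cuspProj_d_e_skip, hC]
        have : (fun a : Fin N => if (a : ℕ) = i then (1 : F) else 0) =
            Pi.single (⟨i, hi⟩ : Fin N) 1 := by
          funext a; simp [Pi.single_apply, Fin.ext_iff]
        rw [this, Matrix.vecMulLinear_apply, Matrix.single_one_vecMul]
        rfl
      · simp only [LinearMap.comp_apply, ψ, cuspProj_e, cuspProj_d_e C hN hkN h0', map_zero]
      · have : C.d (C.d (C.e k)) = 0 := LinearMap.congr_fun C.d_comp_d _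
        simp only [LinearMap.comp_apply, ψ, cuspProj_d_e C hN hkN h0', map_zero, this]
    -- The vanishing of the square descends from `C` along the surjection `ψ`, which commutes with
    -- the differentials.
    have hz : ∀ x, Matrix.vecMul (Matrix.vecMul x (toMat N d')) (toMat N d') = 0 := by
      intro x
      obtain ⟨y, rfl⟩ := cuspProj_surjective C hN hkN x
      have h1 : ∀ y, Matrix.vecMul (ψ y) (toMat N d') = ψ (C.d y) :=
        fun y => LinearMap.congr_fun hcomm y
      have h2 : C.d (C.d y) = 0 := LinearMap.congr_fun C.d_comp_d y
      change Matrix.vecMul (Matrix.vecMul (ψ y) (toMat N d')) (toMat N d') = 0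
      rw [h1, h1, h2, map_zero]
    ext i j
    have h3 := congrFun (hz (Pi.single i 1)) j
    rw [Matrix.vecMul_vecMul, Matrix.single_one_vecMul] at h3
    exact h3

theorem IsDifferential.leftCusp {n k : ℕ} {d : ℕ → ℕ → F} (hd : IsDifferential n d)
    (hk : k ≤ n) : IsDifferential (n + 2) (nextDifferential d (.front (.leftCusp k))) := by
  have hskip : ∀ i j, nextDifferential d (.front (.leftCusp k)) (skipStrand k i) (skipStrand k j) =
      d i j := by
    intro i j
    simp [nextDifferential, skipStrand_ne, skipStrand_ne_succ, unskipStrand_skipStrand]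
  have hcases : ∀ i, i = k ∨ i = k + 1 ∨ ∃ i', i = skipStrand k i' := by
    intro i
    by_cases h1 : i = k
    · exact .inl h1
    by_cases h2 : i = k + 1
    · exact .inr (.inl h2)
    exact .inr (.inr ⟨_, (skipStrand_unskipStrand h1 h2).symm⟩)
  have hk0 : ∀ i, i ≠ k + 1 → nextDifferential d (.front (.leftCusp k)) k i = 0 := by
    intro i hi; simp [nextDifferential, hi]
  have hk1 : ∀ i, nextDifferential d (.front (.leftCusp k)) (k + 1) i = 0 := by
    intro i; simp [nextDifferential]
  have hk2 : ∀ i, nextDifferential d (.front (.leftCusp k)) i k = 0 := by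
    intro i; simp [nextDifferential]
  have hk3 : ∀ i, i ≠ k → nextDifferential d (.front (.leftCusp k)) i (k + 1) = 0 := by
    intro i hi; simp [nextDifferential, hi]
  constructor
  · intro i j hij
    rcases hcases i with rfl | rfl | ⟨i, rfl⟩
    · exact hk0 _ (by omega)
    · exact hk1 _
    rcases hcases j with rfl | rfl | ⟨j, rfl⟩
    · exact hk2 _
    · exact hk3 _ (skipStrand_ne _ _)
    rw [skipStrand_lt_skipStrand, skipStrand_lt hk] at hij
    rw [hskip, hd.upper _ _ hij]
  · ext ⟨i, hi⟩ ⟨j, hj⟩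
    rw [Matrix.mul_apply]
    simp only [toMat_apply, Matrix.zero_apply]
    rcases hcases i with rfl | rfl | ⟨i, rfl⟩
    · refine Finset.sum_eq_zero fun l _ => ?_
      by_cases hl : (l : ℕ) = i + 1
      · rw [hl, hk1, mul_zero]
      · rw [hk0 _ hl, zero_mul]
    · simp [hk1]
    rcases hcases j with rfl | rfl | ⟨j, rfl⟩
    · simp [hk2]
    · refine Finset.sum_eq_zero fun l _ => ?_
      by_cases hl : (l : ℕ) = k
      · rw [hl, hk2, zero_mul]
      · rw [hk3 _ hl, mul_zero]
    have h := congrFun (congrFun hd.sq ⟨i, (skipStrand_lt hk).1 hi⟩) ⟨j, (skipStrand_lt hk).1 hj⟩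
    rw [Matrix.mul_apply] at h
    simp only [toMat_apply, Matrix.zero_apply] at h
    rw [← h]
    symm
    -- The new differential is a direct sum of the old one and of the cusp pair, so only the old
    -- strands contribute to the product of these entries.
    refine Finset.sum_of_injOn (fun l : Fin n => (⟨skipStrand k l, (skipStrand_lt hk).2 l.2⟩ : Fin (n + 2)))
      ?_ ?_ ?_ ?_
    · intro a _ b _ hab
      simpa [skipStrand_inj, Fin.ext_iff] using hab
    · intro a _; simp
    · rintro ⟨l, hl⟩ _ hl'
      rcases hcases l with rfl | rfl | ⟨l, rfl⟩
      · simp [hk2]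
      · simp [hk1]
      · exact absurd ⟨⟨l, (skipStrand_lt hk).1 hl⟩, by simp, rfl⟩ hl'
    · intro l _
      simp only [hskip]

/-- The conditions on an elementary tangle, in terms of the coefficients `d` to its left. -/
def StepOk (n : ℕ) (d : ℕ → ℕ → F) : ElemTangle F → Prop
  | .slide h => h.top < h.bot ∧ h.bot < n
  | .front (.leftCusp k) => k ≤ n
  | .front (.crossing k) => k + 1 < n ∧ d k (k + 1) = 0
  | .front (.rightCusp k b) => k + 1 < n ∧ if b then d k (k + 1) ≠ 0 else d k (k + 1) = -1

/-- The number of strands to the right of an elementary tangle. -/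
def tangleNext (n : ℕ) : ElemTangle F → ℕ
  | .slide _ => n
  | .front e => e.next n

theorem StepOk.rightCusp_ne {n k : ℕ} {b : Bool} {d : ℕ → ℕ → F}
    (h : StepOk n d (.front (.rightCusp k b))) : d k (k + 1) ≠ 0 := by
  have h2 := h.2
  cases b
  · have h2 : d k (k + 1) = -1 := by simpa using h2
    rw [h2]; simp
  · simpa using h2

theorem IsDifferential.next {n : ℕ} {d : ℕ → ℕ → F} (hd : IsDifferential n d) {T : ElemTangle F}
    (h : StepOk n d T) : IsDifferential (tangleNext n T) (nextDifferential d T) := by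
  match T, h with
  | .slide s, h => exact hd.slide s h.1 h.2
  | .front (.leftCusp k), h => exact hd.leftCusp h
  | .front (.crossing k), h => exact hd.crossing h.1 h.2
  | .front (.rightCusp k b), h => exact hd.rightCusp h.1 h.rightCusp_ne

theorem nextDifferential_leftCusp_simple (d : ℕ → ℕ → F) (k i : ℕ) :
    nextDifferential d (.front (.leftCusp k)) k i = (if i = k + 1 then 1 else 0) ∧
    (i < k → nextDifferential d (.front (.leftCusp k)) i k = 0 ∧
      nextDifferential d (.front (.leftCusp k)) i (k + 1) = 0) := by
  refine ⟨by simp [nextDifferential], fun hi => ⟨by simp [nextDifferential], ?_⟩⟩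
  simp [nextDifferential, hi.ne]

/-- Sufficiency of `StepOk`: the isomorphism that a tangle requires always exists once the new
differential is the one of `nextDifferential`. Only numerical conditions on the old one remain. -/
theorem tangleStep_ofCoeff {n n' : ℕ} {d d' : ℕ → ℕ → F} (hd : IsDifferential n d)
    (hd' : IsDifferential n' d') {T : ElemTangle F} (h : StepOk n d T) (hn : n' = tangleNext n T)
    (hc : d' = nextDifferential d T) : TangleStep (ofCoeff n d hd) (ofCoeff n' d' hd') T := by
  subst hn
  match T, h with
  | .slide s, h => exact tangleStep_slide hd hd' h.1 h.2 hc
  | .front (.crossing k), h => exact tangleStep_crossing hd hd' h.1 h.2 hc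
  | .front (.leftCusp k), h =>
    have h1 : d' k (k + 1) = 1 := by simp [hc, nextDifferential]
    refine ⟨by simpa using h1, cuspRelated_of_coeff rfl h (by simp [h1]) ?_⟩
    intro i hi j hj
    simp only [coeff_ofCoeff]
    simp [hc, nextDifferential, skipStrand_ne, skipStrand_ne_succ, unskipStrand_skipStrand]
  | .front (.rightCusp k b), h =>
    have h1 := h.1
    refine ⟨?_, cuspRelated_of_coeff (C := ofCoeff n d hd) (C' := ofCoeff _ d' hd') (k := k) ?_ ?_
      (by simpa using h.rightCusp_ne) ?_⟩
    · have h2 := h.2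
      rw [coeff_ofCoeff]
      cases b
      · simpa using h2
      · have h2 : d k (k + 1) ≠ 0 := by simpa using h2
        exact ⟨-Units.mk0 _ h2, by simp⟩
    · change n = n - 2 + 2
      omega
    · change k ≤ n - 2
      omega
    · intro i hi j hj
      simp only [coeff_ofCoeff, hc]
      rfl

/-- The converse of `tangleStep_ofCoeff`. Simplicity of left cusps is what makes the differential to
the right of a left cusp unique. -/
theorem coeff_of_tangleStep {C C' : StrandComplex F} {T : ElemTangle F} (hs : TangleStep C C' T)
    (hn : C'.n = tangleNext C.n T) (hf : ∀ e, T = .front e → e.Fits C.n)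
    (hl : ∀ k, T = .front (.leftCusp k) → C'.d (C'.e k) = C'.e (k + 1) ∧
      ∀ j < k, C'.coeff j k = 0 ∧ C'.coeff j (k + 1) = 0) :
    StepOk C.n C.coeff T ∧ C'.coeff = nextDifferential C.coeff T := by
  match T, hs with
  | .slide s, hs => exact ⟨⟨hs.1, hs.2.1⟩, coeff_of_tangleStep_slide hn hs⟩
  | .front (.crossing k), hs =>
    have hk : k + 1 < C.n := hf _ rfl
    exact ⟨⟨hk, hs.1⟩, coeff_of_tangleStep_crossing hn hk hs⟩
  | .front (.rightCusp k b), hs =>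
    have hk : k + 1 < C.n := hf _ rfl
    have hn' : C'.n = C.n - 2 := hn
    have hok : StepOk C.n C.coeff (.front (.rightCusp k b)) := by
      refine ⟨hk, ?_⟩
      have h1 := hs.1
      cases b
      · simpa using h1
      · obtain ⟨s, h1⟩ : ∃ s : Fˣ, C.coeff k (k + 1) = -(s : F) := by simpa using h1
        simp [h1]
    refine ⟨hok, ?_⟩
    have h1 := coeff_of_cuspRelated (by omega) (by omega) hok.rightCusp_ne hs.2
    have h2 := (C.isDifferential.next hok).upper
    exact C'.upper.ext (n := C'.n) (hn ▸ h2) h1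
  | .front (.leftCusp k), hs =>
    have hk : k ≤ C.n := hf _ rfl
    have hn' : C'.n = C.n + 2 := hn
    refine ⟨hk, ?_⟩
    obtain ⟨s1, s2⟩ := hl k rfl
    have h0 : C'.coeff k (k + 1) ≠ 0 := by rw [hs.1]; simp
    have h1 := coeff_of_cuspRelated hn' hk h0 hs.2
    have h2 := (C.isDifferential.next (T := .front (.leftCusp k)) hk).upper
    have hk' : ∀ j < C'.n, C'.coeff k j = if j = k + 1 then 1 else 0 := by
      intro j hj
      rw [C'.coeff_fin k ⟨j, hj⟩, s1]; rfl
    -- `e (k + 1)` is the boundary `d (e k)`, hence a cycle.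
    have hk1 : ∀ j < C'.n, C'.coeff (k + 1) j = 0 := by
      intro j hj
      rw [C'.coeff_fin (k + 1) ⟨j, hj⟩, ← s1]
      exact congrFun (LinearMap.congr_fun C'.d_comp_d (C'.e k)) _
    refine C'.upper.ext (n := C'.n) (hn ▸ h2) ?_
    intro i hi j hj
    by_cases i1 : i = k
    · subst i1; rw [hk' j hj, (nextDifferential_leftCusp_simple _ _ _).1]
    by_cases i2 : i = k + 1
    · subst i2; rw [hk1 j hj]; simp [nextDifferential]
    have hi' := skipStrand_unskipStrand i1 i2
    have hiN : unskipStrand k i < C.n := by rw [← skipStrand_lt hk, hi']; omega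
    -- For strands above the cusp this is simplicity; for strands below it, triangularity.
    have col : ∀ l, l = k ∨ l = k + 1 → C'.coeff i l = 0 := by
      intro l hl
      by_cases hik : i < k
      · rcases hl with rfl | rfl
        · exact (s2 i hik).1
        · exact (s2 i hik).2
      · exact C'.upper _ _ (by omega)
    by_cases j1 : j = k
    · rw [col j (.inl j1)]; simp [nextDifferential, j1]
    by_cases j2 : j = k + 1
    · rw [col j (.inr j2)]; simp [nextDifferential, j2, i1]
    have hj' := skipStrand_unskipStrand j1 j2
    have hjN : unskipStrand k j < C.n := by rw [← skipStrand_lt hk, hj']; omega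
    have h3 := h1 _ hiN _ hjN
    simp only [nextDifferential, hi', hj', col (k + 1) (.inr rfl)] at h3
    simp [nextDifferential, i1, i2, j1, j2, h3]

end Cusps

/-! ## Morse complex sequences as lists of elementary tangles -/

section Lists

variable {F : Type*} [Field F]

open StrandComplex

/-- The local conditions hold along a list of elementary tangles that starts with `n` strands and the
coefficients `d`. -/
def Good : ℕ → (ℕ → ℕ → F) → List (ElemTangle F) → Prop
  | _, _, [] => True
  | n, d, T :: Ts => StepOk n d T ∧ Good (tangleNext n T) (nextDifferential d T) Ts

theorem good_append (n : ℕ) (d : ℕ → ℕ → F) (T T' : List (ElemTangle F)) :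
    Good n d (T ++ T') ↔
      Good n d T ∧ Good (T.foldl tangleNext n) (T.foldl nextDifferential d) T' := by
  induction T generalizing n d with
  | nil => simp [Good]
  | cons t T ih => simp [Good, ih, and_assoc]

theorem Good.isDifferential {n : ℕ} {d : ℕ → ℕ → F} {T : List (ElemTangle F)} (h : Good n d T)
    (hd : IsDifferential n d) : IsDifferential (T.foldl tangleNext n) (T.foldl nextDifferential d) := by
  induction T generalizing n d with
  | nil => exact hd
  | cons t T ih => exact ih h.2 (hd.next h.1)

theorem good_iff (n : ℕ) (d : ℕ → ℕ → F) (T : List (ElemTangle F)) :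
    Good n d T ↔ ∀ l (hl : l < T.length), StepOk ((T.take l).foldl tangleNext n)
      ((T.take l).foldl nextDifferential d) T[l] := by
  induction T generalizing n d with
  | nil => simp [Good]
  | cons t T ih =>
    simp only [Good, ih]
    constructor
    · rintro ⟨h1, h2⟩ l hl
      cases l with
      | zero => exact h1
      | succ l => exact h2 l (by simpa using hl)
    · intro h
      exact ⟨h 0 (by simp), fun l hl => h (l + 1) (by simpa using hl)⟩

theorem foldl_tangleNext (n : ℕ) (T : List (ElemTangle F)) :
    T.foldl tangleNext n = (T.filterMap ElemTangle.event?).foldl (fun n e => e.next n) n := by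
  induction T generalizing n with
  | nil => rfl
  | cons t T ih =>
    cases t with
    | front e => simp [ElemTangle.event?, tangleNext, ih]
    | slide h =>
      rw [List.filterMap_cons_none rfl]
      exact ih n

theorem filterMap_take_eq (T : List (ElemTangle F)) (l : ℕ) :
    (T.filterMap ElemTangle.event?).take (sliceIndex T l) =
      (T.take l).filterMap ElemTangle.event? := by
  conv_lhs => rw [← List.take_append_drop l T, List.filterMap_append]
  simp [sliceIndex]

theorem strands_sliceIndex {D : Front} {T : List (ElemTangle F)}
    (hT : T.filterMap ElemTangle.event? = D.events) (l : ℕ) :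
    D.strands (sliceIndex T l) = (T.take l).foldl tangleNext 0 := by
  rw [Front.strands, strandCount, ← hT, filterMap_take_eq, foldl_tangleNext]

theorem event_of_tangle {D : Front} {T : List (ElemTangle F)}
    (hT : T.filterMap ElemTangle.event? = D.events) {l : ℕ} (hl : l < T.length) {e : FrontEvent}
    (he : T[l] = .front e) :
    D.events[sliceIndex T l]? = some e ∧ sliceIndex T (l + 1) = sliceIndex T l + 1 := by
  constructor
  · have h1 : T.filterMap ElemTangle.event? = (T.take l).filterMap ElemTangle.event? ++
        (T.drop l).filterMap ElemTangle.event? := by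
      rw [← List.filterMap_append, List.take_append_drop]
    rw [← hT, h1, List.drop_eq_getElem_cons hl, he]
    simp [sliceIndex, ElemTangle.event?]
  · simp [sliceIndex, List.take_add_one, List.getElem?_eq_getElem hl, he, ElemTangle.event?]

theorem sliceIndex_succ_slide {T : List (ElemTangle F)} {l : ℕ} (hl : l < T.length)
    {h : Handleslide F} (he : T[l] = .slide h) : sliceIndex T (l + 1) = sliceIndex T l := by
  simp [sliceIndex, List.take_add_one, List.getElem?_eq_getElem hl, he, ElemTangle.event?]

theorem foldl_take_succ {α β : Type*} (f : β → α → β) (b : β) (T : List α) {l : ℕ}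
    (hl : l < T.length) : (T.take (l + 1)).foldl f b = f ((T.take l).foldl f b) T[l] := by
  rw [List.take_add_one, List.getElem?_eq_getElem hl, List.foldl_append]
  rfl

theorem Front.fits_of_getElem? (D : Front) {p : ℕ} {e : FrontEvent} (h : D.events[p]? = some e) :
    e.Fits (D.strands p) := by
  obtain ⟨hp, rfl⟩ := List.getElem?_eq_some_iff.1 h
  exact D.fits p hp

namespace MCS

variable {D : Front}

theorem cx_n (C : MCS D F) (l : Fin (C.tangles.length + 1)) :
    (C.cx l).n = (C.tangles.take l).foldl tangleNext 0 := by
  rw [C.cx_strands, strands_sliceIndex C.tangles_front]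

theorem stepOk_and_coeff_succ (C : MCS D F) (hs : C.SimpleLeftCusps) (l : Fin C.tangles.length) :
    StepOk (C.cx l.castSucc).n (C.cx l.castSucc).coeff C.tangles[l] ∧
      (C.cx l.succ).coeff = nextDifferential (C.cx l.castSucc).coeff C.tangles[l] := by
  refine coeff_of_tangleStep (C.step l) ?_ ?_ (hs l)
  · rw [C.cx_n, C.cx_n]
    exact foldl_take_succ _ _ _ l.2
  · intro e he
    rw [C.cx_strands]
    exact D.fits_of_getElem? (event_of_tangle C.tangles_front l.2 he).1

theorem coeff_cx (C : MCS D F) (hs : C.SimpleLeftCusps) (l : ℕ) (hl : l < C.tangles.length + 1) :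
    (C.cx ⟨l, hl⟩).coeff = (C.tangles.take l).foldl nextDifferential 0 := by
  induction l with
  | zero =>
    funext i j
    have := C.cx_n ⟨0, hl⟩
    simp only [List.take_zero, List.foldl_nil] at this ⊢
    exact (C.cx ⟨0, hl⟩).upper i j (by omega)
  | succ l ih =>
    rw [foldl_take_succ _ _ _ (by omega), ← ih (by omega)]
    exact (C.stepOk_and_coeff_succ hs ⟨l, by omega⟩).2

theorem good (C : MCS D F) (hs : C.SimpleLeftCusps) : Good 0 0 C.tangles := by
  rw [good_iff]
  intro l hl
  have h := (C.stepOk_and_coeff_succ hs ⟨l, hl⟩).1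
  rw [C.cx_n] at h
  have h2 := C.coeff_cx hs l (by omega)
  simp only [Fin.castSucc_mk] at h
  rwa [h2] at h

theorem coeffAt_eq (C : MCS D F) (hs : C.SimpleLeftCusps) {l : ℕ} (hl : l ≤ C.tangles.length) :
    C.coeffAt l = (C.tangles.take l).foldl nextDifferential 0 := by
  funext i j
  rw [coeffAt, dif_pos (by omega), coeff_cx C hs]

/-- All differentials are computed from the tangles, starting with the zero differential on no
strands. Thus an identity between MCSs may be checked on handleslides. -/
theorem ext_of_tangles {C C' : MCS D F} (hs : C.SimpleLeftCusps) (hs' : C'.SimpleLeftCusps)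
    (h : C.tangles = C'.tangles) : C = C' := by
  have h1 := C.cx_n
  have h2 := C'.cx_n
  have h3 := C.coeff_cx hs
  have h4 := C'.coeff_cx hs'
  cases C with | mk T _ cx _ _ =>
  cases C' with | mk T' _ cx' _ _ =>
  simp only at h
  subst h
  have : cx = cx' := by
    funext l
    exact ext_coeff ((h1 l).trans (h2 l).symm) ((h3 l l.2).trans (h4 l l.2).symm)
  subst this
  rfl

/-- A list of elementary tangles along which the local conditions hold comes from an MCS with simple
left cusps. -/
theorem exists_of_good {T : List (ElemTangle F)} (hT : T.filterMap ElemTangle.event? = D.events)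
    (hg : Good 0 0 T) : ∃ C : MCS D F, C.tangles = T ∧ C.SimpleLeftCusps := by
  have h0 : IsDifferential 0 (0 : ℕ → ℕ → F) := ⟨fun _ _ _ => rfl, Subsingleton.elim _ _⟩
  have hd : ∀ l, IsDifferential ((T.take l).foldl tangleNext 0)
      ((T.take l).foldl nextDifferential 0) := by
    intro l
    rw [← List.take_append_drop l T, good_append] at hg
    exact hg.1.isDifferential h0
  rw [good_iff] at hg
  refine ⟨{ tangles := T
            tangles_front := hT
            cx := fun l => ofCoeff _ _ (hd l)
            cx_strands := fun l => (strands_sliceIndex hT l).symm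
            step := fun l => tangleStep_ofCoeff _ _ (hg l l.2) (foldl_take_succ _ _ _ l.2)
              (foldl_take_succ _ _ _ l.2) }, rfl, ?_⟩
  intro l k hk
  change T[l] = _ at hk
  have h1 : (T.take (l + 1)).foldl nextDifferential 0 =
      nextDifferential ((T.take l).foldl nextDifferential 0) (.front (.leftCusp k)) := by
    rw [foldl_take_succ _ _ _ l.2]; exact congrArg _ hk
  have h2 := nextDifferential_leftCusp_simple ((T.take l).foldl nextDifferential 0) k
  rw [← h1] at h2
  have h3 := coeff_ofCoeff _ _ (hd (l + 1))
  constructor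
  · funext j
    refine ((ofCoeff _ _ (hd (l + 1))).coeff_fin k j).symm.trans ?_
    rw [h3]
    exact (h2 j).1
  · intro j hj
    change (ofCoeff _ _ (hd (l + 1))).coeff j k = 0 ∧ (ofCoeff _ _ (hd (l + 1))).coeff j (k + 1) = 0
    rw [h3]
    exact (h2 j).2 hj

end MCS

/-! ### Maslov potentials and gradings -/

/-- A function on the strands that behaves like a Maslov potential modulo `m`. -/
structure IsPotential (D : Front) {m : ℕ} (ν : ℕ → ℕ → ZMod m) : Prop where
  leftCusp : ∀ p k, D.events[p]? = some (.leftCusp k) →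
    ν (p + 1) k = ν (p + 1) (k + 1) + 1 ∧ ∀ i < D.strands p, ν (p + 1) (skipStrand k i) = ν p i
  crossing : ∀ p k, D.events[p]? = some (.crossing k) →
    ∀ i < D.strands p, ν (p + 1) (swapStrand k i) = ν p i
  rightCusp : ∀ p k b, D.events[p]? = some (.rightCusp k b) →
    ν p k = ν p (k + 1) + 1 ∧ ∀ i < D.strands (p + 1), ν (p + 1) i = ν p (skipStrand k i)

theorem strandCount_succ {E : List FrontEvent} {p : ℕ} {e : FrontEvent} (h : E[p]? = some e) :
    strandCount E (p + 1) = e.next (strandCount E p) := by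
  obtain ⟨hp, rfl⟩ := List.getElem?_eq_some_iff.1 h
  exact foldl_take_succ _ _ _ hp

theorem Front.strands_succ (D : Front) {p : ℕ} {e : FrontEvent} (h : D.events[p]? = some e) :
    D.strands (p + 1) = e.next (D.strands p) := strandCount_succ h

theorem Front.MaslovPotential.isPotential {D : Front} (μ : D.MaslovPotential) {m : ℕ}
    (hm : m ∣ 2 * D.rotationNumber) : IsPotential D (μ.mod m) := by
  have hcont : ∀ p i j e, D.events[p]? = some e → i < D.strands p → j < D.strands (p + 1) →
      e.Continues i j → μ.mod m p i = μ.mod m (p + 1) j := by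
    intro p i j e he hi hj hc
    have hp := (List.getElem?_eq_some_iff.1 he).1
    have := μ.continues ⟨⟨p, by omega⟩, ⟨i, hi⟩⟩ ⟨⟨p + 1, by omega⟩, ⟨j, hj⟩⟩ ⟨rfl, e, he, hc⟩
    exact congrArg ZMod.cast this
  -- The cast is additive because `m` divides the modulus of `μ`.
  have hcast : ∀ a b : ZMod (2 * D.rotationNumber), a = b + 1 →
      (a.cast : ZMod m) = b.cast + 1 := by
    rintro a b rfl
    rw [ZMod.cast_add hm, ZMod.cast_one hm]
  refine ⟨?_, ?_, ?_⟩
  · intro p k he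
    have hf : k ≤ D.strands p := D.fits_of_getElem? he
    have hn : D.strands (p + 1) = D.strands p + 2 := D.strands_succ he
    have hp := (List.getElem?_eq_some_iff.1 he).1
    constructor
    · refine hcast _ _ (μ.cusp ⟨⟨p + 1, by omega⟩, ⟨k, ?_⟩⟩ ⟨⟨p + 1, by omega⟩, ⟨k + 1, ?_⟩⟩
        ⟨.inl ⟨p, rfl, he⟩, rfl, rfl⟩)
      · change k < D.strands (p + 1); omega
      · change k + 1 < D.strands (p + 1); omega
    · intro i hi
      exact (hcont p i _ _ he hi (by rw [hn, skipStrand_lt hf]; exact hi) rfl).symm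
  · intro p k he i hi
    have hf : k + 1 < D.strands p := D.fits_of_getElem? he
    have hn : D.strands (p + 1) = D.strands p := D.strands_succ he
    exact (hcont p i _ _ he hi (by rw [hn, swapStrand_lt hf]; exact hi) rfl).symm
  · intro p k b he
    have hf : k + 1 < D.strands p := D.fits_of_getElem? he
    have hn : D.strands (p + 1) = D.strands p - 2 := D.strands_succ he
    have hp := (List.getElem?_eq_some_iff.1 he).1
    constructor
    · refine hcast _ _ (μ.cusp ⟨⟨p, by omega⟩, ⟨k, ?_⟩⟩ ⟨⟨p, by omega⟩, ⟨k + 1, ?_⟩⟩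
        ⟨.inr ⟨b, he⟩, rfl, rfl⟩)
      · change k < D.strands p; omega
      · exact hf
    · intro i hi
      have h2 : D.strands p = D.strands (p + 1) + 2 := by omega
      exact (hcont p _ i _ he (by rw [h2, skipStrand_lt (by omega)]; exact hi) hi rfl).symm

/-- The differential `d` of slice `p` lowers the potential by `1`. -/
def GradedDiff {m : ℕ} (ν : ℕ → ℕ → ZMod m) (p : ℕ) (d : ℕ → ℕ → F) : Prop :=
  ∀ i j, d i j ≠ 0 → ν p j = ν p i - 1

theorem GradedDiff.slide {m : ℕ} {ν : ℕ → ℕ → ZMod m} {p : ℕ} {d : ℕ → ℕ → F}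
    (h : GradedDiff ν p d) {s : Handleslide F} (hs : ν p s.top = ν p s.bot) :
    GradedDiff ν p (nextDifferential d (.slide s)) := by
  intro i j hij
  have h1 := h i j
  have h2 := h s.bot j
  have h3 := h i s.top
  have h4 := h s.bot s.top
  by_contra hne
  apply hij
  have e1 : d i j = 0 := by_contra fun c => hne (h1 c)
  have e2 : i = s.top → d s.bot j = 0 := fun e => by_contra fun c => hne (by rw [h2 c, e, hs])
  have e3 : j = s.bot → d i s.top = 0 := fun e => by_contra fun c => hne (by rw [← h3 c, e, hs])
  have e4 : i = s.top → j = s.bot → d s.bot s.top = 0 :=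
    fun e e' => by_contra fun c => hne (by rw [e, e', hs]; exact hs.symm.trans (h4 c))
  simp only [nextDifferential]
  split_ifs with c1 c2 c2 <;> simp_all

theorem GradedDiff.front {D : Front} {m : ℕ} {ν : ℕ → ℕ → ZMod m} (hν : IsPotential D ν) {p : ℕ}
    {d : ℕ → ℕ → F} (hd : IsDifferential (D.strands p) d)
    (h : GradedDiff ν p d) {e : FrontEvent} (he : D.events[p]? = some e)
    (hok : StepOk (D.strands p) d (.front e)) :
    GradedDiff ν (p + 1) (nextDifferential d (.front e)) := by
  have hd' : IsDifferential (D.strands (p + 1)) (nextDifferential d (.front e)) := by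
    rw [D.strands_succ he]; exact hd.next hok
  have hin : ∀ {i j}, d i j ≠ 0 → i < j ∧ j < D.strands p := fun {i j} =>
    not_imp_comm.1 (hd.upper i j)
  match e, he, hok with
  | .crossing k, he, hok =>
    intro i j hij
    have hij' : d (swapStrand k i) (swapStrand k j) ≠ 0 := hij
    have h1 := h _ _ hij'
    have h2 := hin hij'
    rw [← hν.crossing p k he _ h2.2, ← hν.crossing p k he _ (h2.1.trans h2.2),
      swapStrand_swapStrand, swapStrand_swapStrand] at h1
    exact h1
  | .leftCusp k, he, hok =>
    intro i j hij
    have h1 := hν.leftCusp p k he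
    simp only [nextDifferential] at hij
    split_ifs at hij with c1 c2
    · rw [c1.1, c1.2, h1.1]; ring
    · simp at hij
    · push Not at c2
      have h2 := hin hij
      have h3 := h _ _ hij
      rw [← h1.2 _ h2.2, ← h1.2 _ (h2.1.trans h2.2), skipStrand_unskipStrand c2.1 c2.2.1,
        skipStrand_unskipStrand c2.2.2.1 c2.2.2.2] at h3
      exact h3
  | .rightCusp k b, he, hok =>
    intro i j hij
    have h1 := hν.rightCusp p k b he
    have h2 := not_imp_comm.1 (hd'.upper i j) hij
    rw [h1.2 i (h2.1.trans h2.2), h1.2 j h2.2]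
    simp only [nextDifferential] at hij
    -- If the direct coefficient vanishes, the correction term is non-zero. It is a zigzag from
    -- `skipStrand k i` to `k + 1`, back to `k` and on to `skipStrand k j`; the drop of the
    -- potential by 1 between the cusp strands makes its total degree again 1.
    by_cases c1 : d (skipStrand k i) (skipStrand k j) = 0
    · have c2 : d (skipStrand k i) (k + 1) ≠ 0 := fun c => hij (by simp [c1, c])
      have c3 : d k (skipStrand k j) ≠ 0 := fun c => hij (by simp [c1, c])
      rw [h _ _ c3, h1.1, h _ _ c2]; ring
    · exact h _ _ c1

/-- The zero differential is graded, and every tangle preserves gradedness as long as its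
handleslides join strands of equal potential. So only the handleslides need checking. -/
theorem MCS.isGraded_of_slides {D : Front} {m : ℕ} {ν : ℕ → ℕ → ZMod m} (hν : IsPotential D ν)
    (C : MCS D F) (hs : C.SimpleLeftCusps)
    (H : ∀ l h, C.tangles[l]? = some (.slide h) →
      ν (sliceIndex C.tangles l) h.top = ν (sliceIndex C.tangles l) h.bot) : C.IsGraded ν := by
  refine ⟨?_, H⟩
  have key : ∀ l (hl : l < C.tangles.length + 1),
      GradedDiff ν (sliceIndex C.tangles l) (C.cx ⟨l, hl⟩).coeff := by
    intro l
    induction l with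
    | zero =>
      intro hl i j hij
      rw [C.coeff_cx hs] at hij
      simp at hij
    | succ l ih =>
      intro hl
      have hl' : l < C.tangles.length := by omega
      have ih' := ih (by omega)
      have h1 := C.stepOk_and_coeff_succ hs ⟨l, hl'⟩
      simp only [Fin.succ_mk, Fin.castSucc_mk] at h1
      rw [h1.2]
      have h3 := h1.1
      have hd := (C.cx ⟨l, by omega⟩).isDifferential
      rw [C.cx_strands] at h3 hd
      change StepOk _ _ C.tangles[l] at h3
      change GradedDiff ν _ (nextDifferential _ C.tangles[l])
      cases hT : C.tangles[l] with
      | slide h =>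
        rw [sliceIndex_succ_slide hl' hT]
        exact ih'.slide (H l h (by rw [List.getElem?_eq_getElem hl', hT]))
      | front e =>
        obtain ⟨h4, h5⟩ := event_of_tangle C.tangles_front hl' hT
        rw [h5]
        rw [hT] at h3
        exact ih'.front hν hd h4 h3
  intro l i _ j _ hij
  exact key l l.2 i j hij

end Lists

/-! ## Collections of handleslides as matrices -/

section Collections

variable {F : Type*} [Field F]

/-- Left multiplication of `1 + V` by the elementary matrix `1 + r E t b`, for strictly upper
triangular `V` and `t < b`. -/
def slideRow (t b : ℕ) (r : F) (V : SlideCollection F) : SlideCollection F := fun i j =>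
  V i j + (if i = t then r * V b j else 0) + (if i = t ∧ j = b then r else 0)

/-- Right multiplication of `1 - W` by the elementary matrix `1 - s E t b`, for strictly upper
triangular `W` and `t < b`. -/
def slideCol (t b : ℕ) (s : F) (W : SlideCollection F) : SlideCollection F := fun i j =>
  W i j - (if j = b then W i t * s else 0) + (if i = t ∧ j = b then s else 0)

/-- The collection `V` after the handleslide of the strands `k` and `k + 1` with coefficient `r` has been
incorporated, and the handleslide of these strands has been removed. -/
def passSlides (k : ℕ) (r : F) (V : SlideCollection F) : SlideCollection F := fun i j =>
  if i = k ∧ j = k + 1 then 0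
  else V i j + (if i = k then r * V (k + 1) j else 0) -
    (if j = k + 1 then V i k * (V k (k + 1) + r) else 0)

/-- The order of endpoints in a properly ordered collection. -/
def ProperLT (x y : ℕ × ℕ) : Prop := y.1 < x.1 ∨ x.1 = y.1 ∧ x.2 < y.2

theorem mem_properOrder {n : ℕ} {x : ℕ × ℕ} : x ∈ properOrder n ↔ x.1 < x.2 ∧ x.2 < n := by
  obtain ⟨i, j⟩ := x
  simp only [properOrder, List.mem_flatMap, List.mem_reverse, List.mem_range, List.mem_map,
    List.mem_filter, decide_eq_true_eq, Prod.mk.injEq]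
  constructor
  · rintro ⟨t, ht, b, ⟨h1, h2⟩, rfl, rfl⟩
    exact ⟨h2, h1⟩
  · rintro ⟨h1, h2⟩
    exact ⟨i, by omega, j, ⟨h2, h1⟩, rfl, rfl⟩

theorem pairwise_properOrder (n : ℕ) : (properOrder n).Pairwise ProperLT := by
  rw [properOrder, List.pairwise_flatMap]
  constructor
  · intro t _
    rw [List.pairwise_map]
    refine List.Pairwise.imp ?_ (List.pairwise_lt_range.filter _)
    intro a b hab
    exact .inr ⟨rfl, hab⟩
  · rw [List.pairwise_reverse]
    refine List.Pairwise.imp ?_ List.pairwise_lt_range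
    intro a b hab x hx y hy
    simp only [List.mem_map] at hx hy
    obtain ⟨_, _, rfl⟩ := hx
    obtain ⟨_, _, rfl⟩ := hy
    exact .inl hab

/-- In a list sorted by an asymmetric relation, what precedes an entry is what is related to it.
This turns the path of a moving handleslide into inequalities of strand numbers. -/
theorem mem_takeWhile_ne {α : Type*} [DecidableEq α] {R : α → α → Prop} {l : List α} {a x : α}
    (hl : l.Pairwise R) (hR : ∀ y z, R y z → ¬ R z y) (ha : a ∈ l) :
    x ∈ l.takeWhile (fun y => y ≠ a) ↔ x ∈ l ∧ R x a := by
  have hirr : ¬ R a a := fun h => hR _ _ h h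
  induction l with
  | nil => simp at ha
  | cons y l ih =>
    rw [List.pairwise_cons] at hl
    by_cases hy : y = a
    · subst hy
      simp only [ne_eq, not_true_eq_false, decide_false, Bool.false_eq_true, not_false_eq_true,
        List.takeWhile_cons_of_neg, List.not_mem_nil, List.mem_cons, false_iff, not_and]
      rintro (rfl | h)
      · exact hirr
      · exact hR _ _ (hl.1 x h)
    · have ha' : a ∈ l := by
        rcases List.mem_cons.1 ha with h | h
        · exact absurd h.symm hy
        · exact h
      rw [List.takeWhile_cons_of_pos (by simpa using hy), List.mem_cons, List.mem_cons]
      simp only [ih hl.2 ha']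
      constructor
      · rintro (rfl | h)
        · exact ⟨.inl rfl, hl.1 a ha'⟩
        · exact ⟨.inr h.1, h.2⟩
      · rintro ⟨rfl | h, h'⟩
        · exact .inl rfl
        · exact .inr ⟨h, h'⟩

theorem ProperLT.asymm (x y : ℕ × ℕ) (h : ProperLT x y) : ¬ ProperLT y x := by
  unfold ProperLT at *; omega

theorem mem_takeWhile_properOrder {n t b : ℕ} (ht : t < b) (hb : b < n) {x : ℕ × ℕ} :
    x ∈ (properOrder n).takeWhile (fun y => y ≠ (t, b)) ↔
      (x.1 < x.2 ∧ x.2 < n) ∧ ProperLT x (t, b) := by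
  rw [mem_takeWhile_ne (pairwise_properOrder n) ProperLT.asymm (mem_properOrder.2 ⟨ht, hb⟩),
    mem_properOrder]

theorem mem_takeWhile_properOrder_reverse {n t b : ℕ} (ht : t < b) (hb : b < n) {x : ℕ × ℕ} :
    x ∈ (properOrder n).reverse.takeWhile (fun y => y ≠ (t, b)) ↔
      (x.1 < x.2 ∧ x.2 < n) ∧ ProperLT (t, b) x := by
  rw [mem_takeWhile_ne (R := fun x y => ProperLT y x)
    (List.pairwise_reverse.2 (pairwise_properOrder n)) (fun x y h => ProperLT.asymm y x h)
    (List.mem_reverse.2 (mem_properOrder.2 ⟨ht, hb⟩)), List.mem_reverse, mem_properOrder]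

theorem nodup_properOrder (n : ℕ) : (properOrder n).Nodup :=
  (pairwise_properOrder n).imp fun {x y} h e => by subst e; exact ProperLT.asymm _ _ h h

/-! ### Interchanging one handleslide with a list of handleslides -/

/-- None of the handleslides passed ends on `t`, so only those starting on `b` interact. They are
read from row `b`, whereas the created ones are merged into row `t ≠ b`. Nothing that is still to be
read changes, and the contributions simply add up. -/
theorem foldl_created_row_mem {t b : ℕ} (htb : t ≠ b) (r : F) (l : List (ℕ × ℕ)) (hl : l.Nodup)
    (h : ∀ x ∈ l, x.2 ≠ t) (V : SlideCollection F) :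
    l.foldl (fun W x => (created ⟨x.1, x.2, W x.1 x.2⟩ ⟨t, b, r⟩).foldl mergeSlide W) V =
      fun i j => V i j + if i = t ∧ (b, j) ∈ l then V b j * r else 0 := by
  induction l generalizing V with
  | nil => simp
  | cons x l ih =>
    obtain ⟨x1, x2⟩ := x
    rw [List.nodup_cons] at hl
    have hx := h (x1, x2) List.mem_cons_self
    simp only at hx
    rw [List.foldl_cons, ih hl.2 fun y hy => h y (List.mem_cons_of_mem _ hy)]
    funext i j
    by_cases hb : x1 = b
    · subst hb
      simp only [created, hx, if_false, if_true, List.foldl_cons, List.foldl_nil, mergeSlide,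
        htb.symm, false_and, List.mem_cons, Prod.mk.injEq, true_and]
      by_cases h1 : i = t
      · by_cases h2 : j = x2
        · subst h2; simp [h1, hl.1]
        · simp [h1, h2]
      · simp [h1]
    · simp [created, hx, hb, Ne.symm hb]

/-- The mirror image: none of the handleslides passed starts on `b`, so column `t` is read and
column `b` is written. -/
theorem foldl_created_col_mem {t b : ℕ} (htb : t ≠ b) (r : F) (l : List (ℕ × ℕ)) (hl : l.Nodup)
    (h : ∀ x ∈ l, x.1 ≠ b) (V : SlideCollection F) :
    l.foldl (fun W x => (created ⟨x.1, x.2, W x.1 x.2⟩ ⟨t, b, r⟩).foldl mergeSlide W) V =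
      fun i j => V i j - if j = b ∧ (i, t) ∈ l then V i t * r else 0 := by
  induction l generalizing V with
  | nil => simp
  | cons x l ih =>
    obtain ⟨x1, x2⟩ := x
    rw [List.nodup_cons] at hl
    have hx := h (x1, x2) List.mem_cons_self
    simp only at hx
    rw [List.foldl_cons, ih hl.2 fun y hy => h y (List.mem_cons_of_mem _ hy)]
    funext i j
    by_cases hb : x2 = t
    · subst hb
      simp only [created, if_true, List.foldl_cons, List.foldl_nil, mergeSlide,
        htb, and_false, if_false, List.mem_cons, Prod.mk.injEq, and_true]
      by_cases h1 : j = b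
      · by_cases h2 : i = x1
        · subst h2; simp [h1, hl.1]; ring
        · simp [h1, h2]
      · simp [h1]
    · simp [created, hx, hb, Ne.symm hb]

theorem foldl_created_left_row_mem {t b : ℕ} (htb : t ≠ b) (r : F) (l : List (ℕ × ℕ)) (hl : l.Nodup)
    (h : ∀ x ∈ l, x.2 ≠ t) (V : SlideCollection F) :
    l.foldl (fun W x => (created ⟨t, b, r⟩ ⟨x.1, x.2, W x.1 x.2⟩).foldl mergeSlide W) V =
      fun i j => V i j - if i = t ∧ (b, j) ∈ l then r * V b j else 0 := by
  induction l generalizing V with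
  | nil => simp
  | cons x l ih =>
    obtain ⟨x1, x2⟩ := x
    rw [List.nodup_cons] at hl
    have hx := h (x1, x2) List.mem_cons_self
    simp only at hx
    rw [List.foldl_cons, ih hl.2 fun y hy => h y (List.mem_cons_of_mem _ hy)]
    funext i j
    by_cases hb : x1 = b
    · subst hb
      simp only [created, if_true, List.foldl_cons, List.foldl_nil, mergeSlide,
        htb.symm, false_and, if_false, List.mem_cons, Prod.mk.injEq, true_and]
      by_cases h1 : i = t
      · by_cases h2 : j = x2
        · subst h2; simp [h1, hl.1]; ring
        · simp [h1, h2]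
      · simp [h1]
    · simp [created, Ne.symm hx, Ne.symm hb]

/-- When the list contains the support of row `b`, the path no longer matters and the outcome is a
row operation. -/
theorem foldl_created_row {t b : ℕ} (htb : t ≠ b) (r : F) {l : List (ℕ × ℕ)} (hl : l.Nodup)
    (h : ∀ x ∈ l, x.2 ≠ t) {V : SlideCollection F} (hV : ∀ j, V b j ≠ 0 → (b, j) ∈ l) :
    l.foldl (fun W x => (created ⟨x.1, x.2, W x.1 x.2⟩ ⟨t, b, r⟩).foldl mergeSlide W) V =
      fun i j => V i j + if i = t then V b j * r else 0 := by
  rw [foldl_created_row_mem htb r l hl h]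
  funext i j
  by_cases h0 : V b j = 0
  · simp [h0]
  · simp [hV j h0]

theorem foldl_created_col {t b : ℕ} (htb : t ≠ b) (r : F) {l : List (ℕ × ℕ)} (hl : l.Nodup)
    (h : ∀ x ∈ l, x.1 ≠ b) {V : SlideCollection F} (hV : ∀ i, V i t ≠ 0 → (i, t) ∈ l) :
    l.foldl (fun W x => (created ⟨x.1, x.2, W x.1 x.2⟩ ⟨t, b, r⟩).foldl mergeSlide W) V =
      fun i j => V i j - if j = b then V i t * r else 0 := by
  rw [foldl_created_col_mem htb r l hl h]
  funext i j
  by_cases h0 : V i t = 0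
  · simp [h0]
  · simp [hV i h0]

theorem foldl_created_left_row {t b : ℕ} (htb : t ≠ b) (r : F) {l : List (ℕ × ℕ)} (hl : l.Nodup)
    (h : ∀ x ∈ l, x.2 ≠ t) {V : SlideCollection F} (hV : ∀ j, V b j ≠ 0 → (b, j) ∈ l) :
    l.foldl (fun W x => (created ⟨t, b, r⟩ ⟨x.1, x.2, W x.1 x.2⟩).foldl mergeSlide W) V =
      fun i j => V i j - if i = t then r * V b j else 0 := by
  rw [foldl_created_left_row_mem htb r l hl h]
  funext i j
  by_cases h0 : V b j = 0
  · simp [h0]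
  · simp [hV j h0]

/-! ### Incorporation and removal as row and column operations -/

theorem StrictUpper.lt_of_ne_zero {n : ℕ} {V : ℕ → ℕ → F} (hV : StrictUpper n V) {i j : ℕ}
    (h : V i j ≠ 0) : i < j ∧ j < n := not_imp_comm.1 (hV i j) h

theorem StrictUpper.neg {n : ℕ} {V : ℕ → ℕ → F} (hV : StrictUpper n V) : StrictUpper n (-V) :=
  fun i j h => by simp [hV i j h]

/-- Coming from the right of an oppositely ordered collection, `h` passes the handleslides with
larger top strand, or with the same top and smaller bottom strand. They include all that start on
`h.bot` and none that ends on `h.top`. So this is left multiplication of `1 + V` by an elementary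
matrix. -/
theorem incorporateRight_reverse {n : ℕ} {V : SlideCollection F} (hV : StrictUpper n V)
    {h : Handleslide F} (ht : h.top < h.bot) (hb : h.bot < n) :
    incorporateRight (properOrder n).reverse V h = slideRow h.top h.bot h.coeff V := by
  obtain ⟨t, b, r⟩ := h
  simp only at ht hb
  rw [incorporateRight, List.reverse_reverse, foldl_created_row ht.ne r
    (List.Sublist.nodup (List.takeWhile_sublist _) (nodup_properOrder n))
    (fun x hx => by
      rw [mem_takeWhile_properOrder ht hb] at hx
      unfold ProperLT at hx; simp only at hx; omega)
    (fun j h0 => by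
      have h1 := hV.lt_of_ne_zero h0
      rw [mem_takeWhile_properOrder ht hb]
      unfold ProperLT; simp only; omega)]
  funext i j
  simp only [mergeSlide, slideRow]
  split_ifs <;> ring

/-- The properly ordered collection `-V` is inverse to the oppositely ordered `V`. Adding an inverse
handleslide on its left is therefore the same as adding the handleslide on the right of `V`. -/
theorem incorporateLeft_neg {n : ℕ} {V : SlideCollection F} (hV : StrictUpper n V)
    {t b : ℕ} (r : F) (ht : t < b) (hb : b < n) :
    incorporateLeft (properOrder n) (-V) ⟨t, b, -r⟩ = -slideRow t b r V := by
  rw [incorporateLeft, foldl_created_left_row ht.ne _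
    (List.Sublist.nodup (List.takeWhile_sublist _) (nodup_properOrder n))
    (fun x hx => by
      rw [mem_takeWhile_properOrder ht hb] at hx
      unfold ProperLT at hx; simp only at hx; omega)
    (fun j h0 => by
      have h1 := hV.neg.lt_of_ne_zero h0
      rw [mem_takeWhile_properOrder ht hb]
      unfold ProperLT; simp only; omega)]
  funext i j
  simp only [mergeSlide, slideRow, Pi.neg_apply]
  split_ifs <;> ring

/-- In the proper order the inverse of the product is `1 - V`, and a handleslide arriving on the
right multiplies this inverse on the right: a column operation. -/
theorem incorporateRight_proper {n : ℕ} {V : SlideCollection F} (hV : StrictUpper n V)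
    {t b : ℕ} (s : F) (ht : t < b) (hb : b < n) :
    incorporateRight (properOrder n) V ⟨t, b, s⟩ = slideCol t b s V := by
  rw [incorporateRight, foldl_created_col ht.ne s
    (List.Sublist.nodup (List.takeWhile_sublist _) (List.nodup_reverse.2 (nodup_properOrder n)))
    (fun x hx => by
      rw [mem_takeWhile_properOrder_reverse ht hb] at hx
      unfold ProperLT at hx; simp only at hx; omega)
    (fun i h0 => by
      have h1 := hV.lt_of_ne_zero h0
      rw [mem_takeWhile_properOrder_reverse ht hb]
      unfold ProperLT; simp only; omega)]
  funext i j
  simp only [mergeSlide, slideCol]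
  split_ifs <;> ring

theorem removeLeft_proper {n : ℕ} {V : SlideCollection F} (hV : StrictUpper n V)
    {t b : ℕ} (ht : t < b) (hb : b < n) :
    removeLeft (properOrder n) V t b = fun i j => if i = t ∧ j = b then 0 else
      V i j + if i = t then V b j * V t b else 0 := by
  rw [removeLeft, foldl_created_row ht.ne _
    (List.nodup_reverse.2 (List.Sublist.nodup (List.takeWhile_sublist _) (nodup_properOrder n)))
    (fun x hx => by
      rw [List.mem_reverse, mem_takeWhile_properOrder ht hb] at hx
      unfold ProperLT at hx; simp only at hx; omega)
    (fun j h0 => by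
      have h1 := hV.lt_of_ne_zero h0
      rw [List.mem_reverse, mem_takeWhile_properOrder ht hb]
      unfold ProperLT; simp only; omega)]

theorem removeLeft_reverse {n : ℕ} {V : SlideCollection F} (hV : StrictUpper n V)
    {t b : ℕ} (ht : t < b) (hb : b < n) :
    removeLeft (properOrder n).reverse V t b = fun i j => if i = t ∧ j = b then 0 else
      V i j - if j = b then V i t * V t b else 0 := by
  rw [removeLeft, foldl_created_col ht.ne _
    (List.nodup_reverse.2 (List.Sublist.nodup (List.takeWhile_sublist _)
      (List.nodup_reverse.2 (nodup_properOrder n))))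
    (fun x hx => by
      rw [List.mem_reverse, mem_takeWhile_properOrder_reverse ht hb] at hx
      unfold ProperLT at hx; simp only at hx; omega)
    (fun i h0 => by
      have h1 := hV.lt_of_ne_zero h0
      rw [List.mem_reverse, mem_takeWhile_properOrder_reverse ht hb]
      unfold ProperLT; simp only; omega)]

theorem StrictUpper.slideRow {n t b : ℕ} {V : SlideCollection F} (hV : StrictUpper n V) (r : F)
    (ht : t < b) (hb : b < n) : StrictUpper n (slideRow t b r V) := by
  intro i j hij
  have h1 := hV i j hij
  have h2 : i = t → V b j = 0 := fun h => hV _ _ (by omega)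
  have h3 : ¬ (i = t ∧ j = b) := by omega
  simp only [_root_.slideRow, h1, h3, if_false]
  split_ifs with h <;> simp_all

theorem StrictUpper.slideCol {n t b : ℕ} {V : SlideCollection F} (hV : StrictUpper n V) (r : F)
    (ht : t < b) (hb : b < n) : StrictUpper n (slideCol t b r V) := by
  intro i j hij
  have h1 := hV i j hij
  have h2 : j = b → V i t = 0 := fun h => hV _ _ (by omega)
  have h3 : ¬ (i = t ∧ j = b) := by omega
  simp only [_root_.slideCol, h1, h3, if_false]
  split_ifs with h <;> simp_all

/-- What Φ does at a graded crossing before sliding past it: take in the SR-form handleslide from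
the right, then expel the `(k, k + 1)` handleslide to the left. -/
theorem passSlides_eq_removeLeft_reverse {n k : ℕ} {V : SlideCollection F} (hV : StrictUpper n V)
    (r : F) (hk : k + 1 < n) :
    removeLeft (properOrder n).reverse (slideRow k (k + 1) r V) k (k + 1) = passSlides k r V := by
  rw [removeLeft_reverse (hV.slideRow r (by omega) hk) (by omega) hk]
  have h1 : V (k + 1) (k + 1) = 0 := hV _ _ (by omega)
  have h2 : V (k + 1) k = 0 := hV _ _ (by omega)
  have h3 : V k k = 0 := hV _ _ (by omega)
  funext i j
  by_cases hi : i = k <;> by_cases hj : j = k + 1 <;>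
    simp [slideRow, passSlides, hi, hj, h1]

/-- The same passage seen by Ψ, whose collection is `-V`: the A-form handleslide comes in from the
right and the SR-form one is expelled to the left. The result is again the negative of the
collection of Φ. -/
theorem passSlides_eq_removeLeft_proper {n k : ℕ} {V : SlideCollection F} (hV : StrictUpper n V)
    (r : F) (hk : k + 1 < n) :
    removeLeft (properOrder n) (slideCol k (k + 1) (V k (k + 1) + r) (-V)) k (k + 1) =
      -passSlides k r V := by
  rw [removeLeft_proper (hV.neg.slideCol _ (by omega) hk) (by omega) hk]
  have h1 : V (k + 1) (k + 1) = 0 := hV _ _ (by omega)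
  have h2 : V (k + 1) k = 0 := hV _ _ (by omega)
  have h3 : V k k = 0 := hV _ _ (by omega)
  funext i j
  by_cases hi : i = k <;> by_cases hj : j = k + 1 <;>
    simp [slideCol, passSlides, hi, hj, h3] <;> ring

theorem StrictUpper.passSlides {n k : ℕ} {V : SlideCollection F} (hV : StrictUpper n V)
    (r : F) (hk : k + 1 < n) : StrictUpper n (passSlides k r V) := by
  intro i j hij
  have h1 := hV i j hij
  have h2 : i = k → V (k + 1) j = 0 := fun h => hV _ _ (by omega)
  have h3 : j = k + 1 → V i k = 0 := fun h => hV _ _ (by omega)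
  simp only [_root_.passSlides, h1]
  split_ifs with c1 c2 c3 c3 <;> simp_all

theorem slideRow_zero (t b : ℕ) (V : SlideCollection F) : slideRow t b 0 V = V := by
  funext i j; simp [slideRow]

end Collections

/-! ## The two sweeps as one -/

section Sweep

variable {F : Type*} [Field F] [DecidableEq F]

/-- The common state of the two sweeps at a slice: the involution of the ruling, the differential of the
SR-form MCS, and the collection that separates the SR-form from the A-form MCS. -/
structure SweepState (F : Type*) where
  inv : ℕ → ℕ
  diff : ℕ → ℕ → F
  coll : SlideCollection F

namespace SweepState

variable {m : ℕ} (ν : ℕ → ℕ → ZMod m) (p : ℕ) (S : SweepState F) (r : F)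

/-- The handleslides of the A-form MCS to the left of an event. -/
def aLeft : FrontEvent → List (Handleslide F)
  | .leftCusp _ => []
  | .crossing k => if Front.GradedCrossing ν p k then [⟨k, k + 1, S.coll k (k + 1) + r⟩] else []
  | .rightCusp k _ => if m = 1 then [⟨k, k + 1, S.coll k (k + 1) + r⟩] else []

/-- The handleslides of the SR-form MCS to the left of an event. -/
def srLeft : FrontEvent → List (Handleslide F)
  | .leftCusp _ => []
  | .crossing k =>
      if Front.GradedCrossing ν p k ∧ ¬ (Front.Normality S.inv k ∧ r = 0) then [⟨k, k + 1, r⟩] else []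
  | .rightCusp k _ => if m = 1 then [⟨k, k + 1, r⟩] else []

/-- The handleslides of the SR-form MCS to the right of an event. -/
def srRight : FrontEvent → List (Handleslide F)
  | .crossing k =>
      if Front.GradedCrossing ν p k then
        if Front.Normality S.inv k then
          if r = 0 then [] else switchTail S.inv S.diff k r
        else returnTail S.inv S.diff k r
      else []
  | _ => []

/-- The involution of the ruling after an event. -/
def invAfter : FrontEvent → ℕ → ℕ
  | .crossing k =>
      if Front.GradedCrossing ν p k ∧ Front.Normality S.inv k ∧ r ≠ 0 then S.inv
      else nextInvolution S.inv (.crossing k)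
  | e => nextInvolution S.inv e

/-- The part of the SR-form MCS that belongs to an event. -/
def srBlock (e : FrontEvent) : List (ElemTangle F) :=
  (S.srLeft ν p r e).map .slide ++ [.front e] ++ (S.srRight ν p r e).map .slide

/-- The part of the A-form MCS that belongs to an event. -/
def aBlock (e : FrontEvent) : List (ElemTangle F) :=
  (S.aLeft ν p r e).map .slide ++ [.front e]

/-- Incorporate a list of handleslides into a collection. -/
def incorporate (V : SlideCollection F) (Q : List (Handleslide F)) : SlideCollection F :=
  Q.foldl (fun V h => slideRow h.top h.bot h.coeff V) V

/-- The collection after an event. -/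
def collAfter : FrontEvent → SlideCollection F
  | .leftCusp _ => 0
  | .crossing k =>
      if Front.GradedCrossing ν p k then
        incorporate (crossSlides k (passSlides k r S.coll)) (S.srRight ν p r (.crossing k))
      else crossSlides k S.coll
  | .rightCusp k _ => cuspSlides k S.coll

/-- The state after an event. -/
def next (e : FrontEvent) : SweepState F :=
  ⟨S.invAfter ν p r e, (S.srBlock ν p r e).foldl nextDifferential S.diff, S.collAfter ν p r e⟩

end SweepState

open SweepState

theorem strictUpper_incorporate {n : ℕ} {V : SlideCollection F} (hV : StrictUpper n V)
    {Q : List (Handleslide F)} (hQ : ∀ h ∈ Q, h.top < h.bot ∧ h.bot < n) :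
    StrictUpper n (incorporate V Q) := by
  induction Q generalizing V with
  | nil => exact hV
  | cons h Q ih =>
    have h1 := hQ h List.mem_cons_self
    exact ih (hV.slideRow _ h1.1 h1.2) fun x hx => hQ x (List.mem_cons_of_mem _ hx)

theorem sweepToA_slides {m : ℕ} (ν : ℕ → ℕ → ZMod m) (p : ℕ) {n : ℕ} {V : SlideCollection F}
    (hV : StrictUpper n V) {Q : List (Handleslide F)}
    (hQ : ∀ h ∈ Q, h.top < h.bot ∧ h.bot < n) (T : List (ElemTangle F)) :
    sweepToA ν p n V (Q.map .slide ++ T) = sweepToA ν p n (incorporate V Q) T := by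
  induction Q generalizing V with
  | nil => rfl
  | cons h Q ih =>
    have h1 := hQ h List.mem_cons_self
    rw [List.map_cons, List.cons_append, sweepToA, incorporateRight_reverse hV h1.1 h1.2]
    exact ih (hV.slideRow _ h1.1 h1.2) fun x hx => hQ x (List.mem_cons_of_mem _ hx)

theorem introduceSlides_neg {n : ℕ} {V : SlideCollection F}
    (hV : StrictUpper n V) {Q : List (Handleslide F)}
    (hQ : ∀ h ∈ Q, h.top < h.bot ∧ h.bot < n) :
    introduceSlides (properOrder n) (-V) Q = -incorporate V Q := by
  induction Q generalizing V with
  | nil => rfl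
  | cons h Q ih =>
    have h1 := hQ h List.mem_cons_self
    rw [introduceSlides, List.foldl_cons, incorporateLeft_neg hV _ h1.1 h1.2]
    exact ih (hV.slideRow _ h1.1 h1.2) fun x hx => hQ x (List.mem_cons_of_mem _ hx)

theorem crossSlides_passSlides_upper {n k : ℕ} {V : SlideCollection F} (hV : StrictUpper n V) (r : F)
    (hk : k + 1 < n) : StrictUpper n (crossSlides k (passSlides k r V)) :=
  (hV.passSlides r hk).swap hk (by simp [passSlides])

/-- The block of an event is the unit at which the two sweeps are inverse: Φ consumes the SR-form
block, emits the A-form block and reaches the collection of the common next state. -/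
theorem sweepToA_block {m : ℕ} (ν : ℕ → ℕ → ZMod m) (p : ℕ) {n : ℕ} {S : SweepState F} (r : F)
    {e : FrontEvent} (hV : StrictUpper n S.coll) (he : e.Fits n)
    (hQ : ∀ h ∈ S.srRight ν p r e, h.top < h.bot ∧ h.bot < n) (T : List (ElemTangle F)) :
    sweepToA ν p n S.coll (S.srBlock ν p r e ++ T) =
      S.aBlock ν p r e ++ sweepToA ν (p + 1) (e.next n) (S.next ν p r e).coll T := by
  match e, he with
  | .leftCusp k, he => rfl
  | .crossing k, he =>
    have hk : k + 1 < n := he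
    have h0 : S.coll (k + 1) (k + 1) = 0 := hV _ _ (by omega)
    simp only [FrontEvent.next, srBlock, aBlock, List.append_assoc, List.cons_append,
      List.nil_append]
    by_cases hg : Front.GradedCrossing ν p k
    · have hL : sweepToA ν p n S.coll ((S.srLeft ν p r (.crossing k)).map .slide ++
          .front (.crossing k) :: ((S.srRight ν p r (.crossing k)).map .slide ++ T)) =
          sweepToA ν p n (slideRow k (k + 1) r S.coll)
            (.front (.crossing k) :: ((S.srRight ν p r (.crossing k)).map .slide ++ T)) := by
        -- A departure has no handleslide, which amounts to incorporating one of coefficient 0.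
        by_cases hd : Front.Normality S.inv k ∧ r = 0
        · simp [srLeft, hg, hd, slideRow_zero]
        · have h1 : S.srLeft ν p r (.crossing k) = [⟨k, k + 1, r⟩] := by
            simp only [srLeft, hg, hd, not_false_eq_true, and_self, if_true]
          rw [h1, sweepToA_slides ν p hV (by simp [hk])]
          rfl
      have h2 : slideRow k (k + 1) r S.coll k (k + 1) = S.coll k (k + 1) + r := by
        simp [slideRow, h0]
      rw [hL, sweepToA, if_pos hg, passSlides_eq_removeLeft_reverse hV r hk, h2,
        sweepToA_slides ν (p + 1) (crossSlides_passSlides_upper hV r hk) hQ]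
      simp [aLeft, hg, next, collAfter]
    · simp [srLeft, srRight, aLeft, hg, sweepToA, next, collAfter]
  | .rightCusp k b, he =>
    have hk : k + 1 < n := he
    have h0 : S.coll (k + 1) (k + 1) = 0 := hV _ _ (by omega)
    simp only [FrontEvent.next, srBlock, aBlock, List.append_assoc, List.cons_append,
      List.nil_append]
    by_cases hm : m = 1
    · have h1 : S.srLeft ν p r (.rightCusp k b) = [⟨k, k + 1, r⟩] := by simp [srLeft, hm]
      have h2 : slideRow k (k + 1) r S.coll k (k + 1) = S.coll k (k + 1) + r := by
        simp [slideRow, h0]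
      rw [h1, sweepToA_slides ν p hV (by simp [hk])]
      -- The handleslide between the cusp strands changes row `k` only, and that row is erased.
      have h3 : cuspSlides k (slideRow k (k + 1) r S.coll) = cuspSlides k S.coll := by
        funext i j
        simp [cuspSlides, slideRow, skipStrand_ne]
      simp [incorporate, sweepToA, hm, h2, aLeft, srRight, next, collAfter, h3]
    · simp [srLeft, srRight, aLeft, hm, sweepToA, next, collAfter]

/-- The counterpart of `sweepToA_block` for Ψ, with the negated collection. Since Ψ carries the
involution and the SR-form differential, it can recompute the handleslides that follow a switch or
return. -/
theorem sweepToSR_block {m : ℕ} (ν : ℕ → ℕ → ZMod m) (p : ℕ) {n : ℕ} {S : SweepState F} (r : F)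
    {e : FrontEvent} (hV : StrictUpper n S.coll) (he : e.Fits n)
    (hQ : ∀ h ∈ S.srRight ν p r e, h.top < h.bot ∧ h.bot < n) (T : List (ElemTangle F)) :
    sweepToSR ν p n S.inv S.diff (-S.coll) (S.aBlock ν p r e ++ T) =
      S.srBlock ν p r e ++ sweepToSR ν (p + 1) (e.next n) (S.next ν p r e).inv
        (S.next ν p r e).diff (-(S.next ν p r e).coll) T := by
  match e, he with
  | .leftCusp k, he =>
    simp [aBlock, aLeft, srBlock, srLeft, srRight, sweepToSR, next, invAfter, collAfter,
      FrontEvent.next]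
  | .crossing k, he =>
    have hk : k + 1 < n := he
    have h0 : S.coll k k = 0 := hV _ _ (by omega)
    simp only [FrontEvent.next, aBlock, List.append_assoc, List.singleton_append]
    by_cases hg : Front.GradedCrossing ν p k
    · have h1 : S.aLeft ν p r (.crossing k) = [⟨k, k + 1, S.coll k (k + 1) + r⟩] := by
        simp [aLeft, hg]
      -- The A-form coefficient cancels against `-V k (k + 1)` and leaves `r`, so Ψ takes the branch
      -- that belongs to the SR-form coefficient.
      have h2 : slideCol k (k + 1) (S.coll k (k + 1) + r) (-S.coll) k (k + 1) = r := by
        simp [slideCol, h0]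
      have h3 : crossSlides k (-passSlides k r S.coll) = -crossSlides k (passSlides k r S.coll) :=
        rfl
      have h4 := crossSlides_passSlides_upper hV r hk
      rw [h1, List.map_singleton, List.singleton_append, sweepToSR,
        incorporateRight_proper hV.neg _ (by omega) hk, sweepToSR]
      simp only [h2, passSlides_eq_removeLeft_proper hV r hk, h3, hg, not_true_eq_false, if_false]
      by_cases hN : Front.Normality S.inv k
      · by_cases hr : r = 0
        · simp [hN, hr, srBlock, srLeft, srRight, hg, next, invAfter, collAfter, incorporate]
        · have hS : S.srRight ν p r (.crossing k) = switchTail S.inv S.diff k r := by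
            simp [srRight, hg, hN, hr]
          rw [hS] at hQ
          rw [introduceSlides_neg h4 hQ]
          simp [hN, hr, srBlock, srLeft, hS, hg, next, invAfter, collAfter]
      · have hS : S.srRight ν p r (.crossing k) = returnTail S.inv S.diff k r := by
          simp [srRight, hg, hN]
        rw [hS] at hQ
        rw [introduceSlides_neg h4 hQ]
        simp [hN, srBlock, srLeft, hS, hg, next, invAfter, collAfter]
    · simp only [aLeft, hg, if_false, List.map_nil, List.nil_append, sweepToSR, not_false_eq_true,
        if_true]
      have h3 : crossSlides k (-S.coll) = -crossSlides k S.coll := rfl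
      simp [srBlock, srLeft, srRight, hg, next, invAfter, collAfter, h3]
  | .rightCusp k b, he =>
    have hk : k + 1 < n := he
    have h0 : S.coll k k = 0 := hV _ _ (by omega)
    simp only [FrontEvent.next, aBlock, List.append_assoc, List.singleton_append]
    by_cases hm : m = 1
    · have h2 : slideCol k (k + 1) (S.coll k (k + 1) + r) (-S.coll) k (k + 1) = r := by
        simp [slideCol, h0]
      have h3 : cuspSlides k (slideCol k (k + 1) (S.coll k (k + 1) + r) (-S.coll)) =
          -cuspSlides k S.coll := by
        funext i j
        simp [cuspSlides, slideCol, skipStrand_ne, skipStrand_ne_succ]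
      have h1 : S.aLeft ν p r (.rightCusp k b) = [⟨k, k + 1, S.coll k (k + 1) + r⟩] := by
        simp [aLeft, hm]
      rw [h1, List.map_singleton, List.singleton_append, sweepToSR,
        incorporateRight_proper hV.neg _ (by omega) hk, sweepToSR]
      simp [hm, h2, h3, srBlock, srLeft, srRight, next, invAfter, collAfter]
    · have h3 : cuspSlides k (-S.coll) = -cuspSlides k S.coll := rfl
      simp [srLeft, srRight, aLeft, hm, sweepToSR, next, collAfter, srBlock, invAfter, h3]

end Sweep

/-! ## The differential at switches and returns -/

section SwitchReturn

variable {F : Type*} [Field F]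

/-- Type (R1): row `k + 1` and column `k` vanish, so the handleslide does not act. -/
theorem nextDifferential_return_one (d : ℕ → ℕ → F) {k : ℕ} (r : F)
    (h1 : ∀ j, d (k + 1) j = 0) (h2 : ∀ i, d i k = 0) :
    [.slide ⟨k, k + 1, r⟩, .front (.crossing k)].foldl nextDifferential d =
      nextDifferential d (.front (.crossing k)) := by
  funext i j
  simp only [List.foldl_cons, List.foldl_nil, nextDifferential, swapStrand]
  grind

/-- Type (R2), where `A` and `B` are the companions of `k` and `k + 1`. The first handleslide leaves
the entry `-(r * d A k)` at `(A, k)` after the crossing; the last one adds the multiple of row `B`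
that cancels it. -/
theorem nextDifferential_return_two (d : ℕ → ℕ → F) {k A B : ℕ} (r : F) (hAB : A < B) (hBk : B < k)
    (h1 : ∀ j, d k j = 0) (h2 : ∀ j, d (k + 1) j = 0) (h3 : ∀ i, d i A = 0)
    (h4 : ∀ j, j ≠ k → d A j = 0) (h5 : ∀ j, j ≠ k + 1 → d B j = 0)
    (h6 : ∀ i, i ≠ A → d i k = 0) (h9 : d B (k + 1) ≠ 0) :
    [.slide ⟨k, k + 1, r⟩, .front (.crossing k),
      .slide ⟨A, B, d A k * r * (d B (k + 1))⁻¹⟩].foldl nextDifferential d =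
      nextDifferential d (.front (.crossing k)) := by
  funext i j
  simp only [List.foldl_cons, List.foldl_nil, nextDifferential, swapStrand]
  grind

/-- Type (R3): the unwanted entry is `r * d (k + 1) B` at `(k + 1, B)` after the crossing. It is
cleared by a multiple of column `A`. -/
theorem nextDifferential_return_three (d : ℕ → ℕ → F) {k A B : ℕ} (r : F) (hAB : A < B)
    (hkA : k + 1 < A)
    (h1 : ∀ i, d i k = 0) (h2 : ∀ i, d i (k + 1) = 0) (h3 : ∀ j, d A j = 0) (h4 : ∀ j, d B j = 0)
    (h5 : ∀ i, i ≠ k → d i A = 0) (h6 : ∀ i, i ≠ k + 1 → d i B = 0)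
    (h7 : ∀ j, j ≠ A → d k j = 0) (h8 : ∀ j, j ≠ B → d (k + 1) j = 0) (h9 : d k A ≠ 0) :
    [.slide ⟨k, k + 1, r⟩, .front (.crossing k),
      .slide ⟨A, B, (d k A)⁻¹ * r * d (k + 1) B⟩].foldl nextDifferential d =
      nextDifferential d (.front (.crossing k)) := by
  funext i j
  simp only [List.foldl_cons, List.foldl_nil, nextDifferential, swapStrand]
  grind

/-- Type (S1). The handleslides on both sides of the crossing combine with the transposition to a
triangular matrix, so `d` keeps its support: the entries carried over by the crossing cancel, and
the old ones are scaled. -/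
theorem nextDifferential_switch_one (d : ℕ → ℕ → F) {k : ℕ} {r : F} (hr : r ≠ 0)
    (h1 : ∀ j, d k j = 0) (h2 : ∀ i, d i (k + 1) = 0) (h3 : d (k + 1) k = 0) :
    [.slide ⟨k, k + 1, r⟩, .front (.crossing k), .slide ⟨k, k + 1, -r⁻¹⟩].foldl
      nextDifferential d = fun i j => (if j = k then -r else if i = k + 1 then r else 1) * d i j := by
  funext i j
  simp only [List.foldl_cons, List.foldl_nil, nextDifferential, swapStrand]
  grind

/-- Type (S2), with `A` and `B` the companions of `k + 1` and `k`. After the second handleslide one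
stray entry `d A (k + 1)` is left at `(A, k)`, and row `B` has `-(r * d B k)` in the same column;
this explains the last coefficient. -/
theorem nextDifferential_switch_two (d : ℕ → ℕ → F) {k A B : ℕ} {r : F} (hr : r ≠ 0) (hAB : A < B)
    (hBk : B < k)
    (h1 : ∀ j, d k j = 0) (h2 : ∀ j, d (k + 1) j = 0) (h3 : ∀ i, d i A = 0)
    (h4 : ∀ j, j ≠ k + 1 → d A j = 0) (h5 : ∀ j, j ≠ k → d B j = 0)
    (h6 : ∀ i, i ≠ B → d i k = 0) (h7 : ∀ i, i ≠ A → d i (k + 1) = 0) (h9 : d B k ≠ 0) :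
    [.slide ⟨k, k + 1, r⟩, .front (.crossing k), .slide ⟨k, k + 1, -r⁻¹⟩,
      .slide ⟨A, B, d A (k + 1) * r⁻¹ * (d B k)⁻¹⟩].foldl nextDifferential d =
      fun i j => (if j = k then -r else if j = k + 1 then r⁻¹ else 1) * d i j := by
  funext i j
  simp only [List.foldl_cons, List.foldl_nil, nextDifferential, swapStrand]
  grind

theorem nextDifferential_switch_three (d : ℕ → ℕ → F) {k A B : ℕ} {r : F} (hr : r ≠ 0) (hAB : A < B)
    (hkA : k + 1 < A)
    (h1 : ∀ i, d i k = 0) (h2 : ∀ i, d i (k + 1) = 0) (h3 : ∀ j, d A j = 0) (h4 : ∀ j, d B j = 0)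
    (h5 : ∀ i, i ≠ k + 1 → d i A = 0) (h6 : ∀ i, i ≠ k → d i B = 0)
    (h7 : ∀ j, j ≠ B → d k j = 0) (h8 : ∀ j, j ≠ A → d (k + 1) j = 0) (h9 : d (k + 1) A ≠ 0) :
    [.slide ⟨k, k + 1, r⟩, .front (.crossing k), .slide ⟨k, k + 1, -r⁻¹⟩,
      .slide ⟨A, B, d k B * r⁻¹ * (d (k + 1) A)⁻¹⟩].foldl nextDifferential d =
      fun i j => (if i = k then -r⁻¹ else if i = k + 1 then r else 1) * d i j := by
  funext i j
  simp only [List.foldl_cons, List.foldl_nil, nextDifferential, swapStrand]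
  grind

end SwitchReturn

/-! ## Invariants of the SR-form side of the sweep -/

section Invariants

variable {F : Type*} [Field F]

open SweepState

/-- A fixed-point-free involution of `n` strands. -/
def IsPairing (n : ℕ) (π : ℕ → ℕ) : Prop := ∀ i < n, π i < n ∧ π (π i) = i ∧ π i ≠ i

/-- The differential `d` is the sum of non-zero multiples of `e i ↦ e (π i)` for `i < π i`. -/
def PairedDiff (n : ℕ) (π : ℕ → ℕ) (d : ℕ → ℕ → F) : Prop :=
  ∀ i j, d i j ≠ 0 ↔ i < j ∧ j < n ∧ j = π i

/-- All handleslides of the collection join strands of equal potential. -/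
def GradedColl {m : ℕ} (ν : ℕ → ℕ → ZMod m) (p : ℕ) (V : SlideCollection F) : Prop :=
  ∀ i j, V i j ≠ 0 → ν p i = ν p j

/-- The endpoints of the handleslide `h` are strands of equal potential. -/
def SlideOk {m : ℕ} (ν : ℕ → ℕ → ZMod m) (p n : ℕ) (h : Handleslide F) : Prop :=
  (h.top < h.bot ∧ h.bot < n) ∧ ν p h.top = ν p h.bot

/-- The invariant of the state of the sweep in slice `p` with `n` strands. -/
structure SRInv {m : ℕ} (ν : ℕ → ℕ → ZMod m) (p n : ℕ) (S : SweepState F) : Prop where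
  pairing : IsPairing n S.inv
  diff : IsDifferential n S.diff
  graded : GradedDiff ν p S.diff
  paired : PairedDiff n S.inv S.diff
  upper : StrictUpper n S.coll
  collGraded : GradedColl ν p S.coll

/-! ### Pairings and paired differentials past the events -/

theorem PairedDiff.eq_of_ne {n : ℕ} {π : ℕ → ℕ} {d : ℕ → ℕ → F} (h : PairedDiff n π d)
    (hπ : IsPairing n π) {i j : ℕ} (hij : d i j ≠ 0) : i < j ∧ j < n ∧ j = π i ∧ i = π j := by
  obtain ⟨h1, h2, h3⟩ := (h i j).1 hij
  exact ⟨h1, h2, h3, by rw [h3, (hπ i (h1.trans h2)).2.1]⟩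

theorem PairedDiff.inv_ne {n k : ℕ} {π : ℕ → ℕ} {d : ℕ → ℕ → F} (h : PairedDiff n π d)
    (hk : k + 1 < n) (h0 : d k (k + 1) = 0) : π k ≠ k + 1 :=
  fun hc => (h k (k + 1)).2 ⟨by omega, hk, hc.symm⟩ h0

/-- The relative positions of the companions of two crossing strands. -/
theorem IsPairing.crossing_cases {n k : ℕ} {π : ℕ → ℕ} (h : IsPairing n π) (hk : k + 1 < n)
    (hne : π k ≠ k + 1) :
    (π k < n ∧ π (k + 1) < n ∧ π (π k) = k ∧ π (π (k + 1)) = k + 1) ∧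
    π k ≠ k ∧ π (k + 1) ≠ k ∧ π (k + 1) ≠ k + 1 ∧ π k ≠ π (k + 1) := by
  have h1 := h k (by omega)
  have h2 := h (k + 1) hk
  refine ⟨⟨h1.1, h2.1, h1.2.1, h2.2.1⟩, h1.2.2, ?_, h2.2.2, ?_⟩
  · intro hc; rw [hc] at h2; exact hne h2.2.1
  · intro hc; have h3 := h1.2.1; rw [hc, h2.2.1] at h3; omega

theorem IsPairing.crossing {n k : ℕ} {π : ℕ → ℕ} (h : IsPairing n π) (hk : k + 1 < n) :
    IsPairing n (nextInvolution π (.crossing k)) := by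
  intro i hi
  have h1 := h (swapStrand k i) ((swapStrand_lt hk).2 hi)
  simp only [nextInvolution, swapStrand_swapStrand]
  refine ⟨(swapStrand_lt hk).2 h1.1, by rw [h1.2.1, swapStrand_swapStrand], fun hc => h1.2.2 ?_⟩
  have h2 := congrArg (swapStrand k) hc
  rwa [swapStrand_swapStrand] at h2

theorem IsPairing.leftCusp {n k : ℕ} {π : ℕ → ℕ} (h : IsPairing n π) (hk : k ≤ n) :
    IsPairing (n + 2) (nextInvolution π (.leftCusp k)) := by
  intro i hi
  simp only [nextInvolution]
  by_cases h1 : i = k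
  · subst h1; simp; omega
  by_cases h2 : i = k + 1
  · subst h2; simp; omega
  obtain ⟨i, rfl⟩ : ∃ i', i = skipStrand k i' := ⟨_, (skipStrand_unskipStrand h1 h2).symm⟩
  rw [skipStrand_lt hk] at hi
  have h3 := h i hi
  simp [skipStrand_ne, skipStrand_ne_succ, unskipStrand_skipStrand, skipStrand_lt hk, h3,
    skipStrand_inj]

theorem IsPairing.skip_inv_skip {n k : ℕ} {π : ℕ → ℕ} (h : IsPairing (n + 2) π) (hk : k ≤ n)
    (hπ : π k = k + 1) {i : ℕ} (hi : i < n) :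
    skipStrand k (unskipStrand k (π (skipStrand k i))) = π (skipStrand k i) := by
  have h1 := h (skipStrand k i) ((skipStrand_lt hk).2 hi)
  have h2 := h k (by omega)
  refine skipStrand_unskipStrand (fun hc => ?_) fun hc => ?_
  · rw [hc, hπ] at h1
    exact skipStrand_ne_succ k i h1.2.1.symm
  · rw [hc, ← hπ, h2.2.1] at h1
    exact skipStrand_ne k i h1.2.1.symm

theorem IsPairing.rightCusp {n k : ℕ} {b : Bool} {π : ℕ → ℕ} (h : IsPairing (n + 2) π)
    (hk : k ≤ n) (hπ : π k = k + 1) : IsPairing n (nextInvolution π (.rightCusp k b)) := by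
  intro i hi
  have h1 := h (skipStrand k i) ((skipStrand_lt hk).2 hi)
  have h2 := h.skip_inv_skip hk hπ hi
  simp only [nextInvolution, h2]
  refine ⟨?_, ?_, ?_⟩
  · rw [← skipStrand_lt hk, h2]; exact h1.1
  · rw [h1.2.1, unskipStrand_skipStrand]
  · intro hc; rw [hc] at h2; exact h1.2.2 h2.symm

theorem PairedDiff.crossing {n k : ℕ} {π : ℕ → ℕ} {d : ℕ → ℕ → F} (h : PairedDiff n π d)
    (hπ : IsPairing n π) (hk : k + 1 < n) (h0 : d k (k + 1) = 0) :
    PairedDiff n (nextInvolution π (.crossing k)) (nextDifferential d (.front (.crossing k))) := by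
  intro i j
  have hc := hπ.crossing_cases hk (h.inv_ne hk h0)
  have h1 := h.inv_ne hk h0
  -- Only the order of `k` and `k + 1` is reversed by the crossing, and these are not companions
  -- because `d k (k + 1) = 0`.
  have key : ∀ a b, b = π a → (a < b ↔ swapStrand k a < swapStrand k b) := by
    rintro a b rfl
    unfold swapStrand
    by_cases h2 : a = k
    · subst h2; split_ifs <;> omega
    by_cases h3 : a = k + 1
    · subst h3; split_ifs <;> omega
    split_ifs <;> omega
  have h2 := h (swapStrand k i) (swapStrand k j)
  have h3 := key (swapStrand k i) (swapStrand k j)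
  simp only [swapStrand_swapStrand] at h3
  have h4 : swapStrand k j = π (swapStrand k i) ↔ j = swapStrand k (π (swapStrand k i)) :=
    ⟨fun hh => by rw [← hh, swapStrand_swapStrand], fun hh => by rw [hh, swapStrand_swapStrand]⟩
  rw [swapStrand_lt hk] at h2
  simp only [nextDifferential, nextInvolution]
  rw [h2, ← h4]
  constructor
  · rintro ⟨a, b, c⟩; exact ⟨(h3 c).1 a, b, c⟩
  · rintro ⟨a, b, c⟩; exact ⟨(h3 c).2 a, b, c⟩

theorem PairedDiff.leftCusp {n k : ℕ} {π : ℕ → ℕ} {d : ℕ → ℕ → F} (h : PairedDiff n π d)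
    (hk : k ≤ n) :
    PairedDiff (n + 2) (nextInvolution π (.leftCusp k)) (nextDifferential d (.front (.leftCusp k))) := by
  intro i j
  simp only [nextDifferential, nextInvolution]
  by_cases i1 : i = k
  · subst i1
    by_cases j1 : j = i + 1
    · simp [j1]; omega
    · simp [j1]
  by_cases i2 : i = k + 1
  · subst i2
    simp only [i1, false_and, if_false, true_or, or_true, if_true, ne_eq, not_true_eq_false,
      false_iff]
    omega
  obtain ⟨i, rfl⟩ : ∃ i', i = skipStrand k i' := ⟨_, (skipStrand_unskipStrand i1 i2).symm⟩
  by_cases j1 : j = k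
  · subst j1
    simp [skipStrand_ne, skipStrand_ne_succ, (skipStrand_ne _ _).symm]
  by_cases j2 : j = k + 1
  · subst j2
    simp [skipStrand_ne, skipStrand_ne_succ, (skipStrand_ne_succ _ _).symm]
  obtain ⟨j, rfl⟩ : ∃ j', j = skipStrand k j' := ⟨_, (skipStrand_unskipStrand j1 j2).symm⟩
  have h1 := h i j
  simpa [skipStrand_ne, skipStrand_ne_succ, unskipStrand_skipStrand, skipStrand_lt_skipStrand,
    skipStrand_lt hk, skipStrand_inj] using h1

/-- Paired strands `k` and `k + 1` leave row `k + 1` and column `k` empty, so a handleslide between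
them has nothing to act on. -/
theorem PairedDiff.slide_cusp {n k : ℕ} {π : ℕ → ℕ} {d : ℕ → ℕ → F} (h : PairedDiff n π d)
    (hπ : IsPairing n π) (h0 : d k (k + 1) ≠ 0) (r : F) :
    nextDifferential d (.slide ⟨k, k + 1, r⟩) = d := by
  obtain ⟨-, h1, h2, h3⟩ := h.eq_of_ne hπ h0
  have r1 : ∀ j, d (k + 1) j = 0 := fun j => by
    by_contra hc; have := h.eq_of_ne hπ hc; omega
  have c1 : ∀ i, d i k = 0 := fun i => by
    by_contra hc; have := h.eq_of_ne hπ hc; omega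
  funext i j
  simp [nextDifferential, r1, c1]

theorem PairedDiff.rightCusp {n k : ℕ} {b : Bool} {π : ℕ → ℕ} {d : ℕ → ℕ → F}
    (h : PairedDiff (n + 2) π d) (hπ : IsPairing (n + 2) π) (hk : k ≤ n) (h0 : d k (k + 1) ≠ 0) :
    PairedDiff n (nextInvolution π (.rightCusp k b))
      (nextDifferential d (.front (.rightCusp k b))) := by
  obtain ⟨-, h1, h2, h3⟩ := h.eq_of_ne hπ h0
  intro i j
  -- The only entry in column `k + 1` comes from its companion `k`; hence the correction term at the
  -- cusp vanishes.
  have c1 : d (skipStrand k i) (k + 1) = 0 := by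
    by_contra hc
    have := h.eq_of_ne hπ hc
    exact skipStrand_ne k i (by omega)
  have h4 := h (skipStrand k i) (skipStrand k j)
  rw [skipStrand_lt_skipStrand, skipStrand_lt hk] at h4
  simp only [nextDifferential, nextInvolution, c1, zero_mul, sub_zero]
  rw [h4]
  constructor
  · rintro ⟨a, b, c⟩
    exact ⟨a, b, by rw [← c, unskipStrand_skipStrand]⟩
  · rintro ⟨a, b, c⟩
    exact ⟨a, b, by rw [c, hπ.skip_inv_skip hk h2.symm (by omega)]⟩

/-- A handleslide alters `d i j` by products of factors whose indices strictly increase, which need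
a strand strictly between `i` and `j`. So the condition at an event may be tested before the
handleslides to its left. -/
theorem superdiagonal_slides {n : ℕ} {d : ℕ → ℕ → F} (hd : StrictUpper n d)
    {Q : List (Handleslide F)} (hQ : ∀ h ∈ Q, h.top < h.bot ∧ h.bot < n) (i : ℕ) :
    (Q.map ElemTangle.slide).foldl nextDifferential d i (i + 1) = d i (i + 1) := by
  induction Q generalizing d with
  | nil => rfl
  | cons h Q ih =>
    have h1 := hQ h List.mem_cons_self
    rw [List.map_cons, List.foldl_cons, ih (hd.slide h h1.1 h1.2)
      fun x hx => hQ x (List.mem_cons_of_mem _ hx)]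
    have e1 : i = h.top → d h.bot (i + 1) = 0 := fun e => hd _ _ (by omega)
    have e2 : i + 1 = h.bot → d i h.top = 0 := fun e => hd _ _ (by omega)
    have e3 : d h.bot h.top = 0 := hd _ _ (by omega)
    simp only [nextDifferential]
    split_ifs with c1 c2 c2 <;> simp_all

theorem good_slides {n : ℕ} (d : ℕ → ℕ → F)
    {Q : List (Handleslide F)} (hQ : ∀ h ∈ Q, h.top < h.bot ∧ h.bot < n) :
    Good n d (Q.map .slide) := by
  induction Q generalizing d with
  | nil => trivial
  | cons h Q ih =>
    exact ⟨hQ h List.mem_cons_self, ih _ fun x hx => hQ x (List.mem_cons_of_mem _ hx)⟩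

theorem slides_bounds_of_good {n : ℕ} {d : ℕ → ℕ → F}
    {Q : List (Handleslide F)} (hQ : Good n d (Q.map .slide)) :
    ∀ h ∈ Q, h.top < h.bot ∧ h.bot < n := by
  induction Q generalizing d with
  | nil => simp
  | cons h Q ih =>
    intro x hx
    rcases List.mem_cons.1 hx with rfl | hx
    · exact hQ.1
    · exact ih hQ.2 x hx

theorem foldl_tangleNext_slides (n : ℕ) (Q : List (Handleslide F)) :
    (Q.map ElemTangle.slide).foldl tangleNext n = n := by
  induction Q with
  | nil => rfl
  | cons h Q ih => exact ih

theorem foldl_tangleNext_block (n : ℕ) (L Q : List (Handleslide F)) (e : FrontEvent) :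
    (L.map ElemTangle.slide ++ [ElemTangle.front e] ++ Q.map ElemTangle.slide).foldl tangleNext n = e.next n := by
  rw [List.foldl_append, List.foldl_append, foldl_tangleNext_slides, foldl_tangleNext_slides]
  rfl

theorem StepOk.congr {n : ℕ} {d d' : ℕ → ℕ → F} {e : FrontEvent} (h : StepOk n d (.front e))
    (hd : ∀ i, d' i (i + 1) = d i (i + 1)) : StepOk n d' (.front e) := by
  match e, h with
  | .leftCusp k, h => exact h
  | .crossing k, h => exact ⟨h.1, by rw [hd]; exact h.2⟩
  | .rightCusp k b, h => exact ⟨h.1, by rw [hd]; exact h.2⟩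

/-- The local conditions along the handleslides and the event of a block. -/
theorem good_block_iff {n : ℕ} {d : ℕ → ℕ → F} (hd : StrictUpper n d) {e : FrontEvent}
    {L Q : List (Handleslide F)} (hL : ∀ h ∈ L, h.top < h.bot ∧ h.bot < n)
    (hQ : ∀ h ∈ Q, h.top < h.bot ∧ h.bot < e.next n) :
    Good n d (L.map .slide ++ [.front e] ++ Q.map .slide) ↔ StepOk n d (.front e) := by
  rw [good_append, good_append, foldl_tangleNext_slides]
  constructor
  · intro h
    exact h.1.2.1.congr fun i => (superdiagonal_slides hd hL i).symm
  · intro h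
    refine ⟨⟨good_slides d hL, h.congr fun i => superdiagonal_slides hd hL i, trivial⟩, ?_⟩
    rw [List.foldl_append, foldl_tangleNext_slides]
    exact good_slides _ hQ

/-! ### Gradings of differentials and collections under handleslides -/

theorem GradedDiff.slides {m : ℕ} {ν : ℕ → ℕ → ZMod m} {p : ℕ} {d : ℕ → ℕ → F}
    (h : GradedDiff ν p d) {Q : List (Handleslide F)} (hQ : ∀ s ∈ Q, ν p s.top = ν p s.bot) :
    GradedDiff ν p ((Q.map ElemTangle.slide).foldl nextDifferential d) := by
  induction Q generalizing d with
  | nil => exact h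
  | cons s Q ih =>
    exact ih (h.slide (hQ s List.mem_cons_self)) fun x hx => hQ x (List.mem_cons_of_mem _ hx)

theorem GradedColl.slideRow {m : ℕ} {ν : ℕ → ℕ → ZMod m} {p : ℕ} {V : SlideCollection F}
    (h : GradedColl ν p V) {t b : ℕ} (r : F) (htb : ν p t = ν p b) :
    GradedColl ν p (slideRow t b r V) := by
  intro i j hij
  by_contra hne
  apply hij
  have e1 : V i j = 0 := by_contra fun c => hne (h i j c)
  have e2 : i = t → V b j = 0 := fun e => by_contra fun c => hne (by rw [e, htb]; exact h b j c)
  have e3 : ¬ (i = t ∧ j = b) := fun e => hne (by rw [e.1, e.2, htb])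
  simp only [_root_.slideRow, e1, e3, if_false]
  split_ifs with c <;> simp_all

theorem GradedColl.passSlides {m : ℕ} {ν : ℕ → ℕ → ZMod m} {p : ℕ} {V : SlideCollection F}
    (h : GradedColl ν p V) {k : ℕ} (r : F) (hk : ν p k = ν p (k + 1)) :
    GradedColl ν p (passSlides k r V) := by
  intro i j hij
  by_contra hne
  apply hij
  have e1 : V i j = 0 := by_contra fun c => hne (h i j c)
  have e2 : i = k → V (k + 1) j = 0 := fun e => by_contra fun c => hne (by rw [e, hk]; exact h _ j c)
  have e3 : j = k + 1 → V i k = 0 := fun e => by_contra fun c => hne (by rw [e, ← hk]; exact h i _ c)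
  simp only [_root_.passSlides, e1]
  split_ifs with c1 c2 c3 c3 <;> simp_all

theorem GradedColl.incorporate {m : ℕ} {ν : ℕ → ℕ → ZMod m} {p : ℕ} {V : SlideCollection F}
    (h : GradedColl ν p V) {Q : List (Handleslide F)} (hQ : ∀ s ∈ Q, ν p s.top = ν p s.bot) :
    GradedColl ν p (incorporate V Q) := by
  induction Q generalizing V with
  | nil => exact h
  | cons s Q ih =>
    exact ih (h.slideRow _ (hQ s List.mem_cons_self)) fun x hx => hQ x (List.mem_cons_of_mem _ hx)

theorem GradedColl.crossSlides {D : Front} {m : ℕ} {ν : ℕ → ℕ → ZMod m} (hν : IsPotential D ν)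
    {p k : ℕ} (he : D.events[p]? = some (.crossing k)) {V : SlideCollection F}
    (hV : StrictUpper (D.strands p) V) (h : GradedColl ν p V) :
    GradedColl ν (p + 1) (crossSlides k V) := by
  intro i j hij
  have hij' : V (swapStrand k i) (swapStrand k j) ≠ 0 := hij
  have h1 := h _ _ hij'
  have h2 := hV.lt_of_ne_zero hij'
  rw [← hν.crossing p k he _ h2.2, ← hν.crossing p k he _ (h2.1.trans h2.2),
    swapStrand_swapStrand, swapStrand_swapStrand] at h1
  exact h1

theorem GradedColl.eq_zero {m : ℕ} {ν : ℕ → ℕ → ZMod m} {p k : ℕ} {V : SlideCollection F}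
    (h : GradedColl ν p V) (hg : ¬ Front.GradedCrossing ν p k) : V k (k + 1) = 0 :=
  by_contra fun hc => hg (sub_eq_zero.2 (h k (k + 1) hc))

end Invariants

/-! ### The invariants survive every event -/

section InvariantStep

variable {F : Type*} [Field F] [DecidableEq F]

open SweepState

theorem SRInv.left_ok {m : ℕ} {ν : ℕ → ℕ → ZMod m} {p n : ℕ} {S : SweepState F}
    {e : FrontEvent} (he : e.Fits n) (r : F) :
    ∀ h ∈ S.srLeft ν p r e, SlideOk ν p n h := by
  intro h hh
  match e, he with
  | .leftCusp k, _ => simp [srLeft] at hh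
  | .crossing k, he =>
    have hk : k + 1 < n := he
    simp only [srLeft] at hh
    split_ifs at hh with hg
    · rw [List.mem_singleton] at hh
      subst hh
      exact ⟨⟨by simp, hk⟩, sub_eq_zero.1 hg.1⟩
    · simp at hh
  | .rightCusp k b, he =>
    have hk : k + 1 < n := he
    simp only [srLeft] at hh
    split_ifs at hh with hm
    · rw [List.mem_singleton] at hh
      subst hh
      subst hm
      exact ⟨⟨by simp, hk⟩, Subsingleton.elim _ _⟩
    · simp at hh

theorem aLeft_ok {m : ℕ} {ν : ℕ → ℕ → ZMod m} {p n : ℕ} {S : SweepState F}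
    {e : FrontEvent} (he : e.Fits n) (r : F) :
    ∀ h ∈ S.aLeft ν p r e, SlideOk ν p n h := by
  intro h hh
  match e, he with
  | .leftCusp k, _ => simp [aLeft] at hh
  | .crossing k, he =>
    have hk : k + 1 < n := he
    simp only [aLeft] at hh
    split_ifs at hh with hg
    · rw [List.mem_singleton] at hh
      subst hh
      exact ⟨⟨by simp, hk⟩, sub_eq_zero.1 hg⟩
    · simp at hh
  | .rightCusp k b, he =>
    have hk : k + 1 < n := he
    simp only [aLeft] at hh
    split_ifs at hh with hm
    · rw [List.mem_singleton] at hh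
      subst hh
      subst hm
      exact ⟨⟨by simp, hk⟩, Subsingleton.elim _ _⟩
    · simp at hh

theorem SRInv.right_ok {D : Front} {m : ℕ} {ν : ℕ → ℕ → ZMod m} (hν : IsPotential D ν) {p : ℕ}
    {S : SweepState F} (h : SRInv ν p (D.strands p) S) {e : FrontEvent}
    (he : D.events[p]? = some e) (hok : StepOk (D.strands p) S.diff (.front e)) (r : F) :
    ∀ s ∈ S.srRight ν p r e, SlideOk ν (p + 1) (e.next (D.strands p)) s := by
  match e, he, hok with
  | .leftCusp k, _, _ => simp [srRight]
  | .rightCusp k b, _, _ => simp [srRight]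
  | .crossing k, he, hok =>
    have hk : k + 1 < D.strands p := hok.1
    have hne := h.paired.inv_ne hk hok.2
    have hc := h.pairing.crossing_cases hk hne
    have hsw : ∀ i < D.strands p, i ≠ k → i ≠ k + 1 → ν (p + 1) i = ν p i := by
      intro i hi h1 h2
      have h3 := hν.crossing p k he i hi
      rwa [show swapStrand k i = i by simp [swapStrand, h1, h2]] at h3
    have hk1 : ν (p + 1) k = ν p (k + 1) := by
      have h3 := hν.crossing p k he (k + 1) hk
      rwa [show swapStrand k (k + 1) = k by simp [swapStrand]] at h3
    have hk2 : ν (p + 1) (k + 1) = ν p k := by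
      have h3 := hν.crossing p k he k (by omega)
      rwa [show swapStrand k k = k + 1 by simp [swapStrand]] at h3
    have gr : ∀ i j, i < j → j < D.strands p → j = S.inv i → ν p j = ν p i - 1 :=
      fun i j a b c => h.graded i j ((h.paired i j).2 ⟨a, b, c⟩)
    simp only [srRight, FrontEvent.next]
    by_cases hg : Front.GradedCrossing ν p k
    swap
    · simp [hg]
    have hg' : ν p k = ν p (k + 1) := sub_eq_zero.1 hg
    have hs : ∀ c : F, SlideOk ν (p + 1) (D.strands p) ⟨k, k + 1, c⟩ :=
      fun c => ⟨⟨by simp, hk⟩, by rw [hk1, hk2, hg']⟩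
    have hA := hsw (S.inv k) hc.1.1 hc.2.1 hne
    have hB := hsw (S.inv (k + 1)) hc.1.2.1 hc.2.2.1 hc.2.2.2.1
    -- Companions differ in potential by 1, with the sign given by their relative position.
    -- Companions on the same side of strands of equal potential therefore have equal potential,
    -- which grades the handleslide between them.
    have heq : (S.inv k < k ∧ S.inv (k + 1) < k) ∨ (k + 1 < S.inv k ∧ k + 1 < S.inv (k + 1)) →
        ν p (S.inv k) = ν p (S.inv (k + 1)) := by
      rintro (⟨h1, h2⟩ | ⟨h1, h2⟩)
      · have g1 := gr _ _ h1 (by omega) hc.1.2.2.1.symm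
        have g2 := gr (S.inv (k + 1)) (k + 1) (by omega) (by omega) hc.1.2.2.2.symm
        rw [hg', g2] at g1
        linear_combination -g1
      · have g1 := gr k (S.inv k) (by omega) (by omega) rfl
        have g2 := gr (k + 1) (S.inv (k + 1)) (by omega) (by omega) rfl
        rw [g1, g2, hg']
    rw [if_pos hg]
    intro s hmem
    by_cases hN : Front.Normality S.inv k
    · rw [if_pos hN] at hmem
      split_ifs at hmem with hr
      · simp at hmem
      unfold Front.Normality at hN
      simp only [switchTail] at hmem
      split_ifs at hmem with c1 c2
      · rw [List.mem_singleton] at hmem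
        subst hmem; exact hs _
      · simp only [List.mem_cons, List.not_mem_nil, or_false] at hmem
        rcases hmem with rfl | rfl
        · exact hs _
        · refine ⟨⟨c2.1, hc.1.1⟩, ?_⟩
          change ν (p + 1) (S.inv (k + 1)) = ν (p + 1) (S.inv k)
          rw [hA, hB, heq (by omega)]
      · simp only [List.mem_cons, List.not_mem_nil, or_false] at hmem
        rcases hmem with rfl | rfl
        · exact hs _
        · refine ⟨⟨?_, hc.1.1⟩, ?_⟩
          · change S.inv (k + 1) < S.inv k
            omega
          change ν (p + 1) (S.inv (k + 1)) = ν (p + 1) (S.inv k)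
          rw [hA, hB, heq (by omega)]
    · rw [if_neg hN] at hmem
      unfold Front.Normality at hN
      simp only [returnTail] at hmem
      split_ifs at hmem with c1 c2
      · simp at hmem
      · rw [List.mem_singleton] at hmem
        subst hmem
        refine ⟨⟨c2.1, hc.1.2.1⟩, ?_⟩
        change ν (p + 1) (S.inv k) = ν (p + 1) (S.inv (k + 1))
        rw [hA, hB, heq (by omega)]
      · rw [List.mem_singleton] at hmem
        subst hmem
        refine ⟨⟨?_, hc.1.2.1⟩, ?_⟩
        · change S.inv k < S.inv (k + 1)
          omega
        change ν (p + 1) (S.inv k) = ν (p + 1) (S.inv (k + 1))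
        rw [hA, hB, heq (by omega)]

/-- At a return the differential changes as if there were no handleslides. -/
theorem diff_return {n k : ℕ} {π : ℕ → ℕ} {d : ℕ → ℕ → F} (h : PairedDiff n π d)
    (hπ : IsPairing n π) (hk : k + 1 < n) (h0 : d k (k + 1) = 0) (hN : ¬ Front.Normality π k) (r : F) :
    ([ElemTangle.slide ⟨k, k + 1, r⟩, .front (.crossing k)] ++ (returnTail π d k r).map ElemTangle.slide).foldl
      nextDifferential d = nextDifferential d (.front (.crossing k)) := by
  have hne := h.inv_ne hk h0
  obtain ⟨⟨n1, n2, p1, p2⟩, q1, q2, q3, q4⟩ := hπ.crossing_cases hk hne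
  have hz : ∀ {i j}, d i j ≠ 0 → i < j ∧ j < n ∧ j = π i ∧ i = π j := fun hc => h.eq_of_ne hπ hc
  have hnz : ∀ i j, i < j → j < n → j = π i → d i j ≠ 0 := fun i j a b c => (h i j).2 ⟨a, b, c⟩
  unfold Front.Normality at hN
  simp only [returnTail]
  split_ifs with c1 c2
  · exact nextDifferential_return_one d (k := k) r
      (fun j => by by_contra hc; have := hz hc; omega)
      (fun i => by by_contra hc; have := hz hc; omega)
  · exact nextDifferential_return_two d r (A := π k) (B := π (k + 1)) c2.1 c2.2
      (fun j => by by_contra hc; have := hz hc; omega)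
      (fun j => by by_contra hc; have := hz hc; omega)
      (fun i => by by_contra hc; have := hz hc; omega)
      (fun j _ => by by_contra hc; have := hz hc; omega)
      (fun j _ => by by_contra hc; have := hz hc; omega)
      (fun i _ => by by_contra hc; have := hz hc; omega)
      (hnz _ _ (by omega) hk p2.symm)
  · exact nextDifferential_return_three d r (A := π k) (B := π (k + 1)) (by omega) (by omega)
      (fun i => by by_contra hc; have := hz hc; omega)
      (fun i => by by_contra hc; have := hz hc; omega)
      (fun j => by by_contra hc; have := hz hc; omega)
      (fun j => by by_contra hc; have := hz hc; omega)
      (fun i _ => by by_contra hc; have := hz hc; omega)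
      (fun i _ => by by_contra hc; have := hz hc; omega)
      (fun j _ => by by_contra hc; have := hz hc; omega)
      (fun j _ => by by_contra hc; have := hz hc; omega)
      (hnz _ _ (by omega) n1 rfl)

/-- At a switch the coefficients of the differential are scaled. -/
theorem diff_switch {n k : ℕ} {π : ℕ → ℕ} {d : ℕ → ℕ → F} (h : PairedDiff n π d)
    (hπ : IsPairing n π) (hk : k + 1 < n) (h0 : d k (k + 1) = 0) (hN : Front.Normality π k) {r : F}
    (hr : r ≠ 0) :
    ∃ w : ℕ → ℕ → F, (∀ i j, w i j ≠ 0) ∧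
      ([ElemTangle.slide ⟨k, k + 1, r⟩, .front (.crossing k)] ++ (switchTail π d k r).map ElemTangle.slide).foldl
        nextDifferential d = fun i j => w i j * d i j := by
  have hne := h.inv_ne hk h0
  obtain ⟨⟨n1, n2, p1, p2⟩, q1, q2, q3, q4⟩ := hπ.crossing_cases hk hne
  have hz : ∀ {i j}, d i j ≠ 0 → i < j ∧ j < n ∧ j = π i ∧ i = π j := fun hc => h.eq_of_ne hπ hc
  have hnz : ∀ i j, i < j → j < n → j = π i → d i j ≠ 0 := fun i j a b c => (h i j).2 ⟨a, b, c⟩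
  unfold Front.Normality at hN
  simp only [switchTail]
  split_ifs with c1 c2
  · refine ⟨_, ?_, nextDifferential_switch_one d (k := k) hr
      (fun j => by by_contra hc; have := hz hc; omega)
      (fun i => by by_contra hc; have := hz hc; omega)
      (by by_contra hc; have := hz hc; omega)⟩
    intro i j
    split_ifs <;> simp [hr]
  · refine ⟨_, ?_, nextDifferential_switch_two d hr (A := π (k + 1)) (B := π k) c2.1 c2.2
      (fun j => by by_contra hc; have := hz hc; omega)
      (fun j => by by_contra hc; have := hz hc; omega)
      (fun i => by by_contra hc; have := hz hc; omega)
      (fun j _ => by by_contra hc; have := hz hc; omega)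
      (fun j _ => by by_contra hc; have := hz hc; omega)
      (fun i _ => by by_contra hc; have := hz hc; omega)
      (fun i _ => by by_contra hc; have := hz hc; omega)
      (hnz _ _ (by omega) (by omega) p1.symm)⟩
    intro i j
    split_ifs <;> simp [hr]
  · refine ⟨_, ?_, nextDifferential_switch_three d hr (A := π (k + 1)) (B := π k) (by omega) (by omega)
      (fun i => by by_contra hc; have := hz hc; omega)
      (fun i => by by_contra hc; have := hz hc; omega)
      (fun j => by by_contra hc; have := hz hc; omega)
      (fun j => by by_contra hc; have := hz hc; omega)
      (fun i _ => by by_contra hc; have := hz hc; omega)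
      (fun i _ => by by_contra hc; have := hz hc; omega)
      (fun j _ => by by_contra hc; have := hz hc; omega)
      (fun j _ => by by_contra hc; have := hz hc; omega)
      (hnz _ _ (by omega) n2 rfl)⟩
    intro i j
    split_ifs <;> simp [hr]

/-- At a departure, a return or an ungraded crossing, `d` and the involution are both just
transported by the transposition; at a switch the involution stays and `d` keeps its support. -/
theorem SRInv.paired_next {D : Front} {m : ℕ} {ν : ℕ → ℕ → ZMod m} {p : ℕ}
    {S : SweepState F} (h : SRInv ν p (D.strands p) S) {e : FrontEvent}
    (he : D.events[p]? = some e) (hok : StepOk (D.strands p) S.diff (.front e)) (r : F) :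
    IsPairing (D.strands (p + 1)) (S.next ν p r e).inv ∧
      PairedDiff (D.strands (p + 1)) (S.next ν p r e).inv (S.next ν p r e).diff := by
  rw [D.strands_succ he]
  match e, he, hok with
  | .leftCusp k, _, hok =>
    exact ⟨h.pairing.leftCusp hok, h.paired.leftCusp hok⟩
  | .rightCusp k b, _, hok =>
    have hk : k + 1 < D.strands p := hok.1
    obtain ⟨N, hN⟩ : ∃ N, D.strands p = N + 2 := ⟨D.strands p - 2, by omega⟩
    have h1 := h.pairing
    have h2 := h.paired
    have h3 := h2.eq_of_ne h1 hok.rightCusp_ne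
    rw [hN] at h1 h2
    have h4 : (S.next ν p r (.rightCusp k b)).diff =
        nextDifferential S.diff (.front (.rightCusp k b)) := by
      simp only [SweepState.next, srBlock, srLeft, srRight]
      split_ifs with hm
      · simp only [List.map_cons, List.map_nil, List.append_nil, List.singleton_append,
          List.foldl_cons, List.foldl_nil]
        rw [h2.slide_cusp h1 hok.rightCusp_ne]
      · rfl
    rw [h4]
    have h5 : FrontEvent.next (D.strands p) (.rightCusp k b) = N := by
      simp [FrontEvent.next, hN]
    rw [h5]
    exact ⟨h1.rightCusp (b := b) (by omega) h3.2.2.1.symm, h2.rightCusp h1 (by omega) hok.rightCusp_ne⟩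
  | .crossing k, _, hok =>
    have hk : k + 1 < D.strands p := hok.1
    change IsPairing (D.strands p) _ ∧ PairedDiff (D.strands p) _ _
    have hcross := And.intro (h.pairing.crossing hk) (h.paired.crossing h.pairing hk hok.2)
    by_cases hg : Front.GradedCrossing ν p k
    · by_cases hN : Front.Normality S.inv k
      · by_cases hr : r = 0
        · simpa [SweepState.next, srBlock, srLeft, srRight, invAfter, hg, hN, hr] using hcross
        · obtain ⟨w, hw, hd⟩ := diff_switch h.paired h.pairing hk hok.2 hN hr
          have h1 : (S.next ν p r (.crossing k)).inv = S.inv := by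
            simp [SweepState.next, invAfter, hg, hN, hr]
          have h2 : (S.next ν p r (.crossing k)).diff = fun i j => w i j * S.diff i j := by
            rw [← hd]
            simp [SweepState.next, srBlock, srLeft, srRight, hg, hN, hr]
          rw [h1, h2]
          refine ⟨h.pairing, fun i j => ?_⟩
          rw [← h.paired i j]
          simp [hw]
      · have h1 : (S.next ν p r (.crossing k)).inv = nextInvolution S.inv (.crossing k) := by
          simp [SweepState.next, invAfter, hN]
        have h2 : (S.next ν p r (.crossing k)).diff =
            nextDifferential S.diff (.front (.crossing k)) := by
          rw [← diff_return h.paired h.pairing hk hok.2 hN r]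
          simp [SweepState.next, srBlock, srLeft, srRight, hg, hN]
        rw [h1, h2]
        exact hcross
    · simpa [SweepState.next, srBlock, srLeft, srRight, invAfter, hg] using hcross

theorem SRInv.good_srBlock {D : Front} {m : ℕ} {ν : ℕ → ℕ → ZMod m} (hν : IsPotential D ν) {p : ℕ}
    {S : SweepState F} (h : SRInv ν p (D.strands p) S) {e : FrontEvent}
    (he : D.events[p]? = some e) (hok : StepOk (D.strands p) S.diff (.front e)) (r : F) :
    Good (D.strands p) S.diff (S.srBlock ν p r e) :=
  (good_block_iff h.diff.upper (fun s hs => (SRInv.left_ok (D.fits_of_getElem? he) r s hs).1)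
    fun s hs => (h.right_ok hν he hok r s hs).1).2 hok

theorem SRInv.next {D : Front} {m : ℕ} {ν : ℕ → ℕ → ZMod m} (hν : IsPotential D ν) {p : ℕ}
    {S : SweepState F} (h : SRInv ν p (D.strands p) S) {e : FrontEvent}
    (he : D.events[p]? = some e) (hok : StepOk (D.strands p) S.diff (.front e)) (r : F) :
    SRInv ν (p + 1) (D.strands (p + 1)) (S.next ν p r e) := by
  have hL := SRInv.left_ok (ν := ν) (p := p) (S := S) (D.fits_of_getElem? he) r
  have hQ := h.right_ok hν he hok r
  have hn := D.strands_succ he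
  obtain ⟨h1, h2⟩ := h.paired_next he hok r
  have hgood := h.good_srBlock hν he hok r
  refine ⟨h1, ?_, ?_, h2, ?_, ?_⟩
  · have h3 := hgood.isDifferential h.diff
    rwa [srBlock, foldl_tangleNext_block, ← hn] at h3
  · change GradedDiff ν (p + 1) ((S.srBlock ν p r e).foldl nextDifferential S.diff)
    rw [srBlock, List.foldl_append, List.foldl_append]
    have g1 := h.graded.slides (Q := S.srLeft ν p r e) fun s hs => (hL s hs).2
    have d1 := (good_slides S.diff fun s hs => (hL s hs).1).isDifferential h.diff
    rw [foldl_tangleNext_slides] at d1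
    -- `hok` refers to the differential before the left handleslides, but these do not touch the
    -- superdiagonal.
    exact (g1.front hν d1 he (hok.congr fun i =>
      superdiagonal_slides h.diff.upper (fun s hs => (hL s hs).1) i)).slides fun s hs => (hQ s hs).2
  · rw [hn]
    match e, he, hok, hQ with
    | .leftCusp k, _, _, _ => exact fun _ _ _ => rfl
    | .rightCusp k b, _, hok, _ =>
      have hk : k + 1 < D.strands p := hok.1
      intro i j hij
      refine h.upper _ _ ?_
      have h3 : FrontEvent.next (D.strands p) (.rightCusp k b) = D.strands p - 2 := rfl
      rw [h3] at hij
      rw [skipStrand_lt_skipStrand, show D.strands p = D.strands p - 2 + 2 by omega,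
        skipStrand_lt (by omega)]
      exact hij
    | .crossing k, he, hok, hQ =>
      have hk : k + 1 < D.strands p := hok.1
      change StrictUpper (D.strands p) (S.collAfter ν p r (.crossing k))
      simp only [collAfter]
      split_ifs with hg
      · exact strictUpper_incorporate (crossSlides_passSlides_upper h.upper r hk)
          fun s hs => (hQ s hs).1
      -- Crossing strands of different potential carry no handleslide in a graded collection, so
      -- nothing obstructs sliding all of `V` past.
      · exact h.upper.swap hk (h.collGraded.eq_zero hg)
  · change GradedColl ν (p + 1) (S.collAfter ν p r e)
    match e, he, hok, hQ with
    | .leftCusp k, _, _, _ => exact fun i j hij => absurd rfl hij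
    | .rightCusp k b, he, hok, _ =>
      have hk : k + 1 < D.strands p := hok.1
      have h3 : D.strands (p + 1) = D.strands p - 2 := hn
      intro i j hij
      have h4 := hν.rightCusp p k b he
      have h5 := h.upper.lt_of_ne_zero hij
      rw [skipStrand_lt_skipStrand, show D.strands p = D.strands (p + 1) + 2 by omega,
        skipStrand_lt (by omega)] at h5
      rw [h4.2 i (by omega), h4.2 j (by omega)]
      exact h.collGraded _ _ hij
    | .crossing k, he, hok, hQ =>
      have hk : k + 1 < D.strands p := hok.1
      simp only [collAfter]
      split_ifs with hg
      · exact ((h.collGraded.passSlides r (sub_eq_zero.1 hg)).crossSlides hν he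
          (h.upper.passSlides r hk)).incorporate fun s hs => (hQ s hs).2
      · exact h.collGraded.crossSlides hν he h.upper

end InvariantStep

/-! ## The relation between the differentials of the two MCSs -/

section Relation

variable {F : Type*} [Field F]

/-- The collection `V`, in the order opposite to the proper one, intertwines the differentials `d` of the
SR-form and `d'` of the A-form MCS. -/
def Intertwines (n : ℕ) (V : SlideCollection F) (d d' : ℕ → ℕ → F) : Prop :=
  toMat n d * (1 + toMat n V) = (1 + toMat n V) * toMat n d'

theorem intertwines_zero (n : ℕ) (d : ℕ → ℕ → F) : Intertwines n 0 d d := by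
  have : toMat n (0 : ℕ → ℕ → F) = 0 := rfl
  simp [Intertwines, this]

theorem one_add_toMat_slideRow {n t b : ℕ} (hb : b < n) (ht : t < n) (r : F)
    (V : SlideCollection F) : 1 + toMat n (slideRow t b r V) =
      (1 + Matrix.single ⟨t, ht⟩ ⟨b, hb⟩ r) * (1 + toMat n V) := by
  ext i j
  rw [add_mul, one_mul, mul_add, mul_one, Matrix.add_apply, Matrix.add_apply, Matrix.add_apply,
    Matrix.add_apply, single_mul_entry]
  simp only [toMat_apply, slideRow, Matrix.single_apply, Fin.ext_iff, eq_comm (a := t),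
    eq_comm (a := b)]
  ring

/-- The factor `1 + E` gained by `1 + V` compensates the conjugation of `d`, while `d'` is
untouched. -/
theorem Intertwines.slideRow {n : ℕ} {V : SlideCollection F} {d d' : ℕ → ℕ → F}
    (h : Intertwines n V d d') {s : Handleslide F} (ht : s.top < s.bot) (hb : s.bot < n) :
    Intertwines n (slideRow s.top s.bot s.coeff V) (nextDifferential d (.slide s)) d' := by
  have hne : (⟨s.top, ht.trans hb⟩ : Fin n) ≠ ⟨s.bot, hb⟩ := by
    simpa [Fin.ext_iff] using ht.ne
  have e2 := one_sub_single_mul_one_add_single hne s.coeff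
  unfold Intertwines at *
  rw [one_add_toMat_slideRow hb (ht.trans hb), toMat_slide d s hb (ht.trans hb)]
  generalize Matrix.single (⟨s.top, ht.trans hb⟩ : Fin n) (⟨s.bot, hb⟩ : Fin n) s.coeff = E at *
  calc (1 + E) * toMat n d * (1 - E) * ((1 + E) * (1 + toMat n V))
      = (1 + E) * toMat n d * ((1 - E) * (1 + E)) * (1 + toMat n V) := by simp only [mul_assoc]
    _ = (1 + E) * (toMat n d * (1 + toMat n V)) := by rw [e2, mul_one, mul_assoc]
    _ = (1 + E) * (1 + toMat n V) * toMat n d' := by rw [h, mul_assoc]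

theorem Intertwines.incorporate {n : ℕ} {V : SlideCollection F} {d d' : ℕ → ℕ → F}
    (h : Intertwines n V d d') {Q : List (Handleslide F)}
    (hQ : ∀ h ∈ Q, h.top < h.bot ∧ h.bot < n) :
    Intertwines n (SweepState.incorporate V Q)
      ((Q.map ElemTangle.slide).foldl nextDifferential d) d' := by
  induction Q generalizing V d with
  | nil => exact h
  | cons s Q ih =>
    have h1 := hQ s List.mem_cons_self
    exact ih (h.slideRow h1.1 h1.2) fun x hx => hQ x (List.mem_cons_of_mem _ hx)

theorem passSlides_eq_slideRow {n k : ℕ} {V : SlideCollection F} (hV : StrictUpper n V) (r : F)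
    (i j : ℕ) : passSlides k r V i j = slideRow k (k + 1) r V i j -
      (if j = k + 1 then ((if i = k then 1 else 0) + slideRow k (k + 1) r V i k) *
        (V k (k + 1) + r) else 0) := by
  have h1 : V (k + 1) (k + 1) = 0 := hV _ _ (by omega)
  have h2 : V (k + 1) k = 0 := hV _ _ (by omega)
  have h3 : V k k = 0 := hV _ _ (by omega)
  by_cases hi : i = k <;> by_cases hj : j = k + 1 <;> simp [passSlides, slideRow, hi, hj, h1, h2, h3]

/-- With `s = V k (k + 1) + r`, the new collection satisfies `1 + V' = (1 + r E) * (1 + V) * (1 - s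
E)`. The left factor accounts for the SR-form handleslide and the right one for the A-form
handleslide; `s` is the value that makes the entry `(k, k + 1)` of `V'` vanish. -/
theorem Intertwines.passSlides {n k : ℕ} {V : SlideCollection F} {d d' : ℕ → ℕ → F}
    (h : Intertwines n V d d') (hV : StrictUpper n V) (hk : k + 1 < n) (r : F) :
    Intertwines n (passSlides k r V) (nextDifferential d (.slide ⟨k, k + 1, r⟩))
      (nextDifferential d' (.slide ⟨k, k + 1, V k (k + 1) + r⟩)) := by
  have hk' : k < n := by omega
  have h1 := h.slideRow (s := ⟨k, k + 1, r⟩) (by simp) hk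
  have hne : (⟨k, hk'⟩ : Fin n) ≠ ⟨k + 1, hk⟩ := by simp [Fin.ext_iff]
  have e2 := one_sub_single_mul_one_add_single hne (V k (k + 1) + r)
  have h2 : 1 + toMat n (_root_.passSlides k r V) = (1 + toMat n (_root_.slideRow k (k + 1) r V)) *
      (1 - Matrix.single ⟨k, hk'⟩ ⟨k + 1, hk⟩ (V k (k + 1) + r)) := by
    ext i j
    rw [mul_sub, mul_one, Matrix.sub_apply, mul_single_entry, Matrix.add_apply, Matrix.add_apply,
      Matrix.add_apply, toMat_apply, toMat_apply, toMat_apply, passSlides_eq_slideRow hV]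
    simp only [Matrix.one_apply, Fin.ext_iff]
    ring
  unfold Intertwines at *
  rw [h2, toMat_slide d' ⟨k, k + 1, V k (k + 1) + r⟩ hk hk']
  generalize Matrix.single (⟨k, hk'⟩ : Fin n) (⟨k + 1, hk⟩ : Fin n) (V k (k + 1) + r) = E at *
  simp only at h1
  calc _ = (toMat n (nextDifferential d (.slide ⟨k, k + 1, r⟩)) *
        (1 + toMat n (_root_.slideRow k (k + 1) r V))) * (1 - E) := by rw [mul_assoc]
    _ = (1 + toMat n (_root_.slideRow k (k + 1) r V)) * ((1 - E) * (1 + E)) * toMat n d' *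
        (1 - E) := by rw [h1, e2, mul_one]
    _ = _ := by simp only [mul_assoc]

theorem Intertwines.crossing {n k : ℕ} {V : SlideCollection F} {d d' : ℕ → ℕ → F}
    (h : Intertwines n V d d') (hk : k + 1 < n) :
    Intertwines n (crossSlides k V) (nextDifferential d (.front (.crossing k)))
      (nextDifferential d' (.front (.crossing k))) := by
  unfold Intertwines at *
  have e1 : ∀ d : ℕ → ℕ → F, toMat n (nextDifferential d (.front (.crossing k))) =
    (toMat n d).submatrix (swapPerm n k hk) (swapPerm n k hk) := fun d => rfl
  have e2 : 1 + toMat n (crossSlides k V) =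
      (1 + toMat n V).submatrix (swapPerm n k hk) (swapPerm n k hk) := by
    ext i j
    rw [Matrix.submatrix_apply, Matrix.add_apply, Matrix.add_apply, Matrix.one_apply,
      Matrix.one_apply]
    simp only [EmbeddingLike.apply_eq_iff_eq]
    rfl
  rw [e1, e1, e2, Matrix.submatrix_mul_equiv, Matrix.submatrix_mul_equiv, h]

theorem toMat_mul_superdiagonal {n i : ℕ} {d d' : ℕ → ℕ → F} (hd : StrictUpper n d)
    (hd' : StrictUpper n d') (hi : i + 1 < n) :
    (toMat n d * toMat n d') ⟨i, by omega⟩ ⟨i + 1, hi⟩ = 0 := by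
  rw [Matrix.mul_apply]
  refine Finset.sum_eq_zero fun l _ => ?_
  by_cases hl : i < (l : ℕ)
  · simp [hd' l (i + 1) (by omega)]
  · simp [hd i l (by omega)]

/-- A product of two strictly upper triangular matrices vanishes just above the diagonal, so there
the relation reads `d = d'`. -/
theorem Intertwines.superdiagonal {n : ℕ} {V : SlideCollection F} {d d' : ℕ → ℕ → F}
    (h : Intertwines n V d d') (hV : StrictUpper n V) (hd : StrictUpper n d)
    (hd' : StrictUpper n d') (i : ℕ) : d i (i + 1) = d' i (i + 1) := by
  by_cases hi : i + 1 < n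
  · have h1 := congrFun (congrFun h ⟨i, by omega⟩) ⟨i + 1, hi⟩
    rw [mul_add, add_mul, mul_one, one_mul, Matrix.add_apply, Matrix.add_apply,
      toMat_mul_superdiagonal hd hV hi, toMat_mul_superdiagonal hV hd' hi] at h1
    simpa using h1
  · rw [hd _ _ (by omega), hd' _ _ (by omega)]

theorem nextDifferential_slide_zero (d : ℕ → ℕ → F) (t b : ℕ) :
    nextDifferential d (.slide ⟨t, b, 0⟩) = d := by
  funext i j
  simp [nextDifferential]

theorem rightCusp_superdiagonal {n k : ℕ} {b : Bool} {d : ℕ → ℕ → F} (hd : StrictUpper n d)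
    (hk : Even k) (l : ℕ) : nextDifferential d (.front (.rightCusp k b)) (2 * l) (2 * l + 1) =
      d (skipStrand k (2 * l)) (skipStrand k (2 * l) + 1) ∧ Even (skipStrand k (2 * l)) := by
  obtain ⟨x, rfl⟩ := hk
  have h1 : skipStrand (x + x) (2 * l + 1) = skipStrand (x + x) (2 * l) + 1 := by
    unfold skipStrand; split_ifs <;> omega
  constructor
  · simp only [nextDifferential, h1]
    -- The pair `2 * l`, `2 * l + 1` lies entirely above or entirely below the cusp since `k` is
    -- even; in either case triangularity kills one factor of the correction term.
    by_cases h2 : 2 * l < x + x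
    · have : d (x + x) (skipStrand (x + x) (2 * l) + 1) = 0 := hd _ _ (by
        unfold skipStrand; split_ifs; omega)
      simp [this]
    · have : d (skipStrand (x + x) (2 * l)) (x + x + 1) = 0 := hd _ _ (by
        unfold skipStrand; split_ifs; omega)
      simp [this]
  · unfold skipStrand
    split_ifs
    · exact ⟨l, by omega⟩
    · exact ⟨l + 1, by omega⟩

end Relation

/-! ## Lists of events with handleslides -/

section Assemble

variable {F : Type*} [Field F]

/-- `assemble` for events that are numbered from `p` on. -/
def assembleFrom {R : Type*} (p : ℕ) (E : List FrontEvent) (L Q : ℕ → List (Handleslide R)) :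
    List (ElemTangle R) :=
  (E.zipIdx p).flatMap fun ep => (L ep.2).map .slide ++ [.front ep.1] ++ (Q ep.2).map .slide

theorem assembleFrom_cons {R : Type*} (p : ℕ) (e : FrontEvent) (E : List FrontEvent)
    (L Q : ℕ → List (Handleslide R)) : assembleFrom p (e :: E) L Q =
      ((L p).map .slide ++ [.front e] ++ (Q p).map .slide) ++ assembleFrom (p + 1) E L Q := by
  simp [assembleFrom, List.zipIdx_cons]

theorem assemble_take_succ {R : Type*} {E : List FrontEvent} {p : ℕ} {e : FrontEvent}
    (he : E[p]? = some e) (L Q : ℕ → List (Handleslide R)) :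
    assemble (E.take (p + 1)) L Q = assemble (E.take p) L Q ++
      ((L p).map .slide ++ [.front e] ++ (Q p).map .slide) := by
  have hp := (List.getElem?_eq_some_iff.1 he).1
  have hlen : (E.take p).length = p := by simp; omega
  rw [List.take_add_one, he, assemble, List.zipIdx_append, List.flatMap_append, hlen]
  simp [assemble]

theorem assemble_congr {R : Type*} {E : List FrontEvent} {L Q L' Q' : ℕ → List (Handleslide R)}
    (h : ∀ p < E.length, L p = L' p ∧ Q p = Q' p) : assemble E L Q = assemble E L' Q' := by
  unfold assemble
  have : ∀ x ∈ E.zipIdx, x.2 < E.length := by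
    rintro ⟨e, p⟩ hx
    have := List.snd_lt_add_of_mem_zipIdx hx
    simpa using this
  refine List.flatMap_congr fun x hx => ?_
  rw [(h x.2 (this x hx)).1, (h x.2 (this x hx)).2]

theorem filterMap_map_slide {R : Type*} (Q : List (Handleslide R)) :
    (Q.map ElemTangle.slide).filterMap ElemTangle.event? = [] := by
  rw [List.filterMap_map, List.filterMap_eq_nil_iff]
  intros; rfl

theorem filterMap_assemble_take {R : Type*} (E : List FrontEvent)
    (L Q : ℕ → List (Handleslide R)) (p : ℕ) :
    (assemble (E.take p) L Q).filterMap ElemTangle.event? = E.take p := by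
  induction p with
  | zero => rfl
  | succ p ih =>
    cases he : E[p]? with
    | none =>
      have hp : E.length ≤ p := List.getElem?_eq_none_iff.1 he
      rwa [List.take_of_length_le (by omega : E.length ≤ p + 1),
        ← List.take_of_length_le hp]
    | some e =>
      rw [assemble_take_succ he, List.filterMap_append, List.filterMap_append, List.filterMap_append,
        filterMap_map_slide, filterMap_map_slide, ih, List.take_add_one, he]
      rfl

theorem filterMap_assemble {R : Type*} (E : List FrontEvent) (L Q : ℕ → List (Handleslide R)) :
    (assemble E L Q).filterMap ElemTangle.event? = E := by
  have := filterMap_assemble_take E L Q E.length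
  rwa [List.take_length] at this

theorem foldl_tangleNext_assemble_take (E : List FrontEvent) (L Q : ℕ → List (Handleslide F))
    (p : ℕ) : (assemble (E.take p) L Q).foldl tangleNext 0 = strandCount E p := by
  rw [foldl_tangleNext, filterMap_assemble_take, strandCount]

theorem good_assemble_iff (E : List FrontEvent) (L Q : ℕ → List (Handleslide F)) :
    Good 0 0 (assemble E L Q) ↔ ∀ p e, E[p]? = some e → Good (strandCount E p)
      ((assemble (E.take p) L Q).foldl nextDifferential 0)
      ((L p).map .slide ++ [.front e] ++ (Q p).map .slide) := by
  have key : ∀ q ≤ E.length, Good 0 0 (assemble (E.take q) L Q) ↔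
      ∀ p < q, ∀ e, E[p]? = some e → Good (strandCount E p)
        ((assemble (E.take p) L Q).foldl nextDifferential 0)
        ((L p).map .slide ++ [.front e] ++ (Q p).map .slide) := by
    intro q
    induction q with
    | zero => simp [assemble, Good]
    | succ q ih =>
      intro hq
      have he : E[q]? = some E[q] := List.getElem?_eq_getElem (by omega)
      rw [assemble_take_succ he, good_append, ih (by omega), foldl_tangleNext_assemble_take]
      constructor
      · rintro ⟨h1, h2⟩ p hp e hpe
        rcases Nat.lt_succ_iff_lt_or_eq.1 hp with hp | rfl
        · exact h1 p hp e hpe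
        · rw [he] at hpe; cases hpe; exact h2
      · intro h
        exact ⟨fun p hp => h p (by omega), h q (by omega) _ he⟩
  have h := key E.length le_rfl
  rw [List.take_length] at h
  rw [h]
  constructor
  · intro h p e he
    exact h p (List.getElem?_eq_some_iff.1 he).1 e he
  · exact fun h p _ e he => h p e he

/-- Locates the slice of a handleslide, at whose potential its grading must be tested: slice `p` to
the left of event `p` and slice `p + 1` to its right. -/
theorem mem_assemble_take {R : Type*} {E : List FrontEvent} {L Q : ℕ → List (Handleslide R)} {q : ℕ}
    (hq : q ≤ E.length) {l : ℕ} {h : Handleslide R}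
    (hl : (assemble (E.take q) L Q)[l]? = some (.slide h)) : ∃ p < q,
      (h ∈ L p ∧ sliceIndex (assemble (E.take q) L Q) l = p) ∨
      (h ∈ Q p ∧ sliceIndex (assemble (E.take q) L Q) l = p + 1) := by
  induction q with
  | zero => simp [assemble] at hl
  | succ q ih =>
    have he : E[q]? = some E[q] := List.getElem?_eq_getElem (by omega)
    have hlen : (List.filterMap ElemTangle.event? (assemble (E.take q) L Q)).length = q := by
      rw [filterMap_assemble_take, List.length_take]; omega
    rw [assemble_take_succ he] at hl ⊢
    generalize assemble (E.take q) L Q = A at *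
    by_cases h1 : l < A.length
    · rw [List.getElem?_append_left h1] at hl
      obtain ⟨p, hp, h2⟩ := ih (by omega) hl
      refine ⟨p, by omega, ?_⟩
      have : sliceIndex (A ++ ((L q).map .slide ++ [.front E[q]] ++ (Q q).map .slide)) l =
          sliceIndex A l := by
        rw [sliceIndex, sliceIndex, List.take_append_of_le_length h1.le]
      rwa [this]
    · rw [List.getElem?_append_right (by omega)] at hl
      refine ⟨q, by omega, ?_⟩
      obtain ⟨x, rfl⟩ : ∃ x, l = A.length + x := ⟨l - A.length, by omega⟩
      rw [Nat.add_sub_cancel_left] at hl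
      have h3 : sliceIndex (A ++ ((L q).map .slide ++ [.front E[q]] ++ (Q q).map .slide))
          (A.length + x) =
          q + sliceIndex ((L q).map .slide ++ [.front E[q]] ++ (Q q).map .slide) x := by
        rw [sliceIndex, List.take_length_add_append, List.filterMap_append, List.length_append,
          hlen, sliceIndex]
      rw [h3]
      clear h3
      by_cases h4 : x < (L q).length
      · left
        rw [List.append_assoc, List.getElem?_append_left (by simpa using h4)] at hl
        have hm := List.mem_of_getElem? hl
        refine ⟨by simpa using hm, ?_⟩
        rw [sliceIndex, List.append_assoc, List.take_append_of_le_length (by simpa using h4.le),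
          ← List.map_take, filterMap_map_slide]
        rfl
      · right
        rw [List.append_assoc, List.getElem?_append_right (by simpa using h4)] at hl
        obtain ⟨y, rfl⟩ : ∃ y, x = (L q).length + y := ⟨x - (L q).length, by omega⟩
        simp only [List.length_map, Nat.add_sub_cancel_left] at hl
        cases y with
        | zero => simp at hl
        | succ y =>
          have hm : ElemTangle.slide h ∈ (Q q).map ElemTangle.slide := by
            refine List.mem_of_getElem? (i := y) ?_
            simpa using hl
          refine ⟨by simpa using hm, ?_⟩
          have h5 : List.take ((L q).length + (y + 1))
              (List.map ElemTangle.slide (L q) ++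
                ([ElemTangle.front E[q]] ++ List.map ElemTangle.slide (Q q))) =
              (L q).map ElemTangle.slide ++ ElemTangle.front E[q] ::
                ((Q q).take y).map ElemTangle.slide := by
            have := List.take_length_add_append (l₁ := List.map ElemTangle.slide (L q)) (i := y + 1)
              (l₂ := [ElemTangle.front E[q]] ++ List.map ElemTangle.slide (Q q))
            rw [List.length_map] at this
            rw [this]
            simp [List.map_take]
          rw [sliceIndex, List.append_assoc, h5, List.filterMap_append,
            List.filterMap_cons_some (f := ElemTangle.event?) (b := E[q]) rfl, filterMap_map_slide,
            filterMap_map_slide]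
          rfl

end Assemble

/-! ## Pairs of MCSs that correspond to each other -/

section Joint

variable {F : Type*} [Field F] [DecidableEq F]

open SweepState

/-- The state of the sweep in slice `p`.  The coefficient of the SR-form handleslide to the left of the
event that follows slice `p` is `c p V`, where `V` is the collection in slice `p`. -/
def sweepState (E : List FrontEvent) {m : ℕ} (ν : ℕ → ℕ → ZMod m)
    (c : ℕ → SlideCollection F → F) : ℕ → SweepState F
  | 0 => ⟨id, 0, 0⟩
  | p + 1 =>
    match E[p]? with
    | some e => (sweepState E ν c p).next ν p (c p (sweepState E ν c p).coll) e
    | none => sweepState E ν c p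

section Data

variable (E : List FrontEvent) {m : ℕ} (ν : ℕ → ℕ → ZMod m) (c : ℕ → SlideCollection F → F) (p : ℕ)

/-- The coefficient of the SR-form handleslide to the left of the event that follows slice `p`. -/
def sweepCoeff : F := c p (sweepState E ν c p).coll

/-- The handleslides of the SR-form MCS to the left of an event. -/
def srLeftAt : List (Handleslide F) :=
  (E[p]?.map ((sweepState E ν c p).srLeft ν p (sweepCoeff E ν c p))).getD []

/-- The handleslides of the SR-form MCS to the right of an event. -/
def srRightAt : List (Handleslide F) :=
  (E[p]?.map ((sweepState E ν c p).srRight ν p (sweepCoeff E ν c p))).getD []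

/-- The handleslides of the A-form MCS to the left of an event. -/
def aLeftAt : List (Handleslide F) :=
  (E[p]?.map ((sweepState E ν c p).aLeft ν p (sweepCoeff E ν c p))).getD []

/-- The SR-form MCS. -/
def srTangles : List (ElemTangle F) := assemble E (srLeftAt E ν c) (srRightAt E ν c)

/-- The A-form MCS. -/
def aTangles : List (ElemTangle F) := assemble E (aLeftAt E ν c) fun _ => []

/-- The differential of the A-form MCS in slice `p`. -/
def aDiff : ℕ → ℕ → F :=
  (assemble (E.take p) (aLeftAt E ν c) fun _ => []).foldl nextDifferential 0

variable {E p} {e : FrontEvent} (he : E[p]? = some e)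

include he

theorem sweepState_succ : sweepState E ν c (p + 1) =
    (sweepState E ν c p).next ν p (sweepCoeff E ν c p) e := by
  simp [sweepState, he, sweepCoeff]

theorem srLeftAt_eq : srLeftAt E ν c p = (sweepState E ν c p).srLeft ν p (sweepCoeff E ν c p) e := by
  simp [srLeftAt, he]

theorem srRightAt_eq :
    srRightAt E ν c p = (sweepState E ν c p).srRight ν p (sweepCoeff E ν c p) e := by
  simp [srRightAt, he]

theorem aLeftAt_eq : aLeftAt E ν c p = (sweepState E ν c p).aLeft ν p (sweepCoeff E ν c p) e := by
  simp [aLeftAt, he]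

theorem aDiff_succ : aDiff E ν c (p + 1) =
    ((sweepState E ν c p).aBlock ν p (sweepCoeff E ν c p) e).foldl nextDifferential
      (aDiff E ν c p) := by
  rw [aDiff, assemble_take_succ he, List.foldl_append, aLeftAt_eq ν c he]
  simp [aDiff, aBlock]

end Data

theorem sweepState_diff (E : List FrontEvent) {m : ℕ} (ν : ℕ → ℕ → ZMod m)
    (c : ℕ → SlideCollection F → F) (p : ℕ) : (sweepState E ν c p).diff =
      (assemble (E.take p) (srLeftAt E ν c) (srRightAt E ν c)).foldl nextDifferential 0 := by
  induction p with
  | zero => rfl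
  | succ p ih =>
    cases he : E[p]? with
    | none =>
      have hp : E.length ≤ p := List.getElem?_eq_none_iff.1 he
      rw [List.take_of_length_le hp] at ih
      rw [List.take_of_length_le (by omega), ← ih]
      simp [sweepState, he]
    | some e =>
      rw [assemble_take_succ he, List.foldl_append, ← ih, sweepState_succ ν c he,
        srLeftAt_eq ν c he, srRightAt_eq ν c he]
      rfl

/-! ### Nearly plat fronts and the comparison of the two differentials -/

/-- The shape of a nearly plat front: `a` left cusps, then crossings up to event number `b`, and then
right cusps at even strands. -/
structure PlatShape (D : Front) (a b : ℕ) : Prop where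
  leftCusp : ∀ p k, D.events[p]? = some (.leftCusp k) → p < a
  crossing : ∀ p k, D.events[p]? = some (.crossing k) → a ≤ p ∧ p < b
  rightCusp : ∀ p k x, D.events[p]? = some (.rightCusp k x) → b ≤ p ∧ Even k
  le : a ≤ b

theorem Front.NearlyPlat.exists_shape {D : Front} (h : D.NearlyPlat) : ∃ a b, PlatShape D a b := by
  obtain ⟨E₁, E₂, E₃, hE, h1, h2, h3⟩ := h
  have key : ∀ p e, D.events[p]? = some e → (p < E₁.length ∧ e ∈ E₁) ∨
      (E₁.length ≤ p ∧ p < E₁.length + E₂.length ∧ e ∈ E₂) ∨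
      (E₁.length + E₂.length ≤ p ∧ e ∈ E₃) := by
    intro p e he
    rw [hE] at he
    by_cases c1 : p < E₁.length
    · rw [List.append_assoc, List.getElem?_append_left c1] at he
      exact .inl ⟨c1, List.mem_of_getElem? he⟩
    by_cases c2 : p < E₁.length + E₂.length
    · rw [List.append_assoc, List.getElem?_append_right (by omega),
        List.getElem?_append_left (by omega)] at he
      exact .inr (.inl ⟨by omega, c2, List.mem_of_getElem? he⟩)
    · rw [List.getElem?_append_right (by simp; omega)] at he
      exact .inr (.inr ⟨by omega, List.mem_of_getElem? he⟩)
  refine ⟨E₁.length, E₁.length + E₂.length, ?_, ?_, ?_, by omega⟩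
  · intro p k he
    rcases key p _ he with ⟨c, -⟩ | ⟨-, -, c⟩ | ⟨-, c⟩
    · exact c
    · obtain ⟨_, c⟩ := h2 _ c; cases c
    · obtain ⟨_, _, _, c⟩ := h3 _ c; cases c
  · intro p k he
    rcases key p _ he with ⟨-, c⟩ | ⟨c, c', -⟩ | ⟨-, c⟩
    · obtain ⟨_, _, c⟩ := h1 _ c; cases c
    · exact ⟨c, c'⟩
    · obtain ⟨_, _, _, c⟩ := h3 _ c; cases c
  · intro p k x he
    rcases key p _ he with ⟨-, c⟩ | ⟨-, -, c⟩ | ⟨c', c⟩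
    · obtain ⟨_, _, c⟩ := h1 _ c; cases c
    · obtain ⟨_, c⟩ := h2 _ c; cases c
    · obtain ⟨k', b', hk, c⟩ := h3 _ c
      cases c
      exact ⟨c', hk⟩

/-- The relation between the differential `d'` of the A-form MCS and the state of the sweep. -/
structure ARel (a b p n : ℕ) (S : SweepState F) (d' : ℕ → ℕ → F) : Prop where
  diff : IsDifferential n d'
  eq : p ≤ a → S.coll = 0 ∧ d' = S.diff
  intertwines : p ≤ b → Intertwines n S.coll S.diff d'
  even : ∀ l, S.diff (2 * l) (2 * l + 1) = d' (2 * l) (2 * l + 1)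

/-- Only the entry `(k, k + 1)` is tested. At a crossing the intertwining relation is available. At
a right cusp, where it may no longer be, `k` is even and agreement of the even superdiagonal entries
suffices. -/
theorem ARel.stepOk_iff {D : Front} {a b : ℕ} (hD : PlatShape D a b) {m : ℕ}
    {ν : ℕ → ℕ → ZMod m} {p : ℕ} {S : SweepState F} (h : SRInv ν p (D.strands p) S)
    {d' : ℕ → ℕ → F} (hA : ARel a b p (D.strands p) S d') {e : FrontEvent}
    (he : D.events[p]? = some e) :
    StepOk (D.strands p) S.diff (.front e) ↔ StepOk (D.strands p) d' (.front e) := by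
  match e, he with
  | .leftCusp k, _ => exact Iff.rfl
  | .crossing k, he =>
    have h1 := hD.crossing p k he
    simp only [StepOk, (hA.intertwines h1.2.le).superdiagonal h.upper h.diff.upper hA.diff.upper k]
  | .rightCusp k x, he =>
    obtain ⟨-, l, rfl⟩ := hD.rightCusp p k x he
    have h1 := hA.even l
    rw [two_mul] at h1
    simp only [StepOk, h1]

theorem good_aBlock_iff {n : ℕ} {m : ℕ} {ν : ℕ → ℕ → ZMod m} {p : ℕ} {S : SweepState F}
    {d' : ℕ → ℕ → F} (hd : IsDifferential n d') {e : FrontEvent} (he : e.Fits n) (r : F) :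
    Good n d' (S.aBlock ν p r e) ↔ StepOk n d' (.front e) := by
  have h1 := good_block_iff (e := e) hd.upper (Q := [])
    (fun s hs => (aLeft_ok (ν := ν) (p := p) (S := S) he r s hs).1) (by simp)
  simpa [aBlock] using h1

theorem Intertwines.crossing_block {n k p m : ℕ} {ν : ℕ → ℕ → ZMod m} {S : SweepState F}
    {d' : ℕ → ℕ → F} (h : Intertwines n S.coll S.diff d') (hV : StrictUpper n S.coll)
    (hk : k + 1 < n) (r : F)
    (hQ : ∀ h ∈ S.srRight ν p r (.crossing k), h.top < h.bot ∧ h.bot < n) :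
    Intertwines n (S.next ν p r (.crossing k)).coll (S.next ν p r (.crossing k)).diff
      ((S.aBlock ν p r (.crossing k)).foldl nextDifferential d') := by
  by_cases hg : Front.GradedCrossing ν p k
  · have h1 := ((h.passSlides hV hk r).crossing hk).incorporate hQ
    have h2 : (S.next ν p r (.crossing k)).coll =
        SweepState.incorporate (crossSlides k (_root_.passSlides k r S.coll))
          (S.srRight ν p r (.crossing k)) := by
      simp [SweepState.next, collAfter, hg]
    have h3 : ((S.srLeft ν p r (.crossing k)).map ElemTangle.slide).foldl nextDifferential S.diff =
        nextDifferential S.diff (.slide ⟨k, k + 1, r⟩) := by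
      by_cases hN : Front.Normality S.inv k ∧ r = 0
      · simp [srLeft, hN, nextDifferential_slide_zero]
      · have : S.srLeft ν p r (.crossing k) = [⟨k, k + 1, r⟩] := by
          simp only [srLeft, hg, hN, not_false_eq_true, and_self, if_true]
        rw [this]; rfl
    have h4 : (S.aBlock ν p r (.crossing k)).foldl nextDifferential d' =
        nextDifferential (nextDifferential d' (.slide ⟨k, k + 1, S.coll k (k + 1) + r⟩))
          (.front (.crossing k)) := by
      simp [aBlock, aLeft, hg]
    have h5 : (S.next ν p r (.crossing k)).diff =
        ((S.srRight ν p r (.crossing k)).map ElemTangle.slide).foldl nextDifferential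
          (nextDifferential (nextDifferential S.diff (.slide ⟨k, k + 1, r⟩))
            (.front (.crossing k))) := by
      simp only [SweepState.next, srBlock, List.foldl_append, h3]
      rfl
    rw [h2, h4, h5]
    exact h1
  · have h1 := h.crossing hk
    simpa [SweepState.next, srBlock, srLeft, srRight, collAfter, aBlock, aLeft, hg] using h1

theorem ARel.next {D : Front} {a b : ℕ} (hD : PlatShape D a b) {m : ℕ}
    {ν : ℕ → ℕ → ZMod m} (hν : IsPotential D ν) {p : ℕ} {S : SweepState F}
    (h : SRInv ν p (D.strands p) S)
    {d' : ℕ → ℕ → F} (hA : ARel a b p (D.strands p) S d') {e : FrontEvent}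
    (he : D.events[p]? = some e) (hok : StepOk (D.strands p) S.diff (.front e)) (r : F) :
    ARel a b (p + 1) (D.strands (p + 1)) (S.next ν p r e)
      ((S.aBlock ν p r e).foldl nextDifferential d') := by
  have hn := D.strands_succ he
  have hf := D.fits_of_getElem? he
  have hok' := (ARel.stepOk_iff hD h hA he).1 hok
  have hd' : IsDifferential (D.strands (p + 1)) ((S.aBlock ν p r e).foldl nextDifferential d') := by
    have h1 := ((good_aBlock_iff (ν := ν) (p := p) (S := S) hA.diff hf r).2 hok').isDifferential
      hA.diff
    have h2 := foldl_tangleNext_block (F := F) (D.strands p) (S.aLeft ν p r e) [] e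
    simp only [List.map_nil, List.append_nil] at h2
    rwa [aBlock, h2, ← hn] at h1
  have hS := h.next hν he hok r
  have hQ := h.right_ok hν he hok r
  match e, he, hok, hQ with
  | .leftCusp k, he, hok, _ =>
    -- All left cusps come first, so the collection that the sweeps discard here is still zero and
    -- the two differentials coincide.
    have hp := hD.leftCusp p k he
    have h1 : (S.next ν p r (.leftCusp k)).coll = 0 := rfl
    have h2 : (S.aBlock ν p r (.leftCusp k)).foldl nextDifferential d' =
        (S.next ν p r (.leftCusp k)).diff := by
      rw [(hA.eq hp.le).2]; rfl
    rw [h2] at hd' ⊢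
    refine ⟨hd', fun _ => ⟨h1, rfl⟩, fun _ => ?_, fun _ => rfl⟩
    rw [h1]
    exact intertwines_zero _ _
  | .crossing k, he, hok, hQ =>
    have hp := hD.crossing p k he
    have hk : k + 1 < D.strands p := hok.1
    have h1 := (hA.intertwines hp.2.le).crossing_block h.upper hk r fun s hs => (hQ s hs).1
    have h2 : D.strands (p + 1) = D.strands p := hn
    refine ⟨hd', fun hc => by omega, fun _ => by rw [h2]; exact h1, fun l => ?_⟩
    rw [h2] at hS hd'
    exact h1.superdiagonal hS.upper hS.diff.upper hd'.upper _
  | .rightCusp k x, he, hok, _ =>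
    have hp := hD.rightCusp p k x he
    have hk : k + 1 < D.strands p := hok.1
    have hab := hD.le
    refine ⟨hd', fun hc => by omega, fun hc => by omega, fun l => ?_⟩
    -- The entries in question depend on neither the optional handleslide at the cusp nor its
    -- coefficient, so one computation serves both differentials.
    have key : ∀ (d : ℕ → ℕ → F), IsDifferential (D.strands p) d → ∀ s : F,
        ((if m = 1 then [(⟨k, k + 1, s⟩ : Handleslide F)] else []).map ElemTangle.slide ++
          [ElemTangle.front (.rightCusp k x)]).foldl nextDifferential d (2 * l) (2 * l + 1) =
        d (skipStrand k (2 * l)) (skipStrand k (2 * l) + 1) := by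
      intro d hd s
      have hb : ∀ h ∈ (if m = 1 then [(⟨k, k + 1, s⟩ : Handleslide F)] else []),
          h.top < h.bot ∧ h.bot < D.strands p := by
        intro h hh
        split_ifs at hh
        · rw [List.mem_singleton] at hh; subst hh; exact ⟨by simp, hk⟩
        · simp at hh
      have hd2 := (good_slides d hb).isDifferential hd
      rw [foldl_tangleNext_slides] at hd2
      rw [List.foldl_append, List.foldl_cons, List.foldl_nil,
        (rightCusp_superdiagonal hd2.upper hp.2 l).1, superdiagonal_slides hd.upper hb]
    have e1 : (S.next ν p r (.rightCusp k x)).diff (2 * l) (2 * l + 1) =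
        S.diff (skipStrand k (2 * l)) (skipStrand k (2 * l) + 1) := by
      rw [← key S.diff h.diff r, ← List.append_nil (_ ++ [_])]
      rfl
    have e2 : (S.aBlock ν p r (.rightCusp k x)).foldl nextDifferential d' (2 * l) (2 * l + 1) =
        d' (skipStrand k (2 * l)) (skipStrand k (2 * l) + 1) :=
      key d' hA.diff (S.coll k (k + 1) + r)
    obtain ⟨l', hl'⟩ := (rightCusp_superdiagonal (b := x) h.diff.upper hp.2 l).2
    rw [e1, e2, hl', ← two_mul]
    exact hA.even l'

/-! ### Both lists are MCSs under the same condition -/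

/-- The local conditions hold at every event. -/
def EventsOk (D : Front) {m : ℕ} (ν : ℕ → ℕ → ZMod m) (c : ℕ → SlideCollection F → F) : Prop :=
  ∀ p e, D.events[p]? = some e →
    StepOk (D.strands p) (sweepState D.events ν c p).diff (.front e)

/-- The invariants in slice `p` require the local conditions at earlier events only. This allows the
condition at event `p` itself to be derived from either list. -/
theorem sweepInvariants {D : Front} {a b : ℕ} (hD : PlatShape D a b) {m : ℕ}
    {ν : ℕ → ℕ → ZMod m} (hν : IsPotential D ν) {c : ℕ → SlideCollection F → F} {p : ℕ}
    (hp : p ≤ D.events.length) (hok : ∀ q < p, ∀ e, D.events[q]? = some e →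
      StepOk (D.strands q) (sweepState D.events ν c q).diff (.front e)) :
    SRInv ν p (D.strands p) (sweepState D.events ν c p) ∧
      ARel a b p (D.strands p) (sweepState D.events ν c p) (aDiff D.events ν c p) := by
  induction p with
  | zero =>
    have h0 : D.strands 0 = 0 := rfl
    have hd : IsDifferential 0 (0 : ℕ → ℕ → F) := ⟨fun _ _ _ => rfl, Subsingleton.elim _ _⟩
    rw [h0]
    refine ⟨⟨fun i hi => absurd hi (by omega), hd, fun i j h => absurd rfl h,
      fun i j => ⟨fun h => absurd rfl h, fun h => by omega⟩, fun _ _ _ => rfl,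
      fun i j h => absurd rfl h⟩, hd, fun _ => ⟨rfl, rfl⟩, fun _ => intertwines_zero 0 0,
      fun _ => rfl⟩
  | succ p ih =>
    obtain ⟨h1, h2⟩ := ih (by omega) fun q hq => hok q (by omega)
    have he : D.events[p]? = some D.events[p] := List.getElem?_eq_getElem (by omega)
    have h3 := hok p (by omega) _ he
    rw [sweepState_succ ν c he, aDiff_succ ν c he]
    exact ⟨h1.next hν he h3 _, h2.next hD hν h1 he h3 _⟩

theorem EventsOk.invariants {D : Front} {a b : ℕ} (hD : PlatShape D a b) {m : ℕ}
    {ν : ℕ → ℕ → ZMod m} (hν : IsPotential D ν) {c : ℕ → SlideCollection F → F}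
    (h : EventsOk D ν c) {p : ℕ} (hp : p ≤ D.events.length) :
    SRInv ν p (D.strands p) (sweepState D.events ν c p) ∧
      ARel a b p (D.strands p) (sweepState D.events ν c p) (aDiff D.events ν c p) :=
  sweepInvariants hD hν hp fun q _ => h q

theorem stepOk_of_good_slides {n : ℕ} {d : ℕ → ℕ → F} (hd : StrictUpper n d) {e : FrontEvent}
    {L : List (Handleslide F)} (h : Good n d (L.map .slide ++ [.front e])) :
    StepOk n d (.front e) := by
  rw [good_append, foldl_tangleNext_slides] at h
  exact h.2.1.congr fun i => (superdiagonal_slides hd (slides_bounds_of_good h.1) i).symm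

theorem eventsOk_of_step {D : Front} {m : ℕ} {ν : ℕ → ℕ → ZMod m} {c : ℕ → SlideCollection F → F}
    (H : ∀ p e, D.events[p]? = some e → (∀ q < p, ∀ e, D.events[q]? = some e →
      StepOk (D.strands q) (sweepState D.events ν c q).diff (.front e)) →
      StepOk (D.strands p) (sweepState D.events ν c p).diff (.front e)) : EventsOk D ν c := by
  intro p
  induction p using Nat.strong_induction_on with
  | _ p ih => exact fun e he => H p e he fun q hq e he => ih q hq e he

theorem eventsOk_iff_good_srTangles {D : Front} {a b : ℕ} (hD : PlatShape D a b) {m : ℕ}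
    {ν : ℕ → ℕ → ZMod m} (hν : IsPotential D ν) (c : ℕ → SlideCollection F → F) :
    EventsOk D ν c ↔ Good 0 0 (srTangles D.events ν c) := by
  rw [srTangles, good_assemble_iff]
  constructor
  · intro h p e he
    have hp := (List.getElem?_eq_some_iff.1 he).1
    rw [← sweepState_diff, srLeftAt_eq ν c he, srRightAt_eq ν c he]
    exact (h.invariants hD hν hp.le).1.good_srBlock hν he (h p e he) _
  · intro h
    -- Induction along the front: the earlier events provide the triangularity that allows the
    -- condition to be moved across the left handleslides.
    refine eventsOk_of_step fun p e he hq => ?_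
    have hp := (List.getElem?_eq_some_iff.1 he).1
    have h1 := (sweepInvariants hD hν hp.le hq).1
    have h2 := h p e he
    rw [← sweepState_diff, good_append] at h2
    exact stepOk_of_good_slides h1.diff.upper h2.1

/-- Together with `eventsOk_iff_good_srTangles` this shows that one list is realized by an MCS
exactly when the other one is. -/
theorem eventsOk_iff_good_aTangles {D : Front} {a b : ℕ} (hD : PlatShape D a b) {m : ℕ}
    {ν : ℕ → ℕ → ZMod m} (hν : IsPotential D ν) (c : ℕ → SlideCollection F → F) :
    EventsOk D ν c ↔ Good 0 0 (aTangles D.events ν c) := by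
  have key : ∀ p e, D.events[p]? = some e →
      (aLeftAt D.events ν c p).map ElemTangle.slide ++ [.front e] ++
        ([] : List (Handleslide F)).map .slide =
      (sweepState D.events ν c p).aBlock ν p (sweepCoeff D.events ν c p) e := by
    intro p e he
    rw [aLeftAt_eq ν c he]
    simp [aBlock]
  rw [aTangles, good_assemble_iff]
  constructor
  · intro h p e he
    have hp := (List.getElem?_eq_some_iff.1 he).1
    have h1 := h.invariants hD hν hp.le
    rw [key p e he]
    exact (good_aBlock_iff h1.2.diff (D.fits_of_getElem? he) _).2
      ((ARel.stepOk_iff hD h1.1 h1.2 he).1 (h p e he))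
  · intro h
    refine eventsOk_of_step fun p e he hq => ?_
    have hp := (List.getElem?_eq_some_iff.1 he).1
    have h1 := sweepInvariants hD hν hp.le hq
    have h2 := h p e he
    rw [key p e he] at h2
    exact (ARel.stepOk_iff hD h1.1 h1.2 he).2
      ((good_aBlock_iff h1.2.diff (D.fits_of_getElem? he) _).1 h2)

end Joint

/-! ## The sweeps along corresponding MCSs -/

section Correspondence

variable {F : Type*} [Field F] [DecidableEq F]

open SweepState

theorem sweepToA_assembleFrom {D : Front} {a b : ℕ} (hD : PlatShape D a b) {m : ℕ}
    {ν : ℕ → ℕ → ZMod m} (hν : IsPotential D ν) {c : ℕ → SlideCollection F → F}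
    (h : EventsOk D ν c) (E : List FrontEvent) (p : ℕ) (hE : D.events.drop p = E) :
    sweepToA ν p (D.strands p) (sweepState D.events ν c p).coll
        (assembleFrom p E (srLeftAt D.events ν c) (srRightAt D.events ν c)) =
      assembleFrom p E (aLeftAt D.events ν c) fun _ => [] := by
  induction E generalizing p with
  | nil => simp [assembleFrom, sweepToA]
  | cons e E ih =>
    have he : D.events[p]? = some e := by
      rw [← List.head?_drop, hE]; rfl
    have hp := (List.getElem?_eq_some_iff.1 he).1
    have h1 := (h.invariants hD hν hp.le).1
    have h2 := sweepToA_block ν p (sweepCoeff D.events ν c p) h1.upper (D.fits_of_getElem? he)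
    have hQ := h1.right_ok hν he (h p e he) (sweepCoeff D.events ν c p)
    -- The bounds on right-hand handleslides refer to the strands after the event. Their number
    -- changes at cusps only, where there are no such handleslides.
    have hn : e.next (D.strands p) = D.strands p ∨ (∃ k, e = .leftCusp k) ∨ ∃ k b, e = .rightCusp k b := by
      cases e <;> simp [FrontEvent.next]
    have hQ' : ∀ s ∈ (sweepState D.events ν c p).srRight ν p (sweepCoeff D.events ν c p) e,
        s.top < s.bot ∧ s.bot < D.strands p := by
      intro s hs
      rcases hn with hn | ⟨k, rfl⟩ | ⟨k, b, rfl⟩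
      · rw [hn] at hQ; exact (hQ s hs).1
      · simp [srRight] at hs
      · simp [srRight] at hs
    have h3 := ih (p + 1) (by rw [← List.drop_drop, hE]; rfl)
    rw [assembleFrom_cons, assembleFrom_cons, srLeftAt_eq ν c he, srRightAt_eq ν c he,
      aLeftAt_eq ν c he]
    refine (h2 hQ' _).trans ?_
    rw [← sweepState_succ ν c he, ← D.strands_succ he, h3]
    simp [aBlock]

theorem sweepToSR_assembleFrom {D : Front} {a b : ℕ} (hD : PlatShape D a b) {m : ℕ}
    {ν : ℕ → ℕ → ZMod m} (hν : IsPotential D ν) {c : ℕ → SlideCollection F → F}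
    (h : EventsOk D ν c) (E : List FrontEvent) (p : ℕ) (hE : D.events.drop p = E) :
    sweepToSR ν p (D.strands p) (sweepState D.events ν c p).inv (sweepState D.events ν c p).diff
        (-(sweepState D.events ν c p).coll) (assembleFrom p E (aLeftAt D.events ν c) fun _ => []) =
      assembleFrom p E (srLeftAt D.events ν c) (srRightAt D.events ν c) := by
  induction E generalizing p with
  | nil => simp [assembleFrom, sweepToSR]
  | cons e E ih =>
    have he : D.events[p]? = some e := by
      rw [← List.head?_drop, hE]; rfl
    have hp := (List.getElem?_eq_some_iff.1 he).1
    have h1 := (h.invariants hD hν hp.le).1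
    have h2 := sweepToSR_block ν p (sweepCoeff D.events ν c p) h1.upper (D.fits_of_getElem? he)
    have hQ := h1.right_ok hν he (h p e he) (sweepCoeff D.events ν c p)
    have hn : e.next (D.strands p) = D.strands p ∨ (∃ k, e = .leftCusp k) ∨ ∃ k b, e = .rightCusp k b := by
      cases e <;> simp [FrontEvent.next]
    have hQ' : ∀ s ∈ (sweepState D.events ν c p).srRight ν p (sweepCoeff D.events ν c p) e,
        s.top < s.bot ∧ s.bot < D.strands p := by
      intro s hs
      rcases hn with hn | ⟨k, rfl⟩ | ⟨k, b, rfl⟩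
      · rw [hn] at hQ; exact (hQ s hs).1
      · simp [srRight] at hs
      · simp [srRight] at hs
    have h3 := ih (p + 1) (by rw [← List.drop_drop, hE]; rfl)
    rw [assembleFrom_cons, assembleFrom_cons, srLeftAt_eq ν c he, srRightAt_eq ν c he,
      aLeftAt_eq ν c he, List.map_nil, List.append_nil]
    refine (h2 hQ' _).trans ?_
    rw [← sweepState_succ ν c he, ← D.strands_succ he, h3]
    rfl

theorem sweepToA_srTangles {D : Front} {a b : ℕ} (hD : PlatShape D a b) {m : ℕ}
    {ν : ℕ → ℕ → ZMod m} (hν : IsPotential D ν) {c : ℕ → SlideCollection F → F}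
    (h : EventsOk D ν c) :
    sweepToA ν 0 0 0 (srTangles D.events ν c) = aTangles D.events ν c :=
  sweepToA_assembleFrom hD hν h D.events 0 rfl

theorem sweepToSR_aTangles {D : Front} {a b : ℕ} (hD : PlatShape D a b) {m : ℕ}
    {ν : ℕ → ℕ → ZMod m} (hν : IsPotential D ν) {c : ℕ → SlideCollection F → F}
    (h : EventsOk D ν c) :
    sweepToSR ν 0 0 id 0 0 (aTangles D.events ν c) = srTangles D.events ν c := by
  have h1 := sweepToSR_assembleFrom hD hν h D.events 0 rfl
  rwa [show -(sweepState D.events ν c 0).coll = 0 from neg_zero] at h1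

theorem mem_assemble {E : List FrontEvent} {L Q : ℕ → List (Handleslide F)} {l : ℕ}
    {h : Handleslide F} (hl : (assemble E L Q)[l]? = some (.slide h)) : ∃ p < E.length,
      (h ∈ L p ∧ sliceIndex (assemble E L Q) l = p) ∨
      (h ∈ Q p ∧ sliceIndex (assemble E L Q) l = p + 1) := by
  have h1 := mem_assemble_take (E := E) (L := L) (Q := Q) (l := l) (h := h) le_rfl
  rw [List.take_length] at h1
  exact h1 hl

/-! ## A-form -/

/-- The A-form coefficients are free parameters, so `s = V k (k + 1) + r` can be solved for `r` at
each event in turn. -/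
theorem exists_eq_aTangles {D : Front} {a b : ℕ} (hD : PlatShape D a b) {m : ℕ}
    {ν : ℕ → ℕ → ZMod m} (hν : IsPotential D ν) {C : MCS D F} (hC : C.IsAForm ν) :
    ∃ c : ℕ → SlideCollection F → F, EventsOk D ν c ∧ C.tangles = aTangles D.events ν c := by
  obtain ⟨hs, L, hT, hL⟩ := hC
  -- The collection is an argument of `c`, so no recursion is needed to subtract its entry. The
  -- default 0 occurs at events without A-form handleslide, where the coefficient plays no role.
  let c : ℕ → SlideCollection F → F := fun p V =>
    ((L p).head?.map fun h => h.coeff - V h.top h.bot).getD 0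
  have key : C.tangles = aTangles D.events ν c := by
    rw [hT]
    refine assemble_congr fun p hp => ⟨?_, rfl⟩
    have he : D.events[p]? = some D.events[p] := List.getElem?_eq_getElem hp
    have h1 := hL p hp
    rw [aLeftAt_eq ν c he]
    cases e : D.events[p] with
    | leftCusp k => rw [e] at h1; exact h1
    | crossing k =>
      rw [e, AFormAt] at h1
      split_ifs at h1 with hg
      · obtain ⟨r, h1⟩ := h1
        simp [aLeft, hg, h1, sweepCoeff, c]
      · simp [aLeft, hg, h1]
    | rightCusp k x =>
      rw [e, AFormAt] at h1
      split_ifs at h1 with hm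
      · obtain ⟨r, h1⟩ := h1
        simp [aLeft, hm, h1, sweepCoeff, c]
      · simp [aLeft, hm, h1]
  exact ⟨c, (eventsOk_iff_good_aTangles hD hν c).2 (key ▸ C.good hs), key⟩

theorem exists_mcs_aTangles {D : Front} {a b : ℕ} (hD : PlatShape D a b) {m : ℕ}
    {ν : ℕ → ℕ → ZMod m} (hν : IsPotential D ν) {c : ℕ → SlideCollection F → F}
    (h : EventsOk D ν c) :
    ∃ C : MCS D F, C.tangles = aTangles D.events ν c ∧ C.IsGraded ν ∧ C.IsAForm ν := by
  obtain ⟨C, hT, hs⟩ := MCS.exists_of_good (filterMap_assemble _ _ _)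
    ((eventsOk_iff_good_aTangles hD hν c).1 h)
  refine ⟨C, hT, C.isGraded_of_slides hν hs ?_, hs, _, hT, ?_⟩
  · intro l s hl
    rw [hT] at hl ⊢
    obtain ⟨p, hp, ⟨h1, h2⟩ | ⟨h1, -⟩⟩ := mem_assemble hl
    · have he : D.events[p]? = some D.events[p] := List.getElem?_eq_getElem hp
      rw [aLeftAt_eq ν c he] at h1
      rw [h2]
      exact (aLeft_ok (D.fits_of_getElem? he) _ s h1).2
    · simp at h1
  · intro p hp
    have he : D.events[p]? = some D.events[p] := List.getElem?_eq_getElem hp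
    rw [aLeftAt_eq ν c he]
    cases e : D.events[p] with
    | leftCusp k => rfl
    | crossing k =>
      simp only [AFormAt, aLeft]
      split_ifs with hg
      · exact ⟨_, rfl⟩
      · rfl
    | rightCusp k x =>
      simp only [AFormAt, aLeft]
      split_ifs with hg
      · exact ⟨_, rfl⟩
      · rfl

/-! ## SR-form -/

theorem Front.normality_congr {π π' : ℕ → ℕ} {k : ℕ} (h : π k = π' k) (h' : π (k + 1) = π' (k + 1)) :
    Normality π k ↔ Normality π' k := by
  rw [Normality, Normality, h, h']

theorem switchTail_congr {π π' : ℕ → ℕ} {k : ℕ} (h : π k = π' k) (h' : π (k + 1) = π' (k + 1))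
    (d : ℕ → ℕ → F) (r : F) : switchTail π d k r = switchTail π' d k r := by
  rw [switchTail, switchTail, h, h']

theorem returnTail_congr {π π' : ℕ → ℕ} {k : ℕ} (h : π k = π' k) (h' : π (k + 1) = π' (k + 1))
    (d : ℕ → ℕ → F) (r : F) : returnTail π d k r = returnTail π' d k r := by
  rw [returnTail, returnTail, h, h']

theorem nextInvolution_crossing_eq {n k : ℕ} {π : ℕ → ℕ} (h : IsPairing n π) (hk : k + 1 < n)
    (hne : π k ≠ k + 1) : nextInvolution π (.crossing k) k = π (k + 1) ∧
      nextInvolution π (.crossing k) (k + 1) = π k := by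
  obtain ⟨-, h1, h2, h3, -⟩ := h.crossing_cases hk hne
  simp [nextInvolution, swapStrand, h1, h2, h3, hne]

/-- The crossing exchanges the companions of `k` and `k + 1`. Of their six possible relative
positions three are normal, and the exchange maps these to the other three. -/
theorem normality_nextInvolution {n k : ℕ} {π : ℕ → ℕ} (h : IsPairing n π) (hk : k + 1 < n)
    (hne : π k ≠ k + 1) :
    Front.Normality (nextInvolution π (.crossing k)) k ↔ ¬ Front.Normality π k := by
  obtain ⟨e1, e2⟩ := nextInvolution_crossing_eq h hk hne
  obtain ⟨-, h1, h2, h3, h4⟩ := h.crossing_cases hk hne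
  rw [Front.Normality, Front.Normality, e1, e2]
  omega

/-- A family of involutions that arises from the sweep, and its switches and returns. -/
theorem isSwitch_iff {D : Front} {m : ℕ} {ν : ℕ → ℕ → ZMod m} {c : ℕ → SlideCollection F → F}
    {ρ : ℕ → ℕ → ℕ} {p k : ℕ} (he : D.events[p]? = some (.crossing k))
    (h : IsPairing (D.strands p) (sweepState D.events ν c p).inv)
    (hne : (sweepState D.events ν c p).inv k ≠ k + 1)
    (hρ : ∀ i < D.strands p, ρ p i = (sweepState D.events ν c p).inv i)
    (hρ' : ∀ i < D.strands p, ρ (p + 1) i = (sweepState D.events ν c (p + 1)).inv i) :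
    D.IsSwitch ρ p k ↔ Front.GradedCrossing ν p k ∧
      Front.Normality (sweepState D.events ν c p).inv k ∧ sweepCoeff D.events ν c p ≠ 0 := by
  have hk : k + 1 < D.strands p := D.fits_of_getElem? he
  have h1 := Front.normality_congr (hρ k (by omega)) (hρ (k + 1) hk)
  have h2 : (sweepState D.events ν c (p + 1)).inv =
      invAfter ν p (sweepState D.events ν c p) (sweepCoeff D.events ν c p) (.crossing k) := by
    rw [sweepState_succ ν c he]; rfl
  rw [Front.IsSwitch, h1]
  constructor
  · rintro ⟨h3, h4⟩
    -- Otherwise the sweep conjugates the involution, which gives `k` the former companion of `k +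
    -- 1`; a switch would force the two companions to be equal.
    by_contra hc
    have h5 := h3 k (by omega)
    rw [hρ' k (by omega), hρ k (by omega), h2, invAfter, if_neg hc,
      (nextInvolution_crossing_eq h hk hne).1] at h5
    exact (h.crossing_cases hk hne).2.2.2.2 h5.symm
  · rintro ⟨h3, h4, h5⟩
    refine ⟨fun i hi => ?_, h4⟩
    rw [hρ' i hi, hρ i hi, h2, invAfter, if_pos ⟨h3, h4, h5⟩]

theorem isReturn_iff {D : Front} {m : ℕ} {ν : ℕ → ℕ → ZMod m} {c : ℕ → SlideCollection F → F}
    {ρ : ℕ → ℕ → ℕ} {p k : ℕ} (he : D.events[p]? = some (.crossing k))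
    (h : IsPairing (D.strands p) (sweepState D.events ν c p).inv)
    (hne : (sweepState D.events ν c p).inv k ≠ k + 1)
    (hρ : ∀ i < D.strands p, ρ p i = (sweepState D.events ν c p).inv i)
    (hρ' : ∀ i < D.strands p, ρ (p + 1) i = (sweepState D.events ν c (p + 1)).inv i) :
    D.IsReturn ρ p k ↔ ¬ Front.Normality (sweepState D.events ν c p).inv k := by
  have hk : k + 1 < D.strands p := D.fits_of_getElem? he
  have h2 : (sweepState D.events ν c (p + 1)).inv =
      invAfter ν p (sweepState D.events ν c p) (sweepCoeff D.events ν c p) (.crossing k) := by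
    rw [sweepState_succ ν c he]; rfl
  rw [Front.IsReturn, isSwitch_iff he h hne hρ hρ',
    Front.normality_congr (hρ' k (by omega)) (hρ' (k + 1) hk), h2, invAfter]
  split_ifs with hc
  · tauto
  · rw [normality_nextInvolution h hk hne]
    tauto

theorem MCS.coeffAt_assemble {D : Front} {L Q : ℕ → List (Handleslide F)} {C : MCS D F}
    (hs : C.SimpleLeftCusps) (hT : C.tangles = assemble D.events L Q) (p : ℕ) :
    C.coeffAt (assemble (D.events.take p) L Q).length =
      (assemble (D.events.take p) L Q).foldl nextDifferential 0 := by
  obtain ⟨T, h⟩ : ∃ T, assemble D.events L Q = assemble (D.events.take p) L Q ++ T := by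
    conv => enter [1, T, 1]; rw [← List.take_append_drop p D.events]
    rw [assemble, List.zipIdx_append, List.flatMap_append]
    exact ⟨_, rfl⟩
  rw [C.coeffAt_eq hs (by rw [hT, h]; simp), hT, h, List.take_left']
  rfl

theorem EventsOk.isNormalRuling {D : Front} {a b : ℕ} (hD : PlatShape D a b) {m : ℕ}
    {ν : ℕ → ℕ → ZMod m} (hν : IsPotential D ν) {c : ℕ → SlideCollection F → F}
    (h : EventsOk D ν c) : D.IsNormalRuling fun p => (sweepState D.events ν c p).inv := by
  refine ⟨fun p hp i hi => ((h.invariants hD hν hp).1.pairing i hi).1,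
    fun p hp i hi => ((h.invariants hD hν hp).1.pairing i hi).2.1,
    fun p hp i hi => ((h.invariants hD hν hp).1.pairing i hi).2.2, fun p hp => ?_⟩
  have he : D.events[p]? = some D.events[p] := List.getElem?_eq_getElem hp
  have h1 := (h.invariants hD hν hp.le).1
  have hok := h p _ he
  have hn := D.strands_succ he
  have h2 : (sweepState D.events ν c (p + 1)).inv =
      invAfter ν p (sweepState D.events ν c p) (sweepCoeff D.events ν c p) D.events[p] := by
    rw [sweepState_succ ν c he]; rfl
  generalize D.events[p] = e at *
  match e with
  | .leftCusp k =>
    simp only [Front.RulingStep, h2, invAfter, nextInvolution, if_true, true_and]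
    intro i _
    simp [skipStrand_ne, skipStrand_ne_succ, unskipStrand_skipStrand]
  | .rightCusp k x =>
    have hk : k + 1 < D.strands p := hok.1
    have hk0 : (sweepState D.events ν c p).diff k (k + 1) ≠ 0 := by
      have h3 := hok.2
      cases x <;> simp_all
    have hπ := ((h1.paired k (k + 1)).1 hk0).2.2.symm
    refine ⟨hπ, fun i hi => ?_⟩
    have hn' : D.strands p = D.strands (p + 1) + 2 := by
      rw [hn, FrontEvent.next]; omega
    have h3 := h1.pairing
    rw [hn'] at h3 hk
    simp only [h2, invAfter, nextInvolution]
    exact (h3.skip_inv_skip (by omega) hπ hi).symm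
  | .crossing k =>
    have hk : k + 1 < D.strands p := hok.1
    refine ⟨h1.paired.inv_ne hk hok.2, ?_⟩
    -- Either the sweep keeps the involution and normality is part of the reason, or it conjugates:
    -- these are the alternatives of a normal ruling.
    by_cases hc : Front.GradedCrossing ν p k ∧ Front.Normality (sweepState D.events ν c p).inv k ∧
        sweepCoeff D.events ν c p ≠ 0
    · refine .inr ⟨fun i _ => ?_, hc.2.1⟩
      simp only [h2, invAfter, if_pos hc]
    · refine .inl fun i _ => ?_
      simp only [h2, invAfter, if_neg hc]
      rfl

theorem exists_mcs_srTangles {D : Front} {a b : ℕ} (hD : PlatShape D a b) {m : ℕ}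
    {ν : ℕ → ℕ → ZMod m} (hν : IsPotential D ν) {c : ℕ → SlideCollection F → F}
    (h : EventsOk D ν c) :
    ∃ C : MCS D F, C.tangles = srTangles D.events ν c ∧ C.IsGraded ν ∧
      ∃ ρ, D.IsNormalRuling ρ ∧ D.IsGradedRuling ν ρ ∧ C.IsSRForm ν ρ := by
  obtain ⟨C, hT, hs⟩ := MCS.exists_of_good (filterMap_assemble _ _ _)
    ((eventsOk_iff_good_srTangles hD hν c).1 h)
  have hsw : ∀ p k, D.events[p]? = some (FrontEvent.crossing k) → _ := fun p k he =>
    have hp := (List.getElem?_eq_some_iff.1 he).1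
    have h1 := (h.invariants hD hν hp.le).1
    have hok := h p _ he
    isSwitch_iff (ρ := fun p => (sweepState D.events ν c p).inv) he h1.pairing
      (h1.paired.inv_ne hok.1 hok.2) (fun _ _ => rfl) fun _ _ => rfl
  have hret : ∀ p k, D.events[p]? = some (FrontEvent.crossing k) → _ := fun p k he =>
    have hp := (List.getElem?_eq_some_iff.1 he).1
    have h1 := (h.invariants hD hν hp.le).1
    have hok := h p _ he
    isReturn_iff (ρ := fun p => (sweepState D.events ν c p).inv) he h1.pairing
      (h1.paired.inv_ne hok.1 hok.2) (fun _ _ => rfl) fun _ _ => rfl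
  refine ⟨C, hT, C.isGraded_of_slides hν hs ?_, _, h.isNormalRuling hD hν,
    fun p k he hS => ((hsw p k he).1 hS).1, hs, _, _, hT, ?_⟩
  · intro l s hl
    rw [hT] at hl ⊢
    obtain ⟨p, hp, h12⟩ := mem_assemble hl
    have he : D.events[p]? = some D.events[p] := List.getElem?_eq_getElem hp
    rcases h12 with ⟨h1, h2⟩ | ⟨h1, h2⟩
    · rw [srLeftAt_eq ν c he] at h1
      rw [h2]
      exact (SRInv.left_ok (D.fits_of_getElem? he) _ s h1).2
    · rw [srRightAt_eq ν c he] at h1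
      rw [h2]
      exact ((h.invariants hD hν hp.le).1.right_ok hν he (h p _ he) _ s h1).2
  · intro p hp
    have he : D.events[p]? = some D.events[p] := List.getElem?_eq_getElem hp
    rw [MCS.coeffAt_assemble hs hT, ← sweepState_diff, srLeftAt_eq ν c he, srRightAt_eq ν c he]
    generalize D.events[p] = e at *
    match e with
    | .leftCusp k => exact ⟨rfl, rfl⟩
    | .rightCusp k x =>
      refine ⟨?_, rfl⟩
      simp only [srLeft]
      split_ifs
      · exact ⟨_, rfl⟩
      · rfl
    | .crossing k =>
      simp only [SRFormAt, srLeft, srRight]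
      rw [hsw p k he, hret p k he]
      by_cases h1 : Front.GradedCrossing ν p k <;>
        by_cases h2 : Front.Normality (sweepState D.events ν c p).inv k <;>
        by_cases h3 : sweepCoeff D.events ν c p = 0 <;> simp [h1, h2, h3]

/-- An MCS in SR-form, compatible with a graded normal ruling, is given by a sweep. -/
theorem exists_eq_srTangles {D : Front} {a b : ℕ} (hD : PlatShape D a b) {m : ℕ}
    {ν : ℕ → ℕ → ZMod m} (hν : IsPotential D ν) {C : MCS D F} {ρ : ℕ → ℕ → ℕ}
    (hρ : D.IsNormalRuling ρ) (hg : D.IsGradedRuling ν ρ) (hC : C.IsSRForm ν ρ) :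
    ∃ c : ℕ → SlideCollection F → F, EventsOk D ν c ∧ C.tangles = srTangles D.events ν c := by
  obtain ⟨hs, L, Q, hT, hLQ⟩ := hC
  have hgood := C.good hs
  rw [hT, good_assemble_iff] at hgood
  -- The SR-form coefficient is read off directly. The default 0 matters at departures: there it
  -- tells the sweep not to switch.
  let c : ℕ → SlideCollection F → F := fun p _ => ((L p).head?.map Handleslide.coeff).getD 0
  -- The induction must carry everything at once: the SR-form handleslides depend on the ruling and
  -- on the differential, which depends on the earlier handleslides, and the invariants depend on
  -- the earlier local conditions.
  have key : ∀ p ≤ D.events.length,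
      (∀ i < D.strands p, ρ p i = (sweepState D.events ν c p).inv i) ∧
      ∀ q < p, L q = srLeftAt D.events ν c q ∧ Q q = srRightAt D.events ν c q ∧
        ∀ e, D.events[q]? = some e →
          StepOk (D.strands q) (sweepState D.events ν c q).diff (.front e) := by
    intro p
    induction p with
    | zero => exact fun _ => ⟨fun i hi => absurd hi (Nat.not_lt_zero i), fun q hq => by omega⟩
    | succ p ih =>
      intro hp
      obtain ⟨ih1, ih2⟩ := ih (by omega)
      have he : D.events[p]? = some D.events[p] := List.getElem?_eq_getElem hp
      have hd : (assemble (D.events.take p) L Q).foldl nextDifferential 0 =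
          (sweepState D.events ν c p).diff := by
        rw [sweepState_diff, assemble_congr fun q hq => ?_]
        have hq' : q < p := by
          rw [List.length_take] at hq; omega
        exact ⟨(ih2 q hq').1, (ih2 q hq').2.1⟩
      have hinv := (sweepInvariants hD hν (c := c) (by omega : p ≤ D.events.length)
        fun q hq => (ih2 q hq).2.2).1
      have hok : StepOk (D.strands p) (sweepState D.events ν c p).diff
          (.front D.events[p]) := by
        have h1 := hgood p _ he
        rw [hd, good_append] at h1
        exact stepOk_of_good_slides hinv.diff.upper h1.1
      have hform := hLQ p hp
      rw [MCS.coeffAt_assemble hs hT, hd] at hform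
      have hstep := hρ.step p hp
      have hn := D.strands_succ he
      have h2 : (sweepState D.events ν c (p + 1)).inv =
          invAfter ν p (sweepState D.events ν c p) (sweepCoeff D.events ν c p) D.events[p] := by
        rw [sweepState_succ ν c he]; rfl
      have hfix := hρ.involutive (p + 1) hp
      suffices h : (∀ i < D.strands (p + 1), ρ (p + 1) i =
            invAfter ν p (sweepState D.events ν c p) (sweepCoeff D.events ν c p) D.events[p] i) ∧
          L p = (sweepState D.events ν c p).srLeft ν p (sweepCoeff D.events ν c p) D.events[p] ∧
          Q p = (sweepState D.events ν c p).srRight ν p (sweepCoeff D.events ν c p)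
            D.events[p] by
        refine ⟨fun i hi => by rw [h.1 i hi, h2], fun q hq => ?_⟩
        rcases Nat.lt_succ_iff_lt_or_eq.1 hq with hq | rfl
        · exact ih2 q hq
        · rw [srLeftAt_eq ν c he, srRightAt_eq ν c he]
          refine ⟨h.2.1, h.2.2, fun e' he' => ?_⟩
          rw [he] at he'
          cases he'
          exact hok
      have hc : sweepCoeff D.events ν c p = ((L p).head?.map Handleslide.coeff).getD 0 := rfl
      generalize D.events[p] = e at *
      match e with
      | .leftCusp k =>
        have hk : k ≤ D.strands p := hok
        refine ⟨fun i hi => ?_, hform⟩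
        rw [hn, FrontEvent.next] at hi hfix
        simp only [invAfter, nextInvolution]
        by_cases i1 : i = k
        · rw [if_pos i1, i1, hstep.1]
        by_cases i2 : i = k + 1
        -- The ruling prescribes the image of `k` only; that of `k + 1` follows since `ρ (p + 1)` is
        -- an involution.
        · rw [if_neg i1, if_pos i2, i2, ← hstep.1]
          exact hfix k (by omega)
        rw [if_neg i1, if_neg i2]
        obtain ⟨i, rfl⟩ : ∃ i', i = skipStrand k i' := ⟨_, (skipStrand_unskipStrand i1 i2).symm⟩
        rw [skipStrand_lt hk] at hi
        rw [hstep.2 i hi, unskipStrand_skipStrand, ih1 i hi]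
      | .rightCusp k x =>
        have hk : k + 1 < D.strands p := hok.1
        have hn' : D.strands p = D.strands (p + 1) + 2 := by
          rw [hn, FrontEvent.next]; omega
        refine ⟨fun i hi => ?_, ?_, hform.2⟩
        · simp only [invAfter, nextInvolution]
          have h3 : skipStrand k i < D.strands p := by
            rw [hn', skipStrand_lt (by omega)]; exact hi
          rw [← ih1 _ h3, hstep.2 i hi, unskipStrand_skipStrand]
        · have h3 := hform.1
          simp only [srLeft]
          split_ifs at h3 ⊢
          · obtain ⟨r, h3⟩ := h3
            simp [h3, hc]
          · exact h3
      | .crossing k =>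
        have hk : k + 1 < D.strands p := hok.1
        have hn' : D.strands (p + 1) = D.strands p := hn
        have e1 := ih1 k (by omega)
        have e2 := ih1 (k + 1) hk
        have hne := hinv.paired.inv_ne hk hok.2
        have hN := Front.normality_congr e1 e2
        rw [hn']
        simp only [SRFormAt, switchTail_congr e1 e2, returnTail_congr e1 e2] at hform
        by_cases hsw : D.IsSwitch ρ p k
        · rw [if_pos hsw] at hform
          obtain ⟨r, hr, hL, hQ⟩ := hform
          have hcr : sweepCoeff D.events ν c p = r := by simp [hc, hL]
          have hg' := hg p k he hsw
          have hN' := hN.1 hsw.2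
          rw [hcr]
          refine ⟨fun i hi => ?_, ?_, ?_⟩
          · simp only [invAfter, hg', hN', hr, ne_eq, not_false_eq_true, and_self, if_true]
            rw [hsw.1 i hi, ih1 i hi]
          · simp [srLeft, hg', hr, hL]
          · simp [srRight, hg', hN', hr, hQ]
        · rw [if_neg hsw] at hform
          have hconj : ∀ i < D.strands p, ρ (p + 1) i =
              nextInvolution (sweepState D.events ν c p).inv (.crossing k) i := by
            intro i hi
            rw [hstep.2.resolve_right hsw i hi, ih1 _ ((swapStrand_lt hk).2 hi)]
            rfl
          -- Without a switch the involution is conjugated, so normality after the crossing is the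
          -- failure of normality before it.
          have hret : D.IsReturn ρ p k ↔ ¬ Front.Normality (sweepState D.events ν c p).inv k := by
            rw [Front.IsReturn, ← normality_nextInvolution hinv.pairing hk hne,
              ← Front.normality_congr (hconj k (by omega)) (hconj (k + 1) hk)]
            exact and_iff_right hsw
          rw [hret] at hform
          by_cases hg' : Front.GradedCrossing ν p k
          · by_cases hN' : Front.Normality (sweepState D.events ν c p).inv k
            · simp only [hN', not_true_eq_false, false_and, if_false] at hform
              have hcr : sweepCoeff D.events ν c p = 0 := by simp [hc, hform.1]
              rw [hcr]
              refine ⟨fun i hi => ?_, ?_, ?_⟩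
              · simp [invAfter, hconj i hi]
              · simp [srLeft, hN', hform.1]
              · simp [srRight, hN', hform.2]
            · simp only [hN', hg', not_false_eq_true, and_self, if_true] at hform
              obtain ⟨r, hL, hQ⟩ := hform
              have hcr : sweepCoeff D.events ν c p = r := by simp [hc, hL]
              rw [hcr]
              refine ⟨fun i hi => ?_, ?_, ?_⟩
              · simp [invAfter, hN', hconj i hi]
              · simp [srLeft, hN', hg', hL]
              · simp [srRight, hN', hg', hQ]
          · simp only [hg', and_false, if_false] at hform
            refine ⟨fun i hi => ?_, ?_, ?_⟩
            · simp [invAfter, hg', hconj i hi]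
            · simp [srLeft, hg', hform.1]
            · simp [srRight, hg', hform.2]
  have h := (key D.events.length le_rfl).2
  refine ⟨c, fun p e he => (h p (List.getElem?_eq_some_iff.1 he).1).2.2 e he, ?_⟩
  rw [hT]
  exact assemble_congr fun p hp => ⟨(h p hp).1, (h p hp).2.1⟩

end Correspondence

/-! ### The theorem -/

theorem theorem6p1 {F : Type*} [Field F] [DecidableEq F] (D : Front) (hD : D.NearlyPlat)
    (μ : D.MaslovPotential) (m : ℕ) (hm : m ∣ 2 * D.rotationNumber) :
    ∃ (Φ : SRFormMCS μ m F → AFormMCS μ m F) (Ψ : AFormMCS μ m F → SRFormMCS μ m F),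
      (∀ C, (Φ C).1.tangles = C.1.phiTangles (μ.mod m)) ∧
      (∀ C, (Ψ C).1.tangles = C.1.psiTangles (μ.mod m)) ∧
      Function.LeftInverse Ψ Φ ∧ Function.RightInverse Ψ Φ := by
  obtain ⟨a, b, hab⟩ := hD.exists_shape
  have hν := μ.isPotential hm
  -- Both directions of the correspondence are recorded together with the fact that the other sweep
  -- restores the handleslides of `C`; this already contains the inverse property.
  have toA : ∀ C : SRFormMCS μ m F, ∃ C' : AFormMCS μ m F,
      C'.1.tangles = C.1.phiTangles (μ.mod m) ∧ C'.1.psiTangles (μ.mod m) = C.1.tangles := by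
    rintro ⟨C, -, ρ, hρ, hg, hC⟩
    obtain ⟨c, hc, hT⟩ := exists_eq_srTangles hab hν hρ hg hC
    obtain ⟨C', hT', hC'⟩ := exists_mcs_aTangles hab hν hc
    refine ⟨⟨C', hC'⟩, ?_, ?_⟩
    · rw [MCS.phiTangles, hT, hT', sweepToA_srTangles hab hν hc]
    · rw [MCS.psiTangles, hT, hT', sweepToSR_aTangles hab hν hc]
  have toSR : ∀ C : AFormMCS μ m F, ∃ C' : SRFormMCS μ m F,
      C'.1.tangles = C.1.psiTangles (μ.mod m) ∧ C'.1.phiTangles (μ.mod m) = C.1.tangles := by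
    rintro ⟨C, -, hC⟩
    obtain ⟨c, hc, hT⟩ := exists_eq_aTangles hab hν hC
    obtain ⟨C', hT', hC'⟩ := exists_mcs_srTangles hab hν hc
    refine ⟨⟨C', hC'⟩, ?_, ?_⟩
    · rw [MCS.psiTangles, hT, hT', sweepToSR_aTangles hab hν hc]
    · rw [MCS.phiTangles, hT, hT', sweepToA_srTangles hab hν hc]
  choose Φ hΦ hΦ' using toA
  choose Ψ hΨ hΨ' using toSR
  refine ⟨Φ, Ψ, hΦ, hΨ, fun C => Subtype.ext ?_, fun C => Subtype.ext ?_⟩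
  -- The compatible rulings of the two MCSs need not be compared: simple left cusps and equal
  -- tangles determine the MCS.
  · obtain ⟨_, _, _, h1⟩ := (Ψ (Φ C)).2.2
    obtain ⟨_, _, _, h2⟩ := C.2.2
    exact MCS.ext_of_tangles h1.1 h2.1 (by rw [hΨ, hΦ'])
  · exact MCS.ext_of_tangles (Φ (Ψ C)).2.2.1 C.2.2.1 (by rw [hΦ, hΨ'])
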